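/- Let $X,Y$ be complex Banach spaces, let $p\in[1,\infty]$ (with $1/\infty=0$), and let $A$ be a densely defined sectorial operator of type $\omega<\pi/2$ with dense range on $X$; that is, $0\le\omega<\pi/2$, $A$ is closed, $\sigma(A)\subseteq\overline{S(\omega)}$ and $\sup\{\|\lambda R(\lambda,A)\|:|\arg\lambda|\ge\nu\}<\infty$ for all $\nu\in(\omega,\pi)$, where $S(\omega)=\{z\neq0:|\arg z|<\omega\}$ for $\omega>0$ and $S(0)=(0,\infty)$. Let $(T(t))_{t\ge0}$ be the bounded analytic semigroup generated by $-A$. Let $k\ge1$ be an integer, let $X_k$ be $D(A^k)$ with the norm $\|(I+A)^k\,\cdot\,\|_X$, let $C\in B(X_k,Y)$, and let $\alpha\in(-\tfrac1p,\,k-\tfrac1p)$. Put $$W_C=\{t^{k-\alpha-1/p}\,C(t+A)^{-k}:\ t>0\}\subseteq B(X,Y).$$ We call $C$ *$L^p$-admissible of type $\alpha$ for $A$* if there is $M>0$ such that $\|t\mapsto t^{\alpha}CT(t)x\|_{L^p([0,\tau],Y)}\le M\|x\|_X$ for all $\tau>0$ and all $x\in X_k$. We say that $A$ satisfies *$L^p_*$-estimates*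 if, where $A$ is sectorial of type $\omega$, for some $\nu\in(\omega,\pi)$ and some non-zero $\psi\in H_0^\infty(S(\nu))$ (bounded holomorphic on $S(\nu)$ with $|\psi(z)|\le c\,|z|^s/(1+|z|^{2s})$ for some $c,s>0$) there is $L\ge0$ with $\|t\mapsto\psi(tA)x\|_{L^p((0,\infty),dt/t;X)}\le L\|x\|_X$ for all $x\in X$; here $\psi(tA)$ is defined by the Dunford integral $\frac1{2\pi i}\int_{\partial S(\theta)}\psi(tz)R(z,A)\,dz$, $\omega<\theta<\nu$. Then: (a) If $C$ is $L^p$-admissible of type $\alpha$ for $A$, then $W_C$ is bounded in $B(X,Y)$. (b) If $A$ satisfies $L^p_*$-estimates and $W_C$ is bounded in $B(X,Y)$, then $C$ is $L^p$-admissible of type $\alpha$ for $A$. -/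

import Mathlib

open Set Filter Topology MeasureTheory
open scoped NNReal ENNReal

noncomputable section

namespace SectorialObs

section Operators

variable {X : Type*} [NormedAddCommGroup X] [NormedSpace ℂ X]

/-! ### Resolvents and sectorial operators -/

/-- `R` is the bounded two-sided inverse `(z - A)⁻¹` of `z - A : D(A) → X`. -/
def IsResolventAt (A : X →ₗ.[ℂ] X) (z : ℂ) (R : X →L[ℂ] X) : Prop :=
  (∀ x : X, ∃ h : R x ∈ A.domain, z • R x - A ⟨R x, h⟩ = x) ∧
    ∀ x : A.domain, R (z • (x : X) - A x) = x

/-- The resolvent set `ρ(A)`. -/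
def resolventSet (A : X →ₗ.[ℂ] X) : Set ℂ := {z | ∃ R : X →L[ℂ] X, IsResolventAt A z R}

/-- The spectrum `σ(A)`. -/
def opSpectrum (A : X →ₗ.[ℂ] X) : Set ℂ := (resolventSet A)ᶜ

open Classical in
/-- The resolvent `R(z, A) = (z - A)⁻¹` for `z ∈ ρ(A)` (with the value `0` elsewhere). -/
def resolvent (A : X →ₗ.[ℂ] X) (z : ℂ) : X →L[ℂ] X :=
  if h : ∃ R : X →L[ℂ] X, IsResolventAt A z R then h.choose else 0

/-- The open sector `S(ω)` of half-angle `ω` for `ω > 0`, and `S(0) = (0, ∞)`. -/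
def sector (ω : ℝ) : Set ℂ :=
  if ω = 0 then {z | ∃ r : ℝ, 0 < r ∧ z = r} else {z | z ≠ 0 ∧ |z.arg| < ω}

/-- `A` is a sectorial operator of type `ω ∈ [0, π)`. -/
structure IsSectorial (A : X →ₗ.[ℂ] X) (ω : ℝ) : Prop where
  nonneg : 0 ≤ ω
  lt_pi : ω < Real.pi
  isClosed : A.IsClosed
  spectrum_subset : opSpectrum A ⊆ closure (sector ω)
  resolvent_bound : ∀ ν : ℝ, ω < ν → ν < Real.pi →
    ∃ M : ℝ, ∀ z : ℂ, ν ≤ |z.arg| → ‖z • resolvent A z‖ ≤ M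

/-! ### The spaces `X_k = D(A^k)` with the norm `‖(Id + A)^k x‖` -/

/-- The domain `D(A^k)`: `D(A^0) = X` and `D(A^(k+1)) = {x ∈ D(A) | A x ∈ D(A^k)}`. -/
def domPow (A : X →ₗ.[ℂ] X) : ℕ → Submodule ℂ X
  | 0 => ⊤
  | k + 1 => ((domPow A k).comap A.toFun).map A.domain.subtype

theorem mem_domPow_succ {A : X →ₗ.[ℂ] X} {k : ℕ} {x : X} :
    x ∈ domPow A (k + 1) ↔ ∃ h : x ∈ A.domain, A ⟨x, h⟩ ∈ domPow A k := by
  simp [domPow]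

theorem domPow_succ_le_domain (A : X →ₗ.[ℂ] X) (k : ℕ) : domPow A (k + 1) ≤ A.domain :=
  fun _ hx => (mem_domPow_succ.1 hx).1

theorem domPow_succ_le (A : X →ₗ.[ℂ] X) (k : ℕ) : domPow A (k + 1) ≤ domPow A k := by
  induction k with
  | zero => exact fun _ _ => Submodule.mem_top
  | succ k ih =>
    intro x hx
    obtain ⟨h, h'⟩ := mem_domPow_succ.1 hx
    exact mem_domPow_succ.2 ⟨h, ih h'⟩

/-- The map `x ↦ x + A x` from `D(A^(k+1))` to `D(A^k)`. -/
def idAddStep (A : X →ₗ.[ℂ] X) (k : ℕ) : domPow A (k + 1) →ₗ[ℂ] domPow A k :=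
  LinearMap.codRestrict (domPow A k)
    ((domPow A (k + 1)).subtype +
      A.toFun ∘ₗ Submodule.inclusion (domPow_succ_le_domain A k))
    (fun x => (domPow A k).add_mem (domPow_succ_le A k x.2) (mem_domPow_succ.1 x.2).2)

/-- The operator `(Id + A)^k` on `D(A^k)`. -/
def idAddPow (A : X →ₗ.[ℂ] X) : (k : ℕ) → domPow A k →ₗ[ℂ] X
  | 0 => (domPow A 0).subtype
  | k + 1 => idAddPow A k ∘ₗ idAddStep A k

/-- The space `X_k(A)`: the vector space `D(A^k)`, normed by `x ↦ ‖(Id + A)^k x‖`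
(and not by the norm of `X`). In general this is a seminorm; it is a norm as soon as
`-1 ∈ ρ(A)`, in particular for every sectorial `A`. -/
def DomSpace (A : X →ₗ.[ℂ] X) (k : ℕ) : Type _ := ↥(domPow A k)

namespace DomSpace

instance (A : X →ₗ.[ℂ] X) (k : ℕ) : AddCommGroup (DomSpace A k) :=
  inferInstanceAs (AddCommGroup ↥(domPow A k))

instance (A : X →ₗ.[ℂ] X) (k : ℕ) : Module ℂ (DomSpace A k) :=
  inferInstanceAs (Module ℂ ↥(domPow A k))

/-- `(Id + A)^k` as a linear map on `X_k`. -/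
def toX (A : X →ₗ.[ℂ] X) (k : ℕ) : DomSpace A k →ₗ[ℂ] X := idAddPow A k

/-- The inclusion of `X_k` into `X`. -/
def incl (A : X →ₗ.[ℂ] X) (k : ℕ) : DomSpace A k →ₗ[ℂ] X := (domPow A k).subtype

instance (A : X →ₗ.[ℂ] X) (k : ℕ) : SeminormedAddCommGroup (DomSpace A k) :=
  SeminormedAddCommGroup.induced (DomSpace A k) X (toX A k)

instance (A : X →ₗ.[ℂ] X) (k : ℕ) : NormedSpace ℂ (DomSpace A k) :=
  NormedSpace.induced ℂ (DomSpace A k) X (toX A k)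

theorem norm_def {A : X →ₗ.[ℂ] X} {k : ℕ} (x : DomSpace A k) : ‖x‖ = ‖toX A k x‖ := rfl

end DomSpace

/-! ### The operators `(z + A)^(-k)` as bounded operators from `X` to `X_k` -/

/-- `(z + A)⁻¹ = -R(-z, A)`. -/
def invShift (A : X →ₗ.[ℂ] X) (z : ℂ) : X →L[ℂ] X := -resolvent A (-z)

theorem invShift_spec {A : X →ₗ.[ℂ] X} {z : ℂ} (hz : -z ∈ resolventSet A) (x : X) :
    ∃ h : invShift A z x ∈ A.domain, z • invShift A z x + A ⟨invShift A z x, h⟩ = x := by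
  have hR : IsResolventAt A (-z) (resolvent A (-z)) := by
    have hz' : ∃ R : X →L[ℂ] X, IsResolventAt A (-z) R := hz
    rw [resolvent, dif_pos hz']
    exact hz'.choose_spec
  obtain ⟨h, hx⟩ := hR.1 x
  have h' : invShift A z x ∈ A.domain := by
    simpa [invShift] using h
  refine ⟨h', ?_⟩
  have e : (⟨invShift A z x, h'⟩ : A.domain) = -⟨resolvent A (-z) x, h⟩ := by
    ext; simp [invShift]
  rw [e, LinearPMap.map_neg]
  simpa [invShift, sub_eq_add_neg] using hx

theorem invShift_eq_zero {A : X →ₗ.[ℂ] X} {z : ℂ} (hz : -z ∉ resolventSet A) :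
    invShift A z = 0 := by
  have hz' : ¬ ∃ R : X →L[ℂ] X, IsResolventAt A (-z) R := hz
  rw [invShift, resolvent, dif_neg hz', neg_zero]

theorem invShift_mem_domPow_succ (A : X →ₗ.[ℂ] X) (z : ℂ) {k : ℕ} :
    ∀ x : X, x ∈ domPow A k → invShift A z x ∈ domPow A (k + 1) := by
  by_cases hz : -z ∈ resolventSet A
  · induction k with
    | zero =>
      intro x _
      exact mem_domPow_succ.2 ⟨(invShift_spec hz x).1, Submodule.mem_top⟩
    | succ k ih =>
      intro x hx
      obtain ⟨h, hA⟩ := invShift_spec hz x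
      refine mem_domPow_succ.2 ⟨h, ?_⟩
      rw [eq_sub_of_add_eq' hA]
      exact Submodule.sub_mem _ hx
        (Submodule.smul_mem _ _ (ih x (domPow_succ_le A k hx)))
  · intro x _
    rw [invShift_eq_zero hz]
    exact Submodule.zero_mem _

theorem invShift_pow_mem (A : X →ₗ.[ℂ] X) (z : ℂ) (k : ℕ) :
    ∀ x : X, (invShift A z ^ k) x ∈ domPow A k := by
  induction k with
  | zero => exact fun _ => Submodule.mem_top
  | succ k ih =>
    intro x
    rw [pow_succ', mul_apply_eq_comp]
    exact invShift_mem_domPow_succ A z _ (ih x)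

/-- `(z + A)^(-k)` as a linear map from `X` to `X_k`. -/
def invShiftPowLin (A : X →ₗ.[ℂ] X) (z : ℂ) (k : ℕ) : X →ₗ[ℂ] DomSpace A k :=
  LinearMap.codRestrict (domPow A k) (invShift A z ^ k : X →L[ℂ] X).toLinearMap
    (invShift_pow_mem A z k)

theorem toX_invShiftPowLin {A : X →ₗ.[ℂ] X} {z : ℂ} (hz : -z ∈ resolventSet A) (k : ℕ) :
    ∀ x : X, DomSpace.toX A k (invShiftPowLin A z k x) =
      ((1 + (1 - z) • invShift A z) ^ k : X →L[ℂ] X) x := by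
  induction k with
  | zero => intro x; rfl
  | succ k ih =>
    intro x
    have key : idAddStep A k (invShiftPowLin A z (k + 1) x) =
        invShiftPowLin A z k ((1 + (1 - z) • invShift A z) x) := by
      apply Subtype.ext
      obtain ⟨h, hA⟩ := invShift_spec hz ((invShift A z ^ k) x)
      have hc : (invShift A z ^ (k + 1)) x = invShift A z ((invShift A z ^ k) x) := by
        rw [pow_succ']; rfl
      have hc' : (invShift A z ^ k) (invShift A z x) = invShift A z ((invShift A z ^ k) x) := by
        rw [← mul_apply_eq_comp, ← pow_succ, hc]
      have hd : (invShift A z ^ (k + 1)) x ∈ A.domain := by rw [hc]; exact h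
      change (invShift A z ^ (k + 1)) x + A ⟨(invShift A z ^ (k + 1)) x, hd⟩ =
        (invShift A z ^ k) (x + (1 - z) • invShift A z x)
      have e : (⟨(invShift A z ^ (k + 1)) x, hd⟩ : A.domain) = ⟨_, h⟩ := Subtype.ext hc
      rw [e, eq_sub_of_add_eq' hA, hc, map_add, map_smul, hc', sub_smul, one_smul]
      abel
    change idAddPow A k (idAddStep A k (invShiftPowLin A z (k + 1) x)) = _
    rw [key, pow_succ, mul_apply_eq_comp]
    exact ih _

theorem exists_bound_invShiftPowLin (A : X →ₗ.[ℂ] X) (z : ℂ) (k : ℕ) :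
    ∃ K : ℝ, ∀ x : X, ‖invShiftPowLin A z k x‖ ≤ K * ‖x‖ := by
  by_cases hz : -z ∈ resolventSet A
  · refine ⟨‖((1 + (1 - z) • invShift A z) ^ k : X →L[ℂ] X)‖, fun x => ?_⟩
    rw [DomSpace.norm_def, toX_invShiftPowLin hz]
    exact ContinuousLinearMap.le_opNorm _ _
  · cases k with
    | zero => exact ⟨1, fun x => by rw [one_mul]; exact le_refl ‖x‖⟩
    | succ k =>
      refine ⟨0, fun x => ?_⟩
      have : invShiftPowLin A z (k + 1) x = 0 := by
        apply Subtype.ext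
        change (invShift A z ^ (k + 1)) x = 0
        rw [invShift_eq_zero hz]
        simp
      rw [this]
      simp

/-- `(z + A)^(-k)` as a bounded operator from `X` to `X_k`. -/
def invShiftPow (A : X →ₗ.[ℂ] X) (z : ℂ) (k : ℕ) : X →L[ℂ] DomSpace A k :=
  (invShiftPowLin A z k).mkContinuousOfExistsBound (exists_bound_invShiftPowLin A z k)

/-! ### Strongly continuous semigroups and their generators -/

/-- `T` is a strongly continuous semigroup on `X` whose generator is exactly `-A`:
`x ∈ D(A)` and `-A x = y` if and only if `h⁻¹ (T(h) x - x) → y` as `h → 0+`.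
For given `A` there is at most one such `T`. -/
structure IsSemigroupGeneratedByNeg (T : ℝ≥0 → X →L[ℂ] X) (A : X →ₗ.[ℂ] X) : Prop where
  map_zero : T 0 = 1
  map_add : ∀ s t : ℝ≥0, T (s + t) = T s * T t
  strongly_continuous : ∀ x : X, Continuous fun t : ℝ≥0 => T t x
  generator : ∀ x y : X, (x, y) ∈ (-A).graph ↔
    Tendsto (fun h : ℝ≥0 => ((h : ℝ)⁻¹) • (T h x - x)) (𝓝[>] 0) (𝓝 y)

theorem IsSemigroupGeneratedByNeg.mem_neg_graph {T : ℝ≥0 → X →L[ℂ] X} {A : X →ₗ.[ℂ] X}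
    (hT : IsSemigroupGeneratedByNeg T A) (t : ℝ≥0) {x y : X} (h : (x, y) ∈ (-A).graph) :
    (T t x, T t y) ∈ (-A).graph := by
  rw [hT.generator] at h ⊢
  refine (((T t).continuous.tendsto y).comp h).congr fun s => ?_
  have hc : T t (T s x) = T s (T t x) := by
    rw [← mul_apply_eq_comp, ← mul_apply_eq_comp, ← hT.map_add,
      ← hT.map_add, add_comm]
  simp only [Function.comp]
  rw [ContinuousLinearMap.map_smul_of_tower, map_sub, hc]

theorem IsSemigroupGeneratedByNeg.mem_domPow {T : ℝ≥0 → X →L[ℂ] X} {A : X →ₗ.[ℂ] X}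
    (hT : IsSemigroupGeneratedByNeg T A) (t : ℝ≥0) (k : ℕ) :
    ∀ {x : X}, x ∈ domPow A k → T t x ∈ domPow A k := by
  induction k with
  | zero => exact fun _ => Submodule.mem_top
  | succ k ih =>
    intro x hx
    obtain ⟨h, h'⟩ := mem_domPow_succ.1 hx
    have hg := hT.mem_neg_graph t ((-A).mem_graph ⟨x, h⟩)
    obtain ⟨w, hw1, hw2⟩ := (LinearPMap.mem_graph_iff _).1 hg
    have hd : T t x ∈ A.domain := by
      have : (w : X) ∈ A.domain := w.2
      simpa [hw1] using this
    refine mem_domPow_succ.2 ⟨hd, ?_⟩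
    have e : A ⟨T t x, hd⟩ = T t (A ⟨x, h⟩) := by
      have hw : (⟨w, w.2⟩ : A.domain) = ⟨T t x, hd⟩ := Subtype.ext hw1
      have h2 : -(A ⟨w, w.2⟩) = T t (-(A ⟨x, h⟩)) := hw2
      rw [hw, _root_.map_neg] at h2
      exact neg_injective h2
    rw [e]
    exact ih h'

/-- The operator `T(t)` restricted to `X_k`. -/
def IsSemigroupGeneratedByNeg.onDom {T : ℝ≥0 → X →L[ℂ] X} {A : X →ₗ.[ℂ] X}
    (hT : IsSemigroupGeneratedByNeg T A) (k : ℕ) (t : ℝ≥0) (x : DomSpace A k) : DomSpace A k :=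
  ⟨T t (DomSpace.incl A k x), hT.mem_domPow t k x.2⟩

/-! ### Dunford calculus and `L^p_*`-estimates -/

/-- `f ∈ H^∞_0(S(ν))`: bounded and holomorphic on the sector `S(ν)`, with
`|f(z)| ≤ c |z|^s / (1 + |z|^(2s))` there for some `c, s > 0`. -/
def MemH0 (ν : ℝ) (f : ℂ → ℂ) : Prop :=
  DifferentiableOn ℂ f (sector ν) ∧ (∃ M : ℝ, ∀ z ∈ sector ν, ‖f z‖ ≤ M) ∧
    ∃ c s : ℝ, 0 < c ∧ 0 < s ∧
      ∀ z ∈ sector ν, ‖f z‖ ≤ c * (‖z‖ ^ s / (1 + ‖z‖ ^ (2 * s)))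

/-- The Dunford integral `f(A) = (2πi)⁻¹ ∫_Γ f(z) R(z, A) dz`, where `Γ` is the positively
oriented boundary of the sector `S(θ)`: outwards along `r e^{-iθ}`, inwards along `r e^{iθ}`.
For `A` sectorial of type `ω` and `f ∈ H^∞_0(S(ν))` the integral converges absolutely and has
the same value for all `θ ∈ (ω, ν)`. -/
def dunford (θ : ℝ) (f : ℂ → ℂ) (A : X →ₗ.[ℂ] X) : X →L[ℂ] X :=
  (2 * Real.pi * Complex.I)⁻¹ •
    ((∫ r in Ioi (0 : ℝ),
        (f (r * Complex.exp (-(θ * Complex.I))) * Complex.exp (-(θ * Complex.I))) •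
          resolvent A (r * Complex.exp (-(θ * Complex.I)))) -
      ∫ r in Ioi (0 : ℝ),
        (f (r * Complex.exp (θ * Complex.I)) * Complex.exp (θ * Complex.I)) •
          resolvent A (r * Complex.exp (θ * Complex.I)))

/-- The measure `dt / t` on `(0, ∞)`. -/
def haarMul : Measure ℝ :=
  (volume.restrict (Ioi (0 : ℝ))).withDensity fun t => ENNReal.ofReal t⁻¹

/-- `A` satisfies `L^p_*`-estimates: for some (equivalently, every) nonzero
`ψ ∈ H^∞_0(S(ν))`, where `A` is sectorial of type `ω` and `ν > ω`, one has
`‖t ↦ ψ(tA) x‖_{L^p((0, ∞), dt/t; X)} ≤ L ‖x‖` for all `x`. Here `ψ(tA)` is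
the operator `f(A)` for `f(z) = ψ(tz)`. -/
def HasLpStarEstimates (p : ℝ≥0∞) (A : X →ₗ.[ℂ] X) : Prop :=
  ∃ ω θ ν : ℝ, IsSectorial A ω ∧ ω < θ ∧ θ < ν ∧ ν < Real.pi ∧
    ∃ ψ : ℂ → ℂ, MemH0 ν ψ ∧ (∃ z ∈ sector ν, ψ z ≠ 0) ∧
      ∃ L : ℝ≥0, ∀ x : X,
        MemLp (fun t : ℝ => dunford θ (fun z => ψ (t * z)) A x) p haarMul ∧
        eLpNorm (fun t : ℝ => dunford θ (fun z => ψ (t * z)) A x) p haarMul ≤ L * ‖x‖ₑ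

end Operators

/-! ### Admissibility and the set `W_C` -/

section Observation

variable {X Y : Type*} [NormedAddCommGroup X] [NormedSpace ℂ X]
  [NormedAddCommGroup Y] [NormedSpace ℂ Y]

/-- `C ∈ B(X_k, Y)` is (infinite-time) `L^p`-admissible of type `α` for `A`: with `T` the
semigroup generated by `-A`, there is a constant `M` such that
`‖t ↦ t^α C T(t) x‖_{L^p([0, τ]; Y)} ≤ M ‖x‖_X` for all `τ > 0` and all `x ∈ X_k`. -/
def IsLpAdmissible (p : ℝ≥0∞) (α : ℝ) (A : X →ₗ.[ℂ] X) {k : ℕ}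
    (C : DomSpace A k →L[ℂ] Y) : Prop :=
  ∃ (T : ℝ≥0 → X →L[ℂ] X) (hT : IsSemigroupGeneratedByNeg T A),
    ∃ M : ℝ≥0, ∀ τ : ℝ, 0 < τ → ∀ x : DomSpace A k,
      MemLp (fun t : ℝ => t ^ α • C (hT.onDom k t.toNNReal x)) p
        (volume.restrict (Icc 0 τ)) ∧
      eLpNorm (fun t : ℝ => t ^ α • C (hT.onDom k t.toNNReal x)) p
        (volume.restrict (Icc 0 τ)) ≤ M * ‖DomSpace.incl A k x‖ₑ

/-- `W_C = {t^(k - α - 1/p) C (t + A)^(-k) | t > 0} ⊆ B(X, Y)`. -/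
def weissSet (p : ℝ≥0∞) (α : ℝ) (A : X →ₗ.[ℂ] X) {k : ℕ}
    (C : DomSpace A k →L[ℂ] Y) : Set (X →L[ℂ] Y) :=
  {S | ∃ t : ℝ, 0 < t ∧
    S = t ^ ((k : ℝ) - α - (1 / p).toReal) • (C ∘L invShiftPow A (t : ℂ) k)}

end Observation

end SectorialObs

end

noncomputable section

namespace SectorialObs

/-! ### Resolvent calculus and the resolvent set of a sectorial operator. -/

section Resolvents

variable {X : Type*} [NormedAddCommGroup X] [NormedSpace ℂ X] {A : X →ₗ.[ℂ] X}

/-! Write J_s = (1 + sA)⁻¹ and a = α + 1/p, so that the conditions on α say 0 < a < k. Since C is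
unbounded on X, everything goes through the bounded operator `obsInv C` = C(1 + A)^{-k}. For x =
J_1^k y, commutation gives C T(t)x = `obsInv C` (T(t)y) and C J_s^k x = `obsInv C` (J_s^k y). With s
= 1/t, boundedness of W_C becomes ‖C J_s^k x‖ ≤ M s^{-a} ‖x‖.

Necessity is Hölder's inequality in the Laplace representation (k-1)! (l + A)^{-k} y = ∫ s^{k-1}
e^{-ls} T(s)y ds (`IsBoundedAnalytic.integral_pow_mul_exp`). After splitting off the weight s^α, the
remaining factor s^{k-1-α} e^{-ls} has L^q norm of order l^{-(k-a)}, with q conjugate to p. This is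
finite because a < k.

Sufficiency rests on a Calderón-type reproducing formula (`IsSectorial.integral_betaOp_dunford`): ∫
(1 - J_s)^k J_s^{k+n} ψ(sA)x ds/s = c x. Inserted into C T(t)x, it gives J_s^k to C, at the price
s^{-a}, and (1 - J_s)^k to T(t), with gain min(1, s/t)^k because T(t)(1 - J_s) = s J_s A T(t) and ‖A
T(t)‖ ≤ N/t. The spare factor J_s^n is uniformly bounded. Hence t^a ‖C T(t)x‖ is at most a constant
times ∫ min((t/s)^a, (t/s)^{-(k-a)}) ‖ψ(sA)x‖ ds/s. Both exponents are effective because 0 < a < k,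
so the Schur test `eLpNorm_le_of_kernel` on L^p(ds/s) combines with the L^p_*-estimate. Fatou's
lemma passes from the dense set `core A` to general vectors.

For the reproducing formula, ψ(sA) is a contour integral of ψ(z)(z - sA)⁻¹, and Fubini reduces the
claim to evaluating ∫ (1 - J_s)^{a'+1} J_s^{b'+1} (z - sA)⁻¹x ds/s as a scalar function of z times
x. Near z = -1 the resolvent is expanded in powers of z + 1, which leaves integrals of polynomials
in J_s with explicit primitives; analytic continuation reaches the contour. Cauchy's formula then
gives c = ∫ (1 - j)^{k-1} j^{k-1+n} ψ(1/j - 1) dj over (0, 1). A particular n may give c = 0, but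
not all n do when ψ ≠ 0 (`MemH0.exists_moment_ne_zero`).

The semigroup is constructed by a contour integral, and uniqueness for the Cauchy problem identifies
it with whichever semigroup the admissibility hypothesis supplies. -/

theorem resolvent_spec {z : ℂ} (hz : z ∈ resolventSet A) : IsResolventAt A z (resolvent A z) := by
  have hz' : ∃ R : X →L[ℂ] X, IsResolventAt A z R := hz
  rw [resolvent, dif_pos hz']
  exact hz'.choose_spec

theorem resolvent_mem_domain {z : ℂ} (hz : z ∈ resolventSet A) (x : X) :
    resolvent A z x ∈ A.domain := ((resolvent_spec hz).1 x).1

theorem apply_resolvent {z : ℂ} (hz : z ∈ resolventSet A) (x : X) :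
    A ⟨resolvent A z x, resolvent_mem_domain hz x⟩ = z • resolvent A z x - x := by
  obtain ⟨h, hx⟩ := (resolvent_spec hz).1 x
  rw [eq_sub_iff_add_eq, ← eq_sub_iff_add_eq', hx]

theorem resolvent_apply_sub {z : ℂ} (hz : z ∈ resolventSet A) (x : A.domain) :
    resolvent A z (z • (x : X) - A x) = x := (resolvent_spec hz).2 x

theorem resolvent_sub_resolvent {z w : ℂ} (hz : z ∈ resolventSet A) (hw : w ∈ resolventSet A) :
    resolvent A z - resolvent A w = (w - z) • (resolvent A z * resolvent A w) := by
  ext x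
  have h1 := resolvent_apply_sub hz ⟨_, resolvent_mem_domain hw x⟩
  rw [apply_resolvent hw] at h1
  have h2 : resolvent A z (z • resolvent A w x - (w • resolvent A w x - x)) =
      resolvent A w x := h1
  simp only [sub_apply, smul_apply, mul_apply_eq_comp]
  simp only [map_sub, map_smul] at h2
  rw [← sub_eq_zero, ← sub_eq_zero.2 h2]
  module

theorem resolvent_mul_comm {z w : ℂ} (hz : z ∈ resolventSet A) (hw : w ∈ resolventSet A) :
    resolvent A z * resolvent A w = resolvent A w * resolvent A z := by
  by_cases h : z = w
  · rw [h]
  · have h1 := resolvent_sub_resolvent hz hw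
    have h2 := resolvent_sub_resolvent hw hz
    have h3 : (w - z) • (resolvent A z * resolvent A w) =
        (w - z) • (resolvent A w * resolvent A z) := by
      rw [← h1, ← neg_sub (resolvent A w), h2, ← neg_smul, neg_sub]
    exact smul_right_injective _ (sub_ne_zero.2 (Ne.symm h)) h3

/-- The resolvent identity alone suffices: if K = ‖R(z)‖ and |w - z| K < 1/2, it gives ‖R(w)‖ ≤ K +
‖R(w)‖/2, hence ‖R(w)‖ ≤ 2K, and a second use bounds the increment linearly in |w - z|. -/
theorem continuousAt_resolvent {z : ℂ} (hz : ∀ᶠ w in 𝓝 z, w ∈ resolventSet A) :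
    ContinuousAt (resolvent A) z := by
  have hz0 : z ∈ resolventSet A := hz.self_of_nhds
  set K := ‖resolvent A z‖ with hK
  have hKn : 0 ≤ K := norm_nonneg _
  have hbd : ∀ᶠ w in 𝓝 z, ‖resolvent A w - resolvent A z‖ ≤ 2 * K * K * ‖w - z‖ := by
    have hsm : ∀ᶠ w in 𝓝 z, ‖w - z‖ * K < 1 / 2 := by
      have : Tendsto (fun w : ℂ => ‖w - z‖ * K) (𝓝 z) (𝓝 (‖z - z‖ * K)) := by
        apply Continuous.tendsto; fun_prop
      refine this.eventually (gt_mem_nhds ?_)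
      simp
    filter_upwards [hz, hsm] with w hw hs
    have h1 := resolvent_sub_resolvent hw hz0
    have h2 : ‖resolvent A w - resolvent A z‖ ≤ ‖w - z‖ * (‖resolvent A w‖ * K) := by
      rw [h1, norm_smul, norm_sub_rev]
      gcongr
      exact norm_mul_le _ _
    have h3 : ‖resolvent A w‖ ≤ 2 * K := by
      have h4 : ‖resolvent A w‖ ≤ K + ‖resolvent A w - resolvent A z‖ := by
        have := norm_add_le (resolvent A z) (resolvent A w - resolvent A z)
        rwa [add_sub_cancel] at this
      nlinarith [norm_nonneg (resolvent A w)]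
    calc _ ≤ _ := h2
      _ ≤ ‖w - z‖ * (2 * K * K) := by gcongr
      _ = _ := by ring
  rw [ContinuousAt, tendsto_iff_norm_sub_tendsto_zero]
  refine squeeze_zero' (Eventually.of_forall fun _ => norm_nonneg _) hbd ?_
  have : Tendsto (fun w : ℂ => 2 * K * K * ‖w - z‖) (𝓝 z) (𝓝 (2 * K * K * ‖z - z‖)) := by
    apply Continuous.tendsto; fun_prop
  simpa using this

theorem hasDerivAt_resolvent {z : ℂ} (hz : ∀ᶠ w in 𝓝 z, w ∈ resolventSet A) :
    HasDerivAt (resolvent A) (-(resolvent A z * resolvent A z)) z := by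
  have hz0 : z ∈ resolventSet A := hz.self_of_nhds
  rw [hasDerivAt_iff_tendsto_slope]
  have hc : Tendsto (fun w => -(resolvent A w * resolvent A z)) (𝓝[≠] z)
      (𝓝 (-(resolvent A z * resolvent A z))) :=
    (((continuousAt_resolvent hz).tendsto.mul_const _).neg).mono_left nhdsWithin_le_nhds
  refine hc.congr' ?_
  filter_upwards [hz.filter_mono nhdsWithin_le_nhds, self_mem_nhdsWithin] with w hw hne
  have hne' : w - z ≠ 0 := sub_ne_zero.2 hne
  rw [slope_def_module, resolvent_sub_resolvent hw hz0, smul_smul, ← neg_sub w z, mul_neg,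
    inv_mul_cancel₀ hne', neg_one_smul]

/-- Although arg jumps across the negative axis, |arg z| is the unoriented angle between z and 1,
which is continuous off the origin. The condition 0 ≤ ω excludes the origin, whose argument is 0 by
convention. -/
theorem isOpen_lt_abs_arg {ω : ℝ} (hω : 0 ≤ ω) : IsOpen {z : ℂ | ω < |z.arg|} := by
  have : {z : ℂ | ω < |z.arg|} = {z : ℂ | z ≠ 0 ∧ ω < InnerProductGeometry.angle z 1} := by
    ext z
    by_cases hz : z = 0
    · simp [hz, hω]
    · simp [hz, Complex.angle_one_right hz]
  rw [this, isOpen_iff_mem_nhds]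
  rintro z ⟨hz, hz'⟩
  have hc : ContinuousAt (fun y : ℂ => InnerProductGeometry.angle y 1) z := by
    have := InnerProductGeometry.continuousAt_angle (x := (z, (1 : ℂ))) hz one_ne_zero
    exact this.comp (f := fun y : ℂ => (y, (1 : ℂ))) (by fun_prop)
  filter_upwards [hc.eventually (lt_mem_nhds hz'), isOpen_ne.mem_nhds hz] with w h1 h2
  exact ⟨h2, h1⟩

theorem IsSectorial.mem_resolventSet {ω : ℝ} (hA : IsSectorial A ω) {z : ℂ} (hz : ω < |z.arg|) :
    z ∈ resolventSet A := by
  by_contra hn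
  have hz' := hA.spectrum_subset (show z ∈ opSpectrum A from hn)
  rw [mem_closure_iff] at hz'
  obtain ⟨w, hw, hw'⟩ := hz' _ (isOpen_lt_abs_arg hA.nonneg) hz
  have hw1 : ω < |w.arg| := hw
  rw [sector] at hw'
  split_ifs at hw' with h
  · obtain ⟨r, hr, rfl⟩ := hw'
    rw [Complex.arg_ofReal_of_nonneg hr.le, h] at hw1
    simp at hw1
  · exact absurd hw'.2 (not_lt.2 hw1.le)

theorem IsSectorial.eventually_mem_resolventSet {ω : ℝ} (hA : IsSectorial A ω) {z : ℂ}
    (hz : ω < |z.arg|) : ∀ᶠ w in 𝓝 z, w ∈ resolventSet A := by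
  filter_upwards [(isOpen_lt_abs_arg hA.nonneg).mem_nhds hz] with w hw
  exact hA.mem_resolventSet hw

theorem IsSectorial.exists_bound {ω ν : ℝ} (hA : IsSectorial A ω) (hν : ω < ν)
    (hν' : ν < Real.pi) :
    ∃ M : ℝ, 1 ≤ M ∧ ∀ z : ℂ, ν ≤ |z.arg| → ‖resolvent A z‖ ≤ M / ‖z‖ := by
  obtain ⟨M, hM⟩ := hA.resolvent_bound ν hν hν'
  refine ⟨max M 1, le_max_right _ _, fun z hz => ?_⟩
  have hz0 : z ≠ 0 := by
    rintro rfl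
    simp at hz
    linarith [hA.nonneg]
  rw [le_div_iff₀ (norm_pos_iff.2 hz0), mul_comm, ← norm_smul]
  exact (hM z hz).trans (le_max_left _ _)

end Resolvents

/-! ### The rescaled resolvents (z - sA)⁻¹ and J_s = (1 + sA)⁻¹. -/

section ScaledResolvents

variable {X : Type*} [NormedAddCommGroup X] [NormedSpace ℂ X] {A : X →ₗ.[ℂ] X}

/-- The operator `(z - s A)⁻¹` for `s > 0`. -/
def scaledResolvent (A : X →ₗ.[ℂ] X) (z : ℂ) (s : ℝ) : X →L[ℂ] X :=
  (s : ℂ)⁻¹ • resolvent A (z / s)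

/-- The operator `(1 + s A)⁻¹` for `s > 0`. -/
def unitResolvent (A : X →ₗ.[ℂ] X) (s : ℝ) : X →L[ℂ] X := -scaledResolvent A (-1) s

theorem scaledResolvent_neg_one (s : ℝ) :
    scaledResolvent A (-1) s = -unitResolvent A s := (neg_neg _).symm

theorem arg_div_ofReal {z : ℂ} {s : ℝ} (hs : 0 < s) : (z / s).arg = z.arg := by
  rw [div_eq_mul_inv, ← Complex.ofReal_inv, Complex.arg_mul_real (inv_pos.2 hs)]

theorem scaledResolvent_smul {s : ℝ} (hs : 0 < s) (z : ℂ) :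
    (s : ℂ) • scaledResolvent A z s = resolvent A (z / s) := by
  rw [scaledResolvent, smul_smul, mul_inv_cancel₀ (by exact_mod_cast hs.ne'), one_smul]

theorem unitResolvent_eq_invShift (s : ℝ) :
    unitResolvent A s = (s : ℂ)⁻¹ • invShift A ((s⁻¹ : ℝ) : ℂ) := by
  rw [unitResolvent, scaledResolvent, invShift, smul_neg, neg_div, one_div, Complex.ofReal_inv]

theorem invShift_eq_unitResolvent {s : ℝ} (hs : 0 < s) :
    invShift A ((s : ℝ) : ℂ) = (s : ℂ)⁻¹ • unitResolvent A s⁻¹ := by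
  have : (s : ℂ) ≠ 0 := by exact_mod_cast hs.ne'
  rw [unitResolvent_eq_invShift, inv_inv, smul_smul, Complex.ofReal_inv, inv_inv,
    inv_mul_cancel₀ this, one_smul]

variable {ω : ℝ}

theorem IsSectorial.lt_abs_arg_neg_one (hA : IsSectorial A ω) : ω < |(-1 : ℂ).arg| := by
  rw [Complex.arg_neg_one, abs_of_pos Real.pi_pos]
  exact hA.lt_pi

theorem IsSectorial.div_mem (hA : IsSectorial A ω) {z : ℂ} (hz : ω < |z.arg|) {s : ℝ}
    (hs : 0 < s) : z / s ∈ resolventSet A :=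
  hA.mem_resolventSet (by rwa [arg_div_ofReal hs])

theorem IsSectorial.scaledResolvent_mem_domain (hA : IsSectorial A ω) {z : ℂ} (hz : ω < |z.arg|)
    {s : ℝ} (hs : 0 < s) (x : X) : scaledResolvent A z s x ∈ A.domain :=
  A.domain.smul_mem _ (resolvent_mem_domain (hA.div_mem hz hs) x)

theorem IsSectorial.smul_apply_scaledResolvent (hA : IsSectorial A ω) {z : ℂ}
    (hz : ω < |z.arg|) {s : ℝ} (hs : 0 < s) (x : X) :
    (s : ℂ) • A ⟨scaledResolvent A z s x, hA.scaledResolvent_mem_domain hz hs x⟩ =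
      z • scaledResolvent A z s x - x := by
  have hs' : (s : ℂ) ≠ 0 := by exact_mod_cast hs.ne'
  have h := apply_resolvent (hA.div_mem hz hs) x
  have e : (⟨scaledResolvent A z s x, hA.scaledResolvent_mem_domain hz hs x⟩ : A.domain) =
      (s : ℂ)⁻¹ • ⟨_, resolvent_mem_domain (hA.div_mem hz hs) x⟩ := rfl
  rw [e, LinearPMap.map_smul, h, smul_smul, mul_inv_cancel₀ hs', one_smul]
  simp only [scaledResolvent, smul_apply, smul_smul]
  rw [div_eq_mul_inv]

theorem IsSectorial.scaledResolvent_apply_sub (hA : IsSectorial A ω) {z : ℂ}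
    (hz : ω < |z.arg|) {s : ℝ} (hs : 0 < s) (x : A.domain) :
    scaledResolvent A z s (z • (x : X) - (s : ℂ) • A x) = x := by
  have hs' : (s : ℂ) ≠ 0 := by exact_mod_cast hs.ne'
  have h := resolvent_apply_sub (hA.div_mem hz hs) x
  have e : (z • (x : X) - (s : ℂ) • A x) = (s : ℂ) • ((z / s) • (x : X) - A x) := by
    rw [smul_sub, smul_smul, mul_div_cancel₀ _ hs']
  rw [e, map_smul, scaledResolvent, smul_apply, smul_smul, mul_inv_cancel₀ hs', one_smul, h]

theorem IsSectorial.scaledResolvent_sub (hA : IsSectorial A ω) {z w : ℂ}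
    (hz : ω < |z.arg|) (hw : ω < |w.arg|) {s : ℝ} (hs : 0 < s) :
    scaledResolvent A z s - scaledResolvent A w s =
      (w - z) • (scaledResolvent A z s * scaledResolvent A w s) := by
  simp only [scaledResolvent]
  rw [← smul_sub, resolvent_sub_resolvent (hA.div_mem hz hs) (hA.div_mem hw hs),
    smul_mul_smul_comm, smul_smul, smul_smul]
  congr 1
  ring

theorem IsSectorial.commute_scaledResolvent (hA : IsSectorial A ω) {z w : ℂ}
    (hz : ω < |z.arg|) (hw : ω < |w.arg|) {s u : ℝ} (hs : 0 < s) (hu : 0 < u) :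
    Commute (scaledResolvent A z s) (scaledResolvent A w u) :=
  Commute.smul_left (Commute.smul_right
    (resolvent_mul_comm (hA.div_mem hz hs) (hA.div_mem hw hu)) _) _

theorem IsSectorial.commute_scaledResolvent_unitResolvent (hA : IsSectorial A ω) {z : ℂ}
    (hz : ω < |z.arg|) {s u : ℝ} (hs : 0 < s) (hu : 0 < u) :
    Commute (scaledResolvent A z s) (unitResolvent A u) :=
  (hA.commute_scaledResolvent hz hA.lt_abs_arg_neg_one hs hu).neg_right

theorem IsSectorial.commute_unitResolvent (hA : IsSectorial A ω)
    {s u : ℝ} (hs : 0 < s) (hu : 0 < u) : Commute (unitResolvent A s) (unitResolvent A u) :=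
  (hA.commute_scaledResolvent_unitResolvent hA.lt_abs_arg_neg_one hs hu).neg_left

/-- The resolvent identity between z and -1. It extracts a factor J_s, which puts the range of a
contour integral into D(A), and its iterates form the expansion in powers of z + 1. -/
theorem IsSectorial.scaledResolvent_eq (hA : IsSectorial A ω) {z : ℂ}
    (hz : ω < |z.arg|) {s : ℝ} (hs : 0 < s) :
    scaledResolvent A z s =
      -unitResolvent A s + (z + 1) • (scaledResolvent A z s * unitResolvent A s) := by
  have h := hA.scaledResolvent_sub hz hA.lt_abs_arg_neg_one hs
  rw [scaledResolvent_neg_one, mul_neg, sub_neg_eq_add, smul_neg, ← neg_smul] at h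
  rw [neg_add_eq_sub, eq_sub_iff_add_eq, h]
  congr 1
  ring

theorem IsSectorial.unitResolvent_mem_domain (hA : IsSectorial A ω)
    {s : ℝ} (hs : 0 < s) (x : X) : unitResolvent A s x ∈ A.domain :=
  A.domain.neg_mem (hA.scaledResolvent_mem_domain hA.lt_abs_arg_neg_one hs x)

theorem IsSectorial.smul_apply_unitResolvent (hA : IsSectorial A ω) {s : ℝ} (hs : 0 < s) (x : X) :
    (s : ℂ) • A ⟨unitResolvent A s x, hA.unitResolvent_mem_domain hs x⟩ =
      x - unitResolvent A s x := by
  have h := hA.smul_apply_scaledResolvent hA.lt_abs_arg_neg_one hs x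
  have e : (⟨unitResolvent A s x, hA.unitResolvent_mem_domain hs x⟩ : A.domain) =
      -⟨_, hA.scaledResolvent_mem_domain hA.lt_abs_arg_neg_one hs x⟩ := rfl
  rw [e, LinearPMap.map_neg, smul_neg, h, unitResolvent, neg_apply]
  module

theorem IsSectorial.unitResolvent_apply_add (hA : IsSectorial A ω) {s : ℝ} (hs : 0 < s)
    (x : A.domain) : unitResolvent A s ((x : X) + (s : ℂ) • A x) = x := by
  have h := hA.scaledResolvent_apply_sub hA.lt_abs_arg_neg_one hs x
  rw [unitResolvent, neg_apply, ← map_neg, ← h.trans rfl]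
  congr 1
  rw [h]
  module

/-- Since 1 - J_s = s A J_s, both sides are s u A J_s J_u. -/
theorem IsSectorial.unitResolvent_swap (hA : IsSectorial A ω) {s u : ℝ} (hs : 0 < s)
    (hu : 0 < u) :
    (u : ℂ) • ((1 - unitResolvent A s) * unitResolvent A u) =
      (s : ℂ) • (unitResolvent A s * (1 - unitResolvent A u)) := by
  have hs' : (s : ℂ) ≠ 0 := by exact_mod_cast hs.ne'
  have hu' : (u : ℂ) ≠ 0 := by exact_mod_cast hu.ne'
  have h := resolvent_sub_resolvent (hA.div_mem hA.lt_abs_arg_neg_one hs)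
    (hA.div_mem hA.lt_abs_arg_neg_one hu)
  rw [← scaledResolvent_smul hs, ← scaledResolvent_smul hu, scaledResolvent_neg_one,
    scaledResolvent_neg_one, smul_mul_smul_comm, smul_smul, neg_mul_neg,
    show (-1 / (u : ℂ) - -1 / s) * (s * u) = u - s by field_simp; ring] at h
  rw [sub_mul, mul_sub, one_mul, mul_one]
  have h2 := sub_eq_zero.2 h
  rw [← sub_eq_zero, ← h2]
  module

theorem IsSectorial.exists_scaledResolvent_bound {ν : ℝ} (hA : IsSectorial A ω) (hν : ω < ν)
    (hν' : ν < Real.pi) :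
    ∃ M : ℝ, 1 ≤ M ∧ ∀ z : ℂ, ν ≤ |z.arg| → ∀ s : ℝ, 0 < s →
      ‖scaledResolvent A z s‖ ≤ M / ‖z‖ := by
  obtain ⟨M, hM1, hM⟩ := hA.exists_bound hν hν'
  refine ⟨M, hM1, fun z hz s hs => ?_⟩
  have h := hM (z / s) (by rwa [arg_div_ofReal hs])
  rw [scaledResolvent, norm_smul, norm_inv, Complex.norm_real, Real.norm_eq_abs, abs_of_pos hs]
  rw [norm_div, Complex.norm_real, Real.norm_eq_abs, abs_of_pos hs] at h
  calc s⁻¹ * ‖resolvent A (z / s)‖ ≤ s⁻¹ * (M / (‖z‖ / s)) := by gcongr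
    _ = M / ‖z‖ := by field_simp

theorem IsSectorial.exists_unitResolvent_bound (hA : IsSectorial A ω) :
    ∃ M : ℝ, 1 ≤ M ∧ ∀ s : ℝ, 0 < s → ‖unitResolvent A s‖ ≤ M := by
  obtain ⟨ν, h1, h2⟩ := exists_between hA.lt_pi
  obtain ⟨M, hM1, hM⟩ := hA.exists_scaledResolvent_bound h1 h2
  refine ⟨M, hM1, fun s hs => ?_⟩
  have := hM (-1) (by rw [Complex.arg_neg_one, abs_of_pos Real.pi_pos]; exact h2.le) s hs
  rw [unitResolvent, norm_neg]
  simpa using this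

theorem IsSectorial.hasDerivAt_scaledResolvent (hA : IsSectorial A ω) {z : ℂ}
    (hz : ω < |z.arg|) {s : ℝ} (hs : 0 < s) :
    HasDerivAt (fun z => scaledResolvent A z s)
      (-(scaledResolvent A z s * scaledResolvent A z s)) z := by
  have h := hasDerivAt_resolvent (hA.eventually_mem_resolventSet (z := z / s)
    (by rwa [arg_div_ofReal hs]))
  have h2 := (HasDerivAt.scomp z h ((hasDerivAt_id z).div_const (s : ℂ))).const_smul ((s : ℂ)⁻¹)
  refine h2.congr_deriv ?_
  simp only [scaledResolvent]
  rw [smul_mul_smul_comm, smul_smul, smul_neg, one_div]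

/-- With G = (z - sA)⁻¹, the formal derivative A G² is written without A by means of s A G = z G -
1. -/
theorem IsSectorial.hasDerivAt_scaledResolvent_right (hA : IsSectorial A ω) {z : ℂ}
    (hz : ω < |z.arg|) {s : ℝ} (hs : 0 < s) :
    HasDerivAt (fun s => scaledResolvent A z s)
      ((s : ℂ)⁻¹ • ((z • scaledResolvent A z s - 1) * scaledResolvent A z s)) s := by
  have hs' : (s : ℂ) ≠ 0 := by exact_mod_cast hs.ne'
  have h := hasDerivAt_resolvent (hA.eventually_mem_resolventSet (z := z / s)
    (by rwa [arg_div_ofReal hs]))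
  have hi : HasDerivAt (fun u : ℝ => (u : ℂ)⁻¹) (-((s : ℂ) ^ 2)⁻¹) s :=
    (hasDerivAt_inv hs').comp_ofReal
  have hq : HasDerivAt (fun u : ℝ => z / (u : ℂ)) (z * -((s : ℂ) ^ 2)⁻¹) s :=
    hi.const_mul z
  have h2 := hi.smul (HasDerivAt.scomp s h hq)
  refine h2.congr_deriv ?_
  simp only [scaledResolvent, Function.comp]
  rw [sub_mul, one_mul, smul_mul_assoc, smul_mul_smul_comm]
  simp only [pow_two, mul_inv]
  module

theorem IsSectorial.continuousOn_scaledResolvent (hA : IsSectorial A ω) :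
    ContinuousOn (fun p : ℂ × ℝ => scaledResolvent A p.1 p.2)
      ({z | ω < |z.arg|} ×ˢ Ioi 0) := by
  rintro ⟨z, s⟩ ⟨hz, hs⟩
  have hs0 : (0 : ℝ) < s := hs
  have hs' : (s : ℂ) ≠ 0 := by exact_mod_cast hs0.ne'
  have hq : ContinuousAt (fun p : ℂ × ℝ => p.1 / (p.2 : ℂ)) (z, s) :=
    ContinuousAt.div (by fun_prop) (by fun_prop) hs'
  have hc : ContinuousAt (fun p : ℂ × ℝ => resolvent A (p.1 / (p.2 : ℂ))) (z, s) :=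
    ContinuousAt.comp (g := resolvent A) (f := fun p : ℂ × ℝ => p.1 / (p.2 : ℂ))
      (continuousAt_resolvent (hA.eventually_mem_resolventSet
        (by rw [arg_div_ofReal hs0]; exact hz))) hq
  have hi : ContinuousAt (fun p : ℂ × ℝ => (p.2 : ℂ)⁻¹) (z, s) :=
    ContinuousAt.inv₀ (by fun_prop) hs'
  exact (hi.smul hc).continuousWithinAt

theorem IsSectorial.hasDerivAt_unitResolvent (hA : IsSectorial A ω) {s : ℝ} (hs : 0 < s) :
    HasDerivAt (unitResolvent A)
      (-((s : ℂ)⁻¹ • ((1 - unitResolvent A s) * unitResolvent A s))) s := by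
  refine (hA.hasDerivAt_scaledResolvent_right hA.lt_abs_arg_neg_one hs).neg.congr_deriv ?_
  rw [scaledResolvent_neg_one, smul_neg, neg_one_smul, neg_neg, ← neg_sub (1 : X →L[ℂ] X),
    neg_mul_neg]

theorem IsSectorial.continuousOn_unitResolvent (hA : IsSectorial A ω) :
    ContinuousOn (unitResolvent A) (Ioi 0) :=
  fun _ hs => (hA.hasDerivAt_unitResolvent hs).continuousAt.continuousWithinAt

theorem IsSectorial.denseRange_unitResolvent (hA : IsSectorial A ω)
    (hdom : Dense (A.domain : Set X)) : DenseRange (unitResolvent A 1) := by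
  refine hdom.mono fun x hx => ⟨x + (1 : ℝ) • A ⟨x, hx⟩, ?_⟩
  have := hA.unitResolvent_apply_add one_pos ⟨x, hx⟩
  simpa using this

theorem IsSectorial.denseRange_one_sub_unitResolvent (hA : IsSectorial A ω)
    (hran : DenseRange fun x : A.domain => A x) : DenseRange ⇑(1 - unitResolvent A 1) := by
  refine Dense.mono ?_ hran
  rintro _ ⟨x, rfl⟩
  refine ⟨x + A x, ?_⟩
  have := hA.unitResolvent_apply_add one_pos x
  simp only [Complex.ofReal_one, one_smul] at this
  rw [sub_apply, this, one_apply_eq_self]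
  abel

theorem IsSectorial.denseRange_unitResolvent_pow (hA : IsSectorial A ω)
    (hdom : Dense (A.domain : Set X)) (k : ℕ) : DenseRange ⇑(unitResolvent A 1 ^ k) := by
  induction k with
  | zero => exact Function.surjective_id.denseRange
  | succ k ih =>
    have h := (hA.denseRange_unitResolvent hdom).comp ih (unitResolvent A 1).continuous
    rwa [pow_succ']

theorem IsSectorial.unitResolvent_pow_toX (hA : IsSectorial A ω) (k : ℕ) (x : DomSpace A k) :
    (unitResolvent A 1 ^ k) (DomSpace.toX A k x) = DomSpace.incl A k x := by
  induction k with
  | zero => rfl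
  | succ k ih =>
    have h1 := ih (idAddStep A k x)
    have h2 := hA.unitResolvent_apply_add one_pos ⟨x.1, (mem_domPow_succ.1 x.2).1⟩
    rw [pow_succ', mul_apply_eq_comp]
    have h3 : DomSpace.toX A (k + 1) x = DomSpace.toX A k (idAddStep A k x) := rfl
    rw [h3, h1]
    rw [Complex.ofReal_one, one_smul] at h2
    exact h2

theorem invShift_one : invShift A 1 = unitResolvent A 1 := by
  simpa using invShift_eq_unitResolvent (A := A) one_pos

theorem incl_invShiftPow (z : ℂ) (k : ℕ) (x : X) :
    DomSpace.incl A k (invShiftPow A z k x) = (invShift A z ^ k) x := rfl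

end ScaledResolvents

/-! ### Cauchy's theorem for boundaries of sectors. -/

section SectorContours

/-- The point `e^{iφ}` of the unit circle. -/
def ray (φ : ℝ) : ℂ := Complex.exp (φ * Complex.I)

theorem ray_neg (φ : ℝ) : ray (-φ) = Complex.exp (-(φ * Complex.I)) := by simp [ray]

theorem norm_ray (φ : ℝ) : ‖ray φ‖ = 1 := Complex.norm_exp_ofReal_mul_I φ

theorem ray_re (φ : ℝ) : (ray φ).re = Real.cos φ := Complex.exp_ofReal_mul_I_re φ

theorem ray_im (φ : ℝ) : (ray φ).im = Real.sin φ := Complex.exp_ofReal_mul_I_im φ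

theorem norm_ofReal_mul_ray {r : ℝ} (hr : 0 ≤ r) (φ : ℝ) : ‖(r : ℂ) * ray φ‖ = r := by
  rw [norm_mul, norm_ray, mul_one, Complex.norm_real, Real.norm_of_nonneg hr]

theorem arg_ofReal_mul_ray {r : ℝ} (hr : 0 < r) {φ : ℝ} (h1 : -Real.pi < φ) (h2 : φ ≤ Real.pi) :
    ((r : ℂ) * ray φ).arg = φ := by
  rw [ray, Complex.exp_mul_I]
  exact Complex.arg_mul_cos_add_sin_mul_I hr ⟨h1, h2⟩

theorem exp_mem_sector {ν : ℝ} (hν' : ν ≤ Real.pi) {w : ℂ} (hw : |w.im| < ν) :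
    Complex.exp w ∈ sector ν := by
  have hν : ν ≠ 0 := by
    rintro rfl
    exact absurd hw (not_lt.2 (abs_nonneg _))
  rw [sector, if_neg hν]
  refine ⟨Complex.exp_ne_zero _, ?_⟩
  have h := Complex.log_exp (x := w) (by linarith [(abs_lt.1 hw).1]) (by linarith [(abs_lt.1 hw).2])
  rw [← Complex.log_im, h]
  exact hw

theorem ofReal_exp_mul_ray (x φ : ℝ) :
    ((Real.exp x : ℝ) : ℂ) * ray φ = Complex.exp (x + φ * Complex.I) := by
  rw [Complex.exp_add, ray, Complex.ofReal_exp]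

/-- By the law of cosines |r e^{iφ} - a|² ≥ (1 - |cos φ|)(r² + a²), and r² + a² ≥ (r + |a|)²/2;
hence the choice of c. -/
theorem exists_ofReal_mul_ray_sub_ge {φ : ℝ} (hφ : Real.sin φ ≠ 0) :
    ∃ c : ℝ, 0 < c ∧ ∀ r : ℝ, 0 ≤ r → ∀ a : ℝ, c * (r + |a|) ≤ ‖(r : ℂ) * ray φ - a‖ := by
  have hcos : |Real.cos φ| < 1 := by
    rw [← sq_lt_one_iff_abs_lt_one]
    have := Real.sin_sq_add_cos_sq φ
    have : 0 < Real.sin φ ^ 2 := by positivity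
    linarith
  refine ⟨Real.sqrt ((1 - |Real.cos φ|) / 2), Real.sqrt_pos.2 (by linarith), fun r hr a => ?_⟩
  refine le_of_sq_le_sq ?_ (norm_nonneg _)
  rw [mul_pow, Real.sq_sqrt (by linarith), ← Complex.normSq_eq_norm_sq, Complex.normSq_apply]
  simp only [Complex.sub_re, Complex.sub_im, Complex.re_ofReal_mul, Complex.im_ofReal_mul,
    Complex.ofReal_re, Complex.ofReal_im, ray_re, ray_im]
  have h1 : r * a * Real.cos φ ≤ r * |a| * |Real.cos φ| := by
    calc r * a * Real.cos φ ≤ |r * a * Real.cos φ| := le_abs_self _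
      _ = _ := by rw [abs_mul, abs_mul, abs_of_nonneg hr]
  have h2 := Real.sin_sq_add_cos_sq φ
  have h3 := sq_abs a
  have e : (r * Real.cos φ - a) * (r * Real.cos φ - a) +
      (r * Real.sin φ - 0) * (r * Real.sin φ - 0) = r ^ 2 - 2 * (r * a * Real.cos φ) + |a| ^ 2 := by
    rw [h3]
    linear_combination r ^ 2 * h2
  rw [e]
  nlinarith [sq_nonneg (r - |a|), abs_nonneg (Real.cos φ)]

/-- The substitution r = e^x turns rays of a sector into horizontal lines of a strip, where
rectangles are available. -/
theorem integral_ray_eq (h : ℂ → ℂ) (φ : ℝ) :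
    ∫ x : ℝ, h (Complex.exp (x + φ * Complex.I)) * Complex.exp (x + φ * Complex.I) =
      ∫ r in Ioi (0 : ℝ), h (r * ray φ) * ray φ := by
  have h1 := integral_image_eq_integral_abs_deriv_smul MeasurableSet.univ
    (fun x _ => (Real.hasDerivAt_exp x).hasDerivWithinAt) Real.exp_injective.injOn
    (fun r : ℝ => h (r * ray φ) * ray φ)
  rw [image_univ, Real.range_exp, Measure.restrict_univ] at h1
  rw [h1]
  congr 1
  ext x
  rw [abs_of_pos (Real.exp_pos x), ofReal_exp_mul_ray, Complex.real_smul, ← ofReal_exp_mul_ray x φ]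
  ring

theorem integrable_ray_iff (h : ℂ → ℂ) (φ : ℝ) :
    IntegrableOn (fun r : ℝ => h (r * ray φ) * ray φ) (Ioi 0) ↔
    Integrable fun x : ℝ =>
      h (Complex.exp (x + φ * Complex.I)) * Complex.exp (x + φ * Complex.I) := by
  have h1 := integrableOn_image_iff_integrableOn_abs_deriv_smul MeasurableSet.univ
    (fun x _ => (Real.hasDerivAt_exp x).hasDerivWithinAt) Real.exp_injective.injOn
    (fun r : ℝ => h (r * ray φ) * ray φ)
  rw [image_univ, Real.range_exp, integrableOn_univ] at h1
  rw [h1]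
  refine iff_of_eq (congrArg (fun f : ℝ → ℂ => Integrable f) ?_)
  ext x
  rw [abs_of_pos (Real.exp_pos x), ofReal_exp_mul_ray, Complex.real_smul, ← ofReal_exp_mul_ray x φ]
  ring

/-- Cauchy's theorem for the boundary of a sector. -/
theorem integral_ray_eq_integral_ray {θ ν : ℝ} (hθ : 0 < θ) (hθν : θ < ν) (hν : ν ≤ Real.pi)
    {h : ℂ → ℂ} (hd : DifferentiableOn ℂ h (sector ν))
    (hi₁ : IntegrableOn (fun r : ℝ => h (r * ray (-θ)) * ray (-θ)) (Ioi 0))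
    (hi₂ : IntegrableOn (fun r : ℝ => h (r * ray θ) * ray θ) (Ioi 0))
    (h0 : Tendsto (fun z => z * h z) (𝓝[sector ν] 0) (𝓝 0))
    (hinf : Tendsto (fun z => z * h z) (Bornology.cobounded ℂ ⊓ 𝓟 (sector ν)) (𝓝 0)) :
    ∫ r in Ioi (0 : ℝ), h (r * ray (-θ)) * ray (-θ) =
      ∫ r in Ioi (0 : ℝ), h (r * ray θ) * ray θ := by
  -- In the coordinate w = log z the contour is the pair of lines Im w = ±θ. Cauchy's theorem is
  -- applied to the rectangle [-n, n] × [-θ, θ], and the vertical sides vanish as n → ∞ by the decay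
  -- of z h(z) at 0 and at infinity.
  set F : ℂ → ℂ := fun w => h (Complex.exp w) * Complex.exp w with hF
  have him : ∀ x y : ℝ, ((x : ℂ) + y * Complex.I).im = y := fun x y => by simp
  have hFd : DifferentiableOn ℂ F {w | |w.im| < ν} := by
    refine DifferentiableOn.mul (hd.comp Complex.differentiable_exp.differentiableOn ?_)
      Complex.differentiable_exp.differentiableOn
    exact fun w hw => exp_mem_sector hν hw
  have hor : ∀ φ : ℝ, IntegrableOn (fun r : ℝ => h (r * ray φ) * ray φ) (Ioi 0) →
      Tendsto (fun n : ℝ => ∫ x in -n..n, F (x + φ * Complex.I)) atTop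
        (𝓝 (∫ r in Ioi (0 : ℝ), h (r * ray φ) * ray φ)) := by
    intro φ hi
    rw [← integral_ray_eq]
    exact intervalIntegral_tendsto_integral ((integrable_ray_iff h φ).1 hi)
      tendsto_neg_atTop_atBot tendsto_id
  have hexp : ∀ l : Filter ℝ, Tendsto (fun p : ℝ × ℝ => Complex.exp (p.1 + p.2 * Complex.I))
      (l ×ˢ 𝓟 (Icc (-θ) θ)) (𝓟 (sector ν)) := by
    intro l
    rw [tendsto_principal, eventually_prod_principal_iff]
    refine Eventually.of_forall fun x y hy => exp_mem_sector hν ?_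
    rw [him]
    exact (abs_le.2 hy).trans_lt hθν
  have hvert : ∀ l : Filter ℝ, Tendsto (fun p : ℝ × ℝ => F (p.1 + p.2 * Complex.I))
      (l ×ˢ 𝓟 (Icc (-θ) θ)) (𝓝 0) →
      Tendsto (fun n : ℝ => ∫ y in (-θ)..θ, F (n + y * Complex.I)) l (𝓝 0) := by
    intro l hl
    rw [Metric.tendsto_nhds]
    intro ε hε
    have hε' : 0 < ε / (4 * θ) := by positivity
    have h1 := (Metric.tendsto_nhds.1 hl) _ hε'
    rw [eventually_prod_principal_iff] at h1
    filter_upwards [h1] with n hn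
    rw [dist_zero_right]
    have h2 : ‖∫ y in (-θ)..θ, F (n + y * Complex.I)‖ ≤ ε / (4 * θ) * |θ - -θ| := by
      refine intervalIntegral.norm_integral_le_of_norm_le_const fun y hy => ?_
      rw [uIoc_of_le (by linarith)] at hy
      have := hn y ⟨hy.1.le, hy.2⟩
      rw [dist_zero_right] at this
      exact this.le
    refine h2.trans_lt ?_
    rw [abs_of_pos (by linarith)]
    field_simp
    linarith
  have hnorm : ∀ p : ℝ × ℝ, ‖Complex.exp (p.1 + p.2 * Complex.I)‖ = Real.exp p.1 := fun p => by
    rw [Complex.norm_exp]; simp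
  have hV1 := hvert atTop (by
    have : Tendsto (fun p : ℝ × ℝ => Complex.exp (p.1 + p.2 * Complex.I))
        (atTop ×ˢ 𝓟 (Icc (-θ) θ)) (Bornology.cobounded ℂ) := by
      rw [← tendsto_norm_atTop_iff_cobounded]
      simp_rw [hnorm]
      exact Real.tendsto_exp_atTop.comp tendsto_fst
    refine (hinf.comp (tendsto_inf.2 ⟨this, hexp _⟩)).congr fun p => ?_
    exact mul_comm _ _)
  have hV2 := hvert atBot (by
    have : Tendsto (fun p : ℝ × ℝ => Complex.exp (p.1 + p.2 * Complex.I))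
        (atBot ×ˢ 𝓟 (Icc (-θ) θ)) (𝓝 0) := by
      rw [tendsto_zero_iff_norm_tendsto_zero]
      simp_rw [hnorm]
      exact Real.tendsto_exp_atBot.comp tendsto_fst
    refine (h0.comp (tendsto_inf.2 ⟨this, hexp _⟩)).congr fun p => ?_
    exact mul_comm _ _)
  have hV2' := hV2.comp tendsto_neg_atTop_atBot
  have hlim := (((hor _ hi₁).sub (hor _ hi₂)).add (hV1.const_smul Complex.I)).sub
    (hV2'.const_smul Complex.I)
  rw [smul_zero, add_zero, sub_zero] at hlim
  have hz : ∀ n : ℝ, (∫ x in -n..n, F (x + ((-θ : ℝ) : ℂ) * Complex.I)) -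
      (∫ x in -n..n, F (x + θ * Complex.I)) +
      Complex.I • (∫ y in (-θ)..θ, F (n + y * Complex.I)) -
      Complex.I • (∫ y in (-θ)..θ, F (((-n : ℝ) : ℂ) + y * Complex.I)) = 0 := by
    intro n
    have h1 := Complex.integral_boundary_rect_eq_zero_of_differentiableOn F
      (((-n : ℝ) : ℂ) + ((-θ : ℝ) : ℂ) * Complex.I) ((n : ℂ) + θ * Complex.I)
      (hFd.mono ?_)
    · have hre : ∀ x y : ℝ, ((x : ℂ) + y * Complex.I).re = x := fun x y => by simp
      rw [hre, hre, him, him] at h1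
      exact h1
    · rintro w ⟨-, hw⟩
      rw [him, him, uIcc_of_le (by linarith)] at hw
      exact (abs_le.2 hw).trans_lt hθν
  have := tendsto_nhds_unique hlim (tendsto_const_nhds.congr fun n => (hz n).symm)
  exact sub_eq_zero.1 this

end SectorContours

/-! ### Cauchy's integral formula for boundaries of sectors. -/

section CauchyFormula

theorem ray_sub_ne_zero {φ : ℝ} (hφ : Real.sin φ ≠ 0) {r : ℝ} (hr : 0 < r) (a : ℝ) :
    (r : ℂ) * ray φ - a ≠ 0 := by
  intro h
  have := congrArg Complex.im h
  simp only [Complex.sub_im, Complex.im_ofReal_mul, Complex.ofReal_im, ray_im, sub_zero,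
    Complex.zero_im, mul_eq_zero] at this
  exact this.elim hr.ne' hφ

theorem continuousOn_of_mapsTo_ray {ν φ : ℝ} (hφ : |φ| < ν) (hν : ν ≤ Real.pi) {ψ : ℂ → ℂ}
    (hd : ContinuousOn ψ (sector ν)) :
    ContinuousOn (fun r : ℝ => ψ (r * ray φ)) (Ioi 0) := by
  refine hd.comp (by fun_prop) fun r hr => ?_
  have hr' : (0 : ℝ) < r := hr
  rw [← Real.exp_log hr', ofReal_exp_mul_ray]
  exact exp_mem_sector hν (by simpa using hφ)

theorem ofReal_mul_ray_mem_sector {ν φ : ℝ} (hφ : |φ| < ν) (hν : ν ≤ Real.pi) {r : ℝ}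
    (hr : 0 < r) : (r : ℂ) * ray φ ∈ sector ν := by
  rw [← Real.exp_log hr, ofReal_exp_mul_ray]
  exact exp_mem_sector hν (by simpa using hφ)

theorem sector_eq {ν : ℝ} (hν : 0 < ν) : sector ν = {z | z ≠ 0 ∧ |z.arg| < ν} := by
  rw [sector, if_neg hν.ne']

theorem ofReal_mem_sector {ν : ℝ} (hν : 0 < ν) {s : ℝ} (hs : 0 < s) : (s : ℂ) ∈ sector ν := by
  rw [sector_eq hν]
  refine ⟨by exact_mod_cast hs.ne', ?_⟩
  rwa [Complex.arg_ofReal_of_nonneg hs.le, abs_zero]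

theorem isOpen_sector {ν : ℝ} (hν : 0 < ν) : IsOpen (sector ν) := by
  have : sector ν = {z : ℂ | z ≠ 0 ∧ InnerProductGeometry.angle z 1 < ν} := by
    ext z
    by_cases hz : z = 0
    · simp [hz, sector_eq hν]
    · simp [hz, Complex.angle_one_right hz, sector_eq hν]
  rw [this, isOpen_iff_mem_nhds]
  rintro z ⟨hz, hz'⟩
  have hc : ContinuousAt (fun y : ℂ => InnerProductGeometry.angle y 1) z := by
    have := InnerProductGeometry.continuousAt_angle (x := (z, (1 : ℂ))) hz one_ne_zero
    exact this.comp (f := fun y : ℂ => (y, (1 : ℂ))) (by fun_prop)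
  filter_upwards [hc.eventually (gt_mem_nhds hz'), isOpen_ne.mem_nhds hz] with w h1 h2
  exact ⟨h2, h1⟩

theorem sector_add_one_ne_zero {ν : ℝ} (hν0 : 0 < ν) (hν : ν ≤ Real.pi) {z : ℂ}
    (hz : z ∈ sector ν) : z + 1 ≠ 0 := by
  intro h
  rw [sector_eq hν0] at hz
  rw [eq_neg_of_add_eq_zero_left h] at hz
  have := hz.2
  rw [Complex.arg_neg_one, abs_of_pos Real.pi_pos] at this
  linarith

theorem integrableOn_ray_div_sub {ψ : ℂ → ℂ} {φ ε K s : ℝ} (hφ : Real.sin φ ≠ 0) (hε : 0 < ε)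
    (hc : ContinuousOn (fun r : ℝ => ψ (r * ray φ)) (Ioi 0))
    (hb : ∀ r : ℝ, 0 < r → ‖ψ (r * ray φ)‖ ≤ K * (1 + r) ^ (-ε)) (hs : s ≠ 0) :
    IntegrableOn (fun r : ℝ => ψ (r * ray φ) / (r * ray φ - s) * ray φ) (Ioi 0) := by
  obtain ⟨c, hc0, hcb⟩ := exists_ofReal_mul_ray_sub_ge hφ
  have hK : 0 ≤ K := by
    have := (norm_nonneg _).trans (hb 1 one_pos)
    exact nonneg_of_mul_nonneg_left this (by positivity)
  have hs0 : 0 < |s| := abs_pos.2 hs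
  set m := min 1 |s| with hm
  have hm0 : 0 < m := lt_min one_pos hs0
  have hint : IntegrableOn (fun r : ℝ => K / (c * m) * (r + 1) ^ (-(1 + ε))) (Ioi 0) :=
    (integrableOn_add_rpow_Ioi_of_lt (by linarith) (by norm_num)).const_mul _
  refine hint.mono' ?_ ?_
  · refine ContinuousOn.aestronglyMeasurable ?_ measurableSet_Ioi
    exact (hc.div (by fun_prop) fun r hr => ray_sub_ne_zero hφ hr s).mul continuousOn_const
  · refine (ae_restrict_mem measurableSet_Ioi).mono fun r hr => ?_
    have hr' : (0 : ℝ) < r := hr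
    rw [norm_mul, norm_ray, mul_one, norm_div]
    have h1 : c * m * (1 + r) ≤ ‖(r : ℂ) * ray φ - s‖ := by
      refine le_trans ?_ (hcb r hr'.le s)
      have : m * (1 + r) ≤ r + |s| := by
        have h1 : m ≤ 1 := min_le_left _ _
        have h2 : m ≤ |s| := min_le_right _ _
        nlinarith
      rw [mul_assoc]
      gcongr
    calc ‖ψ (r * ray φ)‖ / ‖(r : ℂ) * ray φ - s‖
        ≤ K * (1 + r) ^ (-ε) / (c * m * (1 + r)) :=
          div_le_div₀ (by positivity) (hb r hr') (by positivity) h1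
      _ = K / (c * m) * (r + 1) ^ (-(1 + ε)) := by
          rw [neg_add, Real.rpow_add (by linarith), Real.rpow_neg_one, add_comm r 1]
          field_simp

/-- Neither term is integrable at infinity; their difference (s + 1)/((z - s)(z + 1)) decays
quadratically. -/
theorem integrableOn_ray_inv_sub {φ s : ℝ} (hφ : Real.sin φ ≠ 0) (hs : 0 < s) :
    IntegrableOn (fun r : ℝ => ((r * ray φ - s)⁻¹ - (r * ray φ + 1)⁻¹) * ray φ) (Ioi 0) := by
  obtain ⟨c, hc0, hcb⟩ := exists_ofReal_mul_ray_sub_ge hφ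
  have h1 : IntegrableOn (fun r : ℝ => (s + 1) * ((fun z : ℂ => (z + 1)⁻¹) (r * ray φ) /
      (r * ray φ - s) * ray φ)) (Ioi 0) := by
    refine Integrable.const_mul (integrableOn_ray_div_sub (ψ := fun z : ℂ => (z + 1)⁻¹) (ε := 1)
      (K := c⁻¹) hφ one_pos ?_ ?_ hs.ne') _
    · refine ContinuousOn.inv₀ (by fun_prop) fun r hr => ?_
      simpa using ray_sub_ne_zero hφ hr (-1)
    · intro r hr
      have := hcb r hr.le (-1)
      rw [abs_neg, abs_one, Complex.ofReal_neg, Complex.ofReal_one, sub_neg_eq_add] at this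
      rw [norm_inv, Real.rpow_neg_one, ← mul_inv, add_comm 1 r]
      exact inv_anti₀ (by positivity) this
  refine h1.congr_fun (fun r hr => ?_) measurableSet_Ioi
  have hz1 := ray_sub_ne_zero hφ hr s
  have hz2 := ray_sub_ne_zero hφ hr (-1)
  rw [Complex.ofReal_neg, Complex.ofReal_one, sub_neg_eq_add] at hz2
  dsimp only
  rw [inv_sub_inv hz1 hz2]
  field_simp
  ring

/-- The primitive log(z - s) - log(z + 1) tends to 0 at infinity. At r = 0 it equals log(-s), which
must be read from the upper half-plane: positivity of sin φ keeps the ray there and fixes the value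
log s + πi. -/
theorem integral_ray_inv_sub {φ s : ℝ} (hφ : 0 < Real.sin φ) (hs : 0 < s) :
    ∫ r in Ioi (0 : ℝ), ((r * ray φ - s)⁻¹ - (r * ray φ + 1)⁻¹) * ray φ =
      -(Real.log s + Real.pi * Complex.I) := by
  set L : ℝ → ℂ := fun r => Complex.log (r * ray φ - s) - Complex.log (r * ray φ + 1) with hL
  have him : ∀ a r : ℝ, ((r : ℂ) * ray φ - a).im = r * Real.sin φ := fun a r => by
    simp [ray_im]
  have hsl : ∀ a r : ℝ, 0 < r → (r : ℂ) * ray φ - a ∈ Complex.slitPlane := fun a r hr => by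
    right
    rw [him]
    positivity
  have hlog : ∀ a r : ℝ, 0 < r → HasDerivAt (fun r : ℝ => Complex.log (r * ray φ - a))
      ((r * ray φ - a)⁻¹ * ray φ) r := by
    intro a r hr
    have h1 : HasDerivAt (fun r : ℝ => (r : ℂ) * ray φ - a) (ray φ) r := by
      simpa using ((Complex.ofRealCLM.hasDerivAt (x := r)).mul_const (ray φ)).sub_const (a : ℂ)
    refine (h1.clog_real (hsl a r hr)).congr_deriv ?_
    rw [div_eq_inv_mul]
  have hder : ∀ r ∈ Ioi (0 : ℝ), HasDerivAt L
      (((r * ray φ - s)⁻¹ - (r * ray φ + 1)⁻¹) * ray φ) r := by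
    intro r hr
    have h1 := (hlog s r hr).sub (hlog (-1) r hr)
    simp only [Complex.ofReal_neg, Complex.ofReal_one, sub_neg_eq_add] at h1
    refine h1.congr_deriv ?_
    ring
  have hL0 : L 0 = Real.log s + Real.pi * Complex.I := by
    simp only [hL, Complex.ofReal_zero, zero_mul, zero_sub, zero_add, Complex.log_one, sub_zero]
    rw [Complex.log, ← Complex.ofReal_neg, Complex.arg_ofReal_of_neg (by linarith)]
    simp
  have hcont : ContinuousWithinAt L (Ici 0) 0 := by
    refine ContinuousWithinAt.sub ?_ ?_
    · have h1 : ContinuousWithinAt Complex.log {z : ℂ | 0 ≤ z.im}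
          (((0 : ℝ) : ℂ) * ray φ - s) :=
        Complex.continuousWithinAt_log_of_re_neg_of_im_zero (by simpa using hs) (by simp)
      refine h1.comp (f := fun r : ℝ => (r : ℂ) * ray φ - s)
        (Continuous.continuousWithinAt (by fun_prop)) fun r hr => ?_
      rw [mem_ofPred_eq, him]
      exact mul_nonneg hr hφ.le
    · refine ContinuousAt.continuousWithinAt (ContinuousAt.clog ?_ ?_)
      · exact Continuous.continuousAt (by fun_prop)
      · simp
  have hlim : Tendsto L atTop (𝓝 0) := by
    have h1 : ∀ a : ℝ, Tendsto (fun r : ℝ => Complex.log (ray φ - a * (r : ℂ)⁻¹)) atTop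
        (𝓝 (Complex.log (ray φ))) := by
      intro a
      have h2 : Tendsto (fun r : ℝ => ray φ - a * ((r⁻¹ : ℝ) : ℂ)) atTop (𝓝 (ray φ)) := by
        have : Tendsto (fun r : ℝ => ((r⁻¹ : ℝ) : ℂ)) atTop (𝓝 0) := by
          exact_mod_cast (Complex.continuous_ofReal.tendsto 0).comp tendsto_inv_atTop_zero
        simpa using (this.const_mul (a : ℂ)).const_sub (ray φ)
      simp only [Complex.ofReal_inv] at h2
      refine h2.clog ?_
      right
      rw [ray_im]
      exact hφ.ne'
    have h2 := (h1 s).sub (h1 (-1))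
    rw [sub_self] at h2
    refine h2.congr' ?_
    filter_upwards [eventually_gt_atTop 0] with r hr
    have hr' : (r : ℂ) ≠ 0 := by exact_mod_cast hr.ne'
    have key : ∀ a : ℝ, Complex.log (r * ray φ - a) =
        Real.log r + Complex.log (ray φ - a * (r : ℂ)⁻¹) := by
      intro a
      have e : (r : ℂ) * ray φ - a = r * (ray φ - a * (r : ℂ)⁻¹) := by field_simp
      rw [e, Complex.log_ofReal_mul hr]
      intro h0
      have := hsl a r hr
      rw [e, h0, mul_zero] at this
      simp at this
    have k2 := key (-1)
    simp only [Complex.ofReal_neg, Complex.ofReal_one, sub_neg_eq_add] at k2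
    simp only [hL, Complex.ofReal_neg, Complex.ofReal_one]
    rw [key s, k2]
    ring
  rw [integral_Ioi_of_hasDerivAt_of_tendsto hcont hder (integrableOn_ray_inv_sub hφ.ne' hs) hlim,
    hL0, zero_sub]

theorem conj_ray (φ : ℝ) : (starRingEnd ℂ) (ray φ) = ray (-φ) := by
  rw [ray, ray, ← Complex.exp_conj]
  simp

theorem integral_ray_inv_sub_neg {φ s : ℝ} (hφ : 0 < Real.sin φ) (hs : 0 < s) :
    ∫ r in Ioi (0 : ℝ), ((r * ray (-φ) - s)⁻¹ - (r * ray (-φ) + 1)⁻¹) * ray (-φ) =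
      -(Real.log s - Real.pi * Complex.I) := by
  have h := congrArg (starRingEnd ℂ) (integral_ray_inv_sub hφ hs)
  rw [← integral_conj] at h
  simp only [map_mul, map_sub, map_inv₀, map_add, map_one, conj_ray, Complex.conj_ofReal,
    map_neg, Complex.conj_I] at h
  rw [h]
  ring

/-- Cauchy's integral formula for the boundary of a sector. -/
theorem cauchy_formula_sector {θ ν : ℝ} (hθ : 0 < θ) (hθν : θ < ν) (hν : ν ≤ Real.pi)
    {ψ : ℂ → ℂ} (hd : DifferentiableOn ℂ ψ (sector ν)) {K ε : ℝ} (hε : 0 < ε)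
    (hb : ∀ z ∈ sector ν, ‖ψ z‖ ≤ K * (1 + ‖z‖) ^ (-ε)) {s : ℝ} (hs : 0 < s) :
    (∫ r in Ioi (0 : ℝ), ψ (r * ray (-θ)) / (r * ray (-θ) - s) * ray (-θ)) -
      ∫ r in Ioi (0 : ℝ), ψ (r * ray θ) / (r * ray θ - s) * ray θ =
      2 * Real.pi * Complex.I * ψ s := by
  have hν0 : 0 < ν := hθ.trans hθν
  have hsin : 0 < Real.sin θ := Real.sin_pos_of_pos_of_lt_pi hθ (hθν.trans_le hν)
  have hsin' : Real.sin (-θ) ≠ 0 := by rw [Real.sin_neg]; exact (neg_neg_of_pos hsin).ne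
  have hsm : (s : ℂ) ∈ sector ν := ofReal_mem_sector hν0 hs
  -- The pole at s is removed by subtracting ψ(s)/(z - s). The term ψ(s)/(z + 1), with its pole
  -- outside the sector, restores integrability at infinity.
  set h : ℂ → ℂ := fun z => dslope ψ s z + ψ s / (z + 1) with hh
  have hhne : ∀ z : ℂ, z ≠ s → h z = ψ z / (z - s) - ψ s * ((z - s)⁻¹ - (z + 1)⁻¹) := by
    intro z hz
    simp only [hh]
    rw [dslope_of_ne _ hz, slope_def_field]
    ring
  have hhd : DifferentiableOn ℂ h (sector ν) := by
    refine DifferentiableOn.add ?_ ?_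
    · exact (Complex.differentiableOn_dslope ((isOpen_sector hν0).mem_nhds hsm)).2 hd
    · exact (differentiableOn_const _).div (by fun_prop) fun z hz =>
        sector_add_one_ne_zero hν0 hν hz
  have hbr : ∀ φ : ℝ, |φ| < ν → ∀ r : ℝ, 0 < r → ‖ψ (r * ray φ)‖ ≤ K * (1 + r) ^ (-ε) := by
    intro φ hφ r hr
    have := hb _ (ofReal_mul_ray_mem_sector hφ hν hr)
    rwa [norm_ofReal_mul_ray hr.le] at this
  have hI1 : ∀ φ : ℝ, |φ| < ν → Real.sin φ ≠ 0 →
      IntegrableOn (fun r : ℝ => ψ (r * ray φ) / (r * ray φ - s) * ray φ) (Ioi 0) :=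
    fun φ hφ hφ' => integrableOn_ray_div_sub hφ' hε
      (continuousOn_of_mapsTo_ray hφ hν hd.continuousOn) (hbr φ hφ) hs.ne'
  have heq : ∀ φ : ℝ, Real.sin φ ≠ 0 → ∀ r ∈ Ioi (0 : ℝ), h (r * ray φ) * ray φ =
      ψ (r * ray φ) / (r * ray φ - s) * ray φ -
        ψ s * (((r * ray φ - s)⁻¹ - (r * ray φ + 1)⁻¹) * ray φ) := by
    intro φ hφ r hr
    rw [hhne _ (sub_ne_zero.1 (ray_sub_ne_zero hφ hr s))]
    ring
  have hI2 : ∀ φ : ℝ, |φ| < ν → Real.sin φ ≠ 0 →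
      IntegrableOn (fun r : ℝ => h (r * ray φ) * ray φ) (Ioi 0) := fun φ hφ hφ' =>
    ((hI1 φ hφ hφ').sub ((integrableOn_ray_inv_sub hφ' hs).const_mul (ψ s))).congr_fun
      (fun r hr => (heq φ hφ' r hr).symm) measurableSet_Ioi
  have hval : ∀ φ : ℝ, |φ| < ν → Real.sin φ ≠ 0 → ∫ r in Ioi (0 : ℝ), h (r * ray φ) * ray φ =
      (∫ r in Ioi (0 : ℝ), ψ (r * ray φ) / (r * ray φ - s) * ray φ) -
      ψ s * ∫ r in Ioi (0 : ℝ), ((r * ray φ - s)⁻¹ - (r * ray φ + 1)⁻¹) * ray φ := by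
    intro φ hφ hφ'
    rw [setIntegral_congr_fun measurableSet_Ioi (heq φ hφ'), integral_sub (hI1 φ hφ hφ')
      ((integrableOn_ray_inv_sub hφ' hs).const_mul (ψ s)), integral_const_mul]
  have hK : 0 ≤ K := by
    have := (norm_nonneg _).trans (hb s hsm)
    exact nonneg_of_mul_nonneg_left this (by positivity)
  have hψK : ∀ z ∈ sector ν, ‖ψ z‖ ≤ K := fun z hz => by
    refine (hb z hz).trans (mul_le_of_le_one_right hK ?_)
    exact Real.rpow_le_one_of_one_le_of_nonpos (by linarith [norm_nonneg z]) (by linarith)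
  have hs' : (s : ℂ) ≠ 0 := by exact_mod_cast hs.ne'
  have h0 : Tendsto (fun z => z * h z) (𝓝[sector ν] 0) (𝓝 0) := by
    have h1 : Tendsto (fun z : ℂ => z / (z - s) * (ψ z - ψ s)) (𝓝[sector ν] 0) (𝓝 0) := by
      have h2 : Tendsto (fun z : ℂ => z / (z - s)) (𝓝[sector ν] 0) (𝓝 0) := by
        have : ContinuousAt (fun z : ℂ => z / (z - s)) 0 :=
          ContinuousAt.div (by fun_prop) (by fun_prop) (by simpa using hs')
        simpa using this.tendsto.mono_left nhdsWithin_le_nhds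
      refine h2.zero_mul_isBoundedUnder_le ⟨2 * K, ?_⟩
      rw [eventually_map]
      filter_upwards [self_mem_nhdsWithin] with z hz
      calc ‖ψ z - ψ s‖ ≤ ‖ψ z‖ + ‖ψ s‖ := norm_sub_le _ _
        _ ≤ 2 * K := by linarith [hψK z hz, hψK s hsm]
    have h3 : Tendsto (fun z : ℂ => z * (ψ s / (z + 1))) (𝓝[sector ν] 0) (𝓝 0) := by
      have : ContinuousAt (fun z : ℂ => z * (ψ s / (z + 1))) 0 :=
        ContinuousAt.mul (by fun_prop) (ContinuousAt.div (by fun_prop) (by fun_prop) (by simp))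
      simpa using this.tendsto.mono_left nhdsWithin_le_nhds
    have h4 := h1.add h3
    rw [add_zero] at h4
    refine h4.congr' ?_
    have : ∀ᶠ z : ℂ in 𝓝[sector ν] 0, z ≠ s :=
      nhdsWithin_le_nhds (isOpen_ne.mem_nhds hs'.symm)
    filter_upwards [this] with z hz
    rw [hhne z hz]
    ring
  have hinf : Tendsto (fun z => z * h z) (Bornology.cobounded ℂ ⊓ 𝓟 (sector ν)) (𝓝 0) := by
    have hq : ∀ a : ℂ, Tendsto (fun z : ℂ => z / (z - a)) (Bornology.cobounded ℂ) (𝓝 1) := by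
      intro a
      have h1 : Tendsto (fun z : ℂ => (1 - a * z⁻¹)⁻¹) (Bornology.cobounded ℂ) (𝓝 1) := by
        have := ((tendsto_inv₀_cobounded (α := ℂ)).const_mul a).const_sub 1
        rw [mul_zero, sub_zero] at this
        simpa using this.inv₀ one_ne_zero
      refine h1.congr' ?_
      filter_upwards [Bornology.eventually_ne_cobounded 0] with z hz
      rw [← mul_div_mul_left z (z - a) (inv_ne_zero hz), inv_mul_cancel₀ hz, mul_sub,
        inv_mul_cancel₀ hz, one_div, mul_comm a]
    have hψ0 : Tendsto ψ (Bornology.cobounded ℂ ⊓ 𝓟 (sector ν)) (𝓝 0) := by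
      have h1 : Tendsto (fun z : ℂ => K * (1 + ‖z‖) ^ (-ε)) (Bornology.cobounded ℂ) (𝓝 0) := by
        have := ((tendsto_rpow_neg_atTop hε).comp (tendsto_atTop_add_const_left _ 1
          (tendsto_norm_cobounded_atTop (E := ℂ)))).const_mul K
        rwa [mul_zero] at this
      refine squeeze_zero_norm' ?_ (h1.mono_left inf_le_left)
      exact (eventually_principal.2 hb).filter_mono inf_le_right
    have h1 := (hψ0.mul ((hq s).mono_left inf_le_left)).sub
      ((((hq s).sub (hq (-1))).mono_left (inf_le_left : _ ⊓ 𝓟 (sector ν) ≤ _)).const_mul (ψ s))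
    rw [zero_mul, sub_self, mul_zero, sub_zero] at h1
    refine h1.congr' ?_
    filter_upwards [inf_le_left (a := Bornology.cobounded ℂ) (b := 𝓟 (sector ν))
      (Bornology.eventually_ne_cobounded (s : ℂ))] with z hz
    rw [hhne z hz, sub_neg_eq_add]
    ring
  have hab : |θ| < ν := by rwa [abs_of_pos hθ]
  have hab' : |-θ| < ν := by rwa [abs_neg]
  have key := integral_ray_eq_integral_ray hθ hθν hν hhd (hI2 _ hab' hsin') (hI2 _ hab hsin.ne')
    h0 hinf
  -- The two explicit integrals differ by the jump 2πi of the logarithm; this is the residue at s.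
  rw [hval _ hab' hsin', hval _ hab hsin.ne', integral_ray_inv_sub hsin hs,
    integral_ray_inv_sub_neg hsin hs] at key
  linear_combination key

end CauchyFormula

/-! ### Integrals of e^{-ζ} B(ζ) over a sector boundary with vertex -1. -/

section HankelContour

variable {E : Type*} [NormedAddCommGroup E] [NormedSpace ℂ E]

/-- The integral of `e^{-ζ} B(ζ)` over the ray from `-1` in direction `e^{iφ}`. -/
def hankelRay (φ : ℝ) (B : ℂ → E) : E :=
  ∫ r in Ioi (0 : ℝ), (Complex.exp (1 - r * ray φ) * ray φ) • B (r * ray φ - 1)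

/-- `(2πi)⁻¹ ∫ e^{-ζ} B(ζ) dζ` over the positively oriented boundary of the sector of
half-angle `θ` with vertex `-1`. -/
def hankel (θ : ℝ) (B : ℂ → E) : E :=
  (2 * Real.pi * Complex.I)⁻¹ • (hankelRay (-θ) B - hankelRay θ B)

/-- `B` is continuous and bounded on the boundary of the sector with vertex `-1`. -/
def HankelBounded (θ : ℝ) (B : ℂ → E) : Prop :=
  ∀ φ : ℝ, |φ| = θ → ContinuousOn (fun r : ℝ => B (r * ray φ - 1)) (Ici 0) ∧
    ∃ K : ℝ, ∀ r : ℝ, 0 ≤ r → ‖B (r * ray φ - 1)‖ ≤ K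

/-- For z = r e^{iθ} - 1 one has Im(z e^{-iθ}) = sin θ > 0, which is impossible for |arg z| < θ. The
lower ray is the complex conjugate of the upper one. -/
theorem le_abs_arg_vertex {θ : ℝ} (h0 : 0 < θ) (h1 : θ < Real.pi / 2) {φ : ℝ} (hφ : |φ| = θ)
    (r : ℝ) : θ ≤ |((r : ℂ) * ray φ - 1).arg| := by
  have hsin : 0 < Real.sin θ := Real.sin_pos_of_pos_of_lt_pi h0 (by linarith)
  have main : θ ≤ |((r : ℂ) * ray θ - 1).arg| := by
    by_contra! hlt
    set z := (r : ℂ) * ray θ - 1 with hz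
    have him : z.im = r * Real.sin θ := by simp [hz, ray_im]
    have hre : z.re = r * Real.cos θ - 1 := by simp [hz, ray_re]
    have hz0 : z ≠ 0 := by
      intro h
      have h3 : r * Real.sin θ = 0 := by rw [← him, h]; rfl
      have h4 : r * Real.cos θ - 1 = 0 := by rw [← hre, h]; rfl
      rcases mul_eq_zero.1 h3 with h | h
      · rw [h] at h4; norm_num at h4
      · exact hsin.ne' h
    -- θ < π/2 is what keeps arg z - θ above -2θ > -π.
    have hs : Real.sin (z.arg - θ) < 0 := by
      rw [abs_lt] at hlt
      exact Real.sin_neg_of_neg_of_neg_pi_lt (by linarith) (by linarith)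
    have hn : 0 < ‖z‖ := norm_pos_iff.2 hz0
    have e1 : ‖z‖ * Real.sin z.arg = z.im := Complex.norm_mul_sin_arg z
    have e2 : ‖z‖ * Real.cos z.arg = z.re := Complex.norm_mul_cos_arg z
    have e3 : ‖z‖ * Real.sin (z.arg - θ) = Real.sin θ := by
      rw [Real.sin_sub]
      linear_combination Real.cos θ * e1 - Real.sin θ * e2 + Real.cos θ * him - Real.sin θ * hre
    have := mul_neg_of_pos_of_neg hn hs
    linarith
  rcases abs_eq h0.le |>.1 hφ with rfl | rfl
  · exact main
  · have e : (r : ℂ) * ray (-θ) - 1 = (starRingEnd ℂ) ((r : ℂ) * ray θ - 1) := by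
      rw [map_sub, map_mul, conj_ray, Complex.conj_ofReal, map_one]
    rw [e, Complex.arg_conj]
    split_ifs with h
    · rwa [h] at main
    · rwa [abs_neg]

/-- |r e^{iφ} - 1|² = (r - cos φ)² + sin² φ, so the contour stays away from the origin. -/
theorem sin_le_norm_vertex {θ : ℝ} (h0 : 0 < θ) (h1 : θ < Real.pi / 2) {φ : ℝ} (hφ : |φ| = θ)
    (r : ℝ) : Real.sin θ ≤ ‖(r : ℂ) * ray φ - 1‖ := by
  have hsin : 0 < Real.sin θ := Real.sin_pos_of_pos_of_lt_pi h0 (by linarith)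
  have hc : Real.cos φ = Real.cos θ := by rw [← hφ, Real.cos_abs]
  have hs : Real.sin φ ^ 2 = Real.sin θ ^ 2 := by
    have h2 := Real.sin_sq_add_cos_sq φ
    have h3 := Real.sin_sq_add_cos_sq θ
    rw [hc] at h2
    linarith
  refine le_of_sq_le_sq ?_ (norm_nonneg _)
  rw [← Complex.normSq_eq_norm_sq, Complex.normSq_apply]
  simp only [Complex.sub_re, Complex.sub_im, Complex.re_ofReal_mul, Complex.im_ofReal_mul,
    ray_re, ray_im, Complex.one_re, Complex.one_im, hc]
  nlinarith [sq_nonneg (r - Real.cos θ), Real.sin_sq_add_cos_sq θ]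

theorem norm_hankel_kernel {θ : ℝ} {φ : ℝ} (hφ : |φ| = θ) (r : ℝ) :
    ‖Complex.exp (1 - r * ray φ) * ray φ‖ = Real.exp (1 - r * Real.cos θ) := by
  rw [norm_mul, norm_ray, mul_one, Complex.norm_exp, ← hφ, Real.cos_abs]
  simp [ray_re]

theorem integrableOn_exp_vertex {θ : ℝ} (hc : 0 < Real.cos θ) :
    IntegrableOn (fun r : ℝ => Real.exp (1 - r * Real.cos θ)) (Ioi 0) := by
  have h : IntegrableOn (fun r : ℝ => Real.exp 1 * Real.exp (-Real.cos θ * r)) (Ioi 0) :=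
    (integrableOn_exp_mul_Ioi (by linarith) 0).const_mul _
  refine h.congr_fun (fun r _ => ?_) measurableSet_Ioi
  dsimp only
  rw [← Real.exp_add]
  congr 1
  ring

theorem HankelBounded.integrableOn {θ : ℝ} (hc : 0 < Real.cos θ) {B : ℂ → E}
    (hB : HankelBounded θ B) {φ : ℝ} (hφ : |φ| = θ) :
    IntegrableOn (fun r : ℝ => (Complex.exp (1 - r * ray φ) * ray φ) • B (r * ray φ - 1))
      (Ioi 0) := by
  obtain ⟨hcont, K, hK⟩ := hB φ hφ
  refine ((integrableOn_exp_vertex hc).mul_const K).mono' ?_ ?_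
  · refine ContinuousOn.aestronglyMeasurable ?_ measurableSet_Ioi
    exact ContinuousOn.smul (by fun_prop) (hcont.mono Ioi_subset_Ici_self)
  · refine (ae_restrict_mem measurableSet_Ioi).mono fun r hr => ?_
    rw [norm_smul, norm_hankel_kernel hφ]
    exact mul_le_mul_of_nonneg_left (hK r (le_of_lt hr)) (Real.exp_pos _).le

theorem HankelBounded.add {θ : ℝ} {B₁ B₂ : ℂ → E} (h₁ : HankelBounded θ B₁)
    (h₂ : HankelBounded θ B₂) : HankelBounded θ (fun z => B₁ z + B₂ z) := fun φ hφ => by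
  obtain ⟨c₁, K₁, b₁⟩ := h₁ φ hφ
  obtain ⟨c₂, K₂, b₂⟩ := h₂ φ hφ
  exact ⟨c₁.add c₂, K₁ + K₂, fun r hr => norm_add_le_of_le (b₁ r hr) (b₂ r hr)⟩

theorem HankelBounded.const_smul {θ : ℝ} {B : ℂ → E} (h : HankelBounded θ B) (c : ℂ) :
    HankelBounded θ (fun z => c • B z) := fun φ hφ => by
  obtain ⟨c₁, K₁, b₁⟩ := h φ hφ
  refine ⟨c₁.const_smul c, ‖c‖ * K₁, fun r hr => ?_⟩
  rw [norm_smul]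
  exact mul_le_mul_of_nonneg_left (b₁ r hr) (norm_nonneg _)

theorem HankelBounded.const (θ : ℝ) (b : E) : HankelBounded θ (fun _ => b) :=
  fun _ _ => ⟨continuousOn_const, ‖b‖, fun _ _ => le_rfl⟩

theorem HankelBounded.clm {F : Type*} [NormedAddCommGroup F] [NormedSpace ℂ F] {θ : ℝ}
    {B : ℂ → E} (h : HankelBounded θ B) (L : E →L[ℂ] F) :
    HankelBounded θ (fun z => L (B z)) := fun φ hφ => by
  obtain ⟨c₁, K₁, b₁⟩ := h φ hφ
  exact ⟨L.continuous.comp_continuousOn c₁, ‖L‖ * K₁, fun r hr =>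
    (L.le_opNorm _).trans (mul_le_mul_of_nonneg_left (b₁ r hr) (norm_nonneg _))⟩

theorem hankel_add {θ : ℝ} (h0 : 0 ≤ θ) (hc : 0 < Real.cos θ) {B₁ B₂ : ℂ → E}
    (h₁ : HankelBounded θ B₁) (h₂ : HankelBounded θ B₂) :
    hankel θ (fun z => B₁ z + B₂ z) = hankel θ B₁ + hankel θ B₂ := by
  have e : ∀ φ : ℝ, |φ| = θ →
      hankelRay φ (fun z => B₁ z + B₂ z) = hankelRay φ B₁ + hankelRay φ B₂ := fun φ hφ => by
    simp only [hankelRay, smul_add]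
    exact integral_add (h₁.integrableOn hc hφ) (h₂.integrableOn hc hφ)
  simp only [hankel]
  rw [e _ (abs_of_nonneg h0), e _ ((abs_neg θ).trans (abs_of_nonneg h0)), ← smul_add]
  congr 1
  abel

theorem hankel_smul (θ : ℝ) (c : ℂ) (B : ℂ → E) :
    hankel θ (fun z => c • B z) = c • hankel θ B := by
  have e : ∀ φ : ℝ, hankelRay φ (fun z => c • B z) = c • hankelRay φ B := fun φ => by
    simp only [hankelRay, smul_comm _ c]
    exact integral_smul c _
  simp only [hankel]
  rw [e, e, ← smul_sub, smul_comm]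

theorem hankel_clm {F : Type*} [NormedAddCommGroup F] [NormedSpace ℂ F] [CompleteSpace E]
    [CompleteSpace F] {θ : ℝ} (h0 : 0 ≤ θ) (hc : 0 < Real.cos θ)
    {B : ℂ → E} (h : HankelBounded θ B) (L : E →L[ℂ] F) :
    hankel θ (fun z => L (B z)) = L (hankel θ B) := by
  have e : ∀ φ : ℝ, |φ| = θ → hankelRay φ (fun z => L (B z)) = L (hankelRay φ B) := fun φ hφ => by
    simp only [hankelRay, ← map_smul]
    exact L.integral_comp_comm (h.integrableOn hc hφ)
  simp only [hankel]
  rw [e _ (abs_of_nonneg h0), e _ ((abs_neg θ).trans (abs_of_nonneg h0)), map_smul, map_sub]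

theorem hankel_congr {θ : ℝ} (h0 : 0 ≤ θ) {B₁ B₂ : ℂ → E}
    (h : ∀ φ : ℝ, |φ| = θ → ∀ r : ℝ, 0 < r → B₁ (r * ray φ - 1) = B₂ (r * ray φ - 1)) :
    hankel θ B₁ = hankel θ B₂ := by
  have e : ∀ φ : ℝ, |φ| = θ → hankelRay φ B₁ = hankelRay φ B₂ := fun φ hφ =>
    setIntegral_congr_fun measurableSet_Ioi fun r hr => by
      simp only [h φ hφ r hr]
  simp only [hankel]
  rw [e _ (abs_of_nonneg h0), e _ ((abs_neg θ).trans (abs_of_nonneg h0))]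

/-- The constant in the norm bound for `hankel`. -/
def hankelConst (θ : ℝ) : ℝ := ∫ r in Ioi (0 : ℝ), Real.exp (1 - r * Real.cos θ)

theorem norm_hankel_le {θ : ℝ} (h0 : 0 ≤ θ) (hc : 0 < Real.cos θ) {B : ℂ → E} {K : ℝ}
    (hK : ∀ φ : ℝ, |φ| = θ → ∀ r : ℝ, 0 < r → ‖B (r * ray φ - 1)‖ ≤ K) :
    ‖hankel θ B‖ ≤ hankelConst θ * K := by
  have e : ∀ φ : ℝ, |φ| = θ → ‖hankelRay φ B‖ ≤ hankelConst θ * K := fun φ hφ => by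
    rw [hankelConst, ← integral_mul_const]
    refine norm_integral_le_of_norm_le ((integrableOn_exp_vertex hc).mul_const K) ?_
    refine (ae_restrict_mem measurableSet_Ioi).mono fun r hr => ?_
    rw [norm_smul, norm_hankel_kernel hφ]
    exact mul_le_mul_of_nonneg_left (hK φ hφ r hr) (Real.exp_pos _).le
  have e1 := e _ (abs_of_nonneg h0)
  have e2 := e _ ((abs_neg θ).trans (abs_of_nonneg h0))
  have hn : ‖(2 * Real.pi * Complex.I : ℂ)⁻¹‖ ≤ 1 / 2 := by
    rw [norm_inv, norm_mul, norm_mul, Complex.norm_I, mul_one, Complex.norm_real,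
      Real.norm_of_nonneg Real.pi_pos.le, Complex.norm_two, one_div]
    exact inv_anti₀ two_pos (by linarith [Real.two_le_pi])
  have h3 := norm_sub_le (hankelRay (-θ) B) (hankelRay θ B)
  rw [hankel, norm_smul]
  nlinarith [norm_nonneg (hankelRay (-θ) B - hankelRay θ B)]

/-- e^{-ζ}(B' - B) is the derivative of e^{-ζ}B, which vanishes at infinity on both rays. Each ray
contributes only -e B(-1) from the common vertex, and these cancel. -/
theorem hankel_deriv_sub_self [CompleteSpace E] {θ : ℝ} (h0 : 0 ≤ θ) (hc : 0 < Real.cos θ)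
    {B B' : ℂ → E}
    (hB : HankelBounded θ B) (hB' : HankelBounded θ (fun z => B' z - B z))
    (hd : ∀ φ : ℝ, |φ| = θ → ∀ r : ℝ, 0 < r →
      HasDerivAt B (B' (r * ray φ - 1)) (r * ray φ - 1)) :
    hankel θ (fun z => B' z - B z) = 0 := by
  have e : ∀ φ : ℝ, |φ| = θ →
      hankelRay φ (fun z => B' z - B z) = -(Complex.exp 1 • B (-1)) := by
    intro φ hφ
    set f : ℝ → E := fun r => Complex.exp (1 - r * ray φ) • B (r * ray φ - 1) with hf
    obtain ⟨hcont, K, hK⟩ := hB φ hφ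
    have hcw : ContinuousWithinAt f (Ici 0) 0 :=
      ContinuousWithinAt.smul (Continuous.continuousWithinAt (by fun_prop)) (hcont 0 self_mem_Ici)
    have hder : ∀ r ∈ Ioi (0 : ℝ), HasDerivAt f ((Complex.exp (1 - r * ray φ) * ray φ) •
        (B' (r * ray φ - 1) - B (r * ray φ - 1))) r := by
      intro r hr
      have h1 : HasDerivAt (fun r : ℝ => (r : ℂ) * ray φ) (ray φ) r := by
        simpa using (Complex.ofRealCLM.hasDerivAt (x := r)).mul_const (ray φ)
      have h2 := HasDerivAt.scomp r (hd φ hφ r hr) (h1.sub_const 1)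
      have h3 := (HasDerivAt.comp_ofReal (e := fun r : ℂ => Complex.exp (1 - r * ray φ))
        (((hasDerivAt_id (r : ℂ)).mul_const (ray φ)).const_sub 1).cexp)
      refine (h3.smul h2).congr_deriv ?_
      simp only [Function.comp, id, one_mul]
      module
    have hlim : Tendsto f atTop (𝓝 0) := by
      have h1 : Tendsto (fun r : ℝ => Real.exp (1 - r * Real.cos θ) * K) atTop (𝓝 0) := by
        have h2 : Tendsto (fun r : ℝ => 1 - r * Real.cos θ) atTop atBot := by
          have := tendsto_atBot_add_const_left _ 1
            (tendsto_neg_atTop_atBot.comp (tendsto_id.atTop_mul_const hc))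
          exact this
        simpa using (Real.tendsto_exp_atBot.comp h2).mul_const K
      refine squeeze_zero_norm' ?_ h1
      filter_upwards [eventually_ge_atTop 0] with r hr
      have h2 : ‖Complex.exp (1 - r * ray φ)‖ = Real.exp (1 - r * Real.cos θ) := by
        rw [← norm_hankel_kernel hφ, norm_mul, norm_ray, mul_one]
      rw [hf, norm_smul, h2]
      exact mul_le_mul_of_nonneg_left (hK r hr) (Real.exp_pos _).le
    rw [hankelRay, integral_Ioi_of_hasDerivAt_of_tendsto hcw hder (hB'.integrableOn hc hφ) hlim]
    simp [hf]
  rw [hankel, e _ (abs_of_nonneg h0), e _ ((abs_neg θ).trans (abs_of_nonneg h0)), sub_self,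
    smul_zero]

theorem hankel_const [CompleteSpace E] {θ : ℝ} (h0 : 0 ≤ θ) (hc : 0 < Real.cos θ) (b : E) :
    hankel θ (fun _ => b) = 0 := by
  have h := hankel_deriv_sub_self (θ := θ) (B := fun _ => -b) (B' := fun _ => 0) h0 hc
    (HankelBounded.const θ _) (HankelBounded.const θ _) (fun _ _ r _ => hasDerivAt_const _ _)
  simpa using h

theorem hankelBounded_inv {θ : ℝ} (h0 : 0 < θ) (h1 : θ < Real.pi / 2) :
    HankelBounded θ (fun z : ℂ => z⁻¹) := by
  have hsin : 0 < Real.sin θ := Real.sin_pos_of_pos_of_lt_pi h0 (by linarith)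
  intro φ hφ
  refine ⟨ContinuousOn.inv₀ (by fun_prop) fun r _ h => ?_, (Real.sin θ)⁻¹, fun r _ => ?_⟩
  · have := sin_le_norm_vertex h0 h1 hφ r
    rw [h, norm_zero] at this
    linarith
  · rw [norm_inv]
    exact inv_anti₀ hsin (sin_le_norm_vertex h0 h1 hφ r)

/-- Cauchy's formula for e^{1-z} at the point 1, after moving the vertex to the origin. This
normalisation produces the initial value T(0) = 1. -/
theorem hankel_inv {θ : ℝ} (h0 : 0 < θ) (h1 : θ < Real.pi / 2) :
    hankel θ (fun z : ℂ => z⁻¹) = 1 := by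
  obtain ⟨ν, hν1, hν2⟩ := exists_between h1
  have hν0 : 0 < ν := h0.trans hν1
  have hcν : 0 < Real.cos ν := Real.cos_pos_of_mem_Ioo ⟨by linarith, hν2⟩
  -- In the sector Re z ≥ |z| cos ν, and 1 + Re z ≤ e^{Re z} turns exponential decay into the power
  -- decay that Cauchy's formula requires.
  have hb : ∀ z ∈ sector ν, ‖Complex.exp (1 - z)‖ ≤
      (Real.exp 1 * (Real.cos ν)⁻¹) * (1 + ‖z‖) ^ (-1 : ℝ) := by
    intro z hz
    rw [sector_eq hν0] at hz
    have hre : ‖z‖ * Real.cos ν ≤ z.re := by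
      rw [← Complex.norm_mul_cos_arg z, ← Real.cos_abs z.arg]
      refine mul_le_mul_of_nonneg_left ?_ (norm_nonneg _)
      exact Real.cos_le_cos_of_nonneg_of_le_pi (abs_nonneg _) (by linarith) hz.2.le
    rw [Complex.norm_exp, Complex.sub_re, Complex.one_re, Real.exp_sub, Real.rpow_neg_one,
      mul_assoc, ← mul_inv, div_eq_mul_inv]
    refine mul_le_mul_of_nonneg_left (inv_anti₀ (by positivity) ?_) (Real.exp_pos _).le
    have h2 := Real.add_one_le_exp z.re
    have h3 := Real.cos_le_one ν
    linarith
  have h := cauchy_formula_sector h0 hν1 (by linarith [Real.pi_pos])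
    (ψ := fun z => Complex.exp (1 - z)) (by fun_prop) one_pos hb one_pos
  have e : ∀ φ : ℝ, hankelRay φ (fun z : ℂ => z⁻¹) = ∫ r in Ioi (0 : ℝ),
      Complex.exp (1 - r * ray φ) / (r * ray φ - (1 : ℝ)) * ray φ := by
    intro φ
    refine integral_congr_ae (Eventually.of_forall fun r => ?_)
    simp only [smul_eq_mul, Complex.ofReal_one]
    ring
  rw [hankel, e, e, h, smul_eq_mul, Complex.ofReal_one, sub_self, Complex.exp_zero, mul_one]
  exact inv_mul_cancel₀ Complex.two_pi_I_ne_zero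

theorem hasDerivAt_hankel {θ : ℝ} (h0 : 0 ≤ θ) (hc : 0 < Real.cos θ) {B B' : ℝ → ℂ → E} {t₀ δ K : ℝ}
    (hδ : 0 < δ) (hB : ∀ t ∈ Metric.ball t₀ δ, HankelBounded θ (B t))
    (hB' : HankelBounded θ (B' t₀))
    (hK : ∀ t ∈ Metric.ball t₀ δ, ∀ φ : ℝ, |φ| = θ → ∀ r : ℝ, 0 < r →
      ‖B' t (r * ray φ - 1)‖ ≤ K)
    (hd : ∀ t ∈ Metric.ball t₀ δ, ∀ φ : ℝ, |φ| = θ → ∀ r : ℝ, 0 < r →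
      HasDerivAt (fun t => B t (r * ray φ - 1)) (B' t (r * ray φ - 1)) t) :
    HasDerivAt (fun t => hankel θ (B t)) (hankel θ (B' t₀)) t₀ := by
  have e : ∀ φ : ℝ, |φ| = θ →
      HasDerivAt (fun t => hankelRay φ (B t)) (hankelRay φ (B' t₀)) t₀ := by
    intro φ hφ
    have ht₀ : t₀ ∈ Metric.ball t₀ δ := Metric.mem_ball_self hδ
    refine (hasDerivAt_integral_of_dominated_loc_of_deriv_le
      (F := fun t r => (Complex.exp (1 - r * ray φ) * ray φ) • B t (r * ray φ - 1))
      (F' := fun t r => (Complex.exp (1 - r * ray φ) * ray φ) • B' t (r * ray φ - 1))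
      (bound := fun r => Real.exp (1 - r * Real.cos θ) * K)
      (Metric.ball_mem_nhds t₀ hδ) ?_ ((hB t₀ ht₀).integrableOn hc hφ)
      (hB'.integrableOn hc hφ).aestronglyMeasurable ?_
      ((integrableOn_exp_vertex hc).mul_const K) ?_).2
    · filter_upwards [Metric.ball_mem_nhds t₀ hδ] with t ht
      exact ((hB t ht).integrableOn hc hφ).aestronglyMeasurable
    · refine (ae_restrict_mem measurableSet_Ioi).mono fun r hr t ht => ?_
      rw [norm_smul, norm_hankel_kernel hφ]
      exact mul_le_mul_of_nonneg_left (hK t ht φ hφ r hr) (Real.exp_pos _).le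
    · refine (ae_restrict_mem measurableSet_Ioi).mono fun r hr t ht => ?_
      exact (hd t ht φ hφ r hr).const_smul _
  exact ((e _ ((abs_neg θ).trans (abs_of_nonneg h0))).sub (e _ (abs_of_nonneg h0))).const_smul _

end HankelContour

/-! ### Construction of the bounded analytic semigroup. -/

section SemigroupConstruction

variable {X : Type*} [NormedAddCommGroup X] [NormedSpace ℂ X] {A : X →ₗ.[ℂ] X}

/-- `T` is a bounded family with the regularity properties of the bounded analytic semigroup
generated by `-A`; the semigroup law follows from these. -/
structure IsBoundedAnalytic (A : X →ₗ.[ℂ] X) (T : ℝ → X →L[ℂ] X) (N : ℝ) : Prop where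
  map_zero : T 0 = 1
  norm_le : ∀ t : ℝ, 0 ≤ t → ‖T t‖ ≤ N
  commute : ∀ t : ℝ, 0 ≤ t → ∀ s : ℝ, 0 < s → Commute (T t) (unitResolvent A s)
  deriv : ∀ t : ℝ, 0 < t → ∃ D : X →L[ℂ] X, HasDerivAt T (-D) t ∧ ‖D‖ ≤ N / t ∧
    ∀ x : X, ∃ h : T t x ∈ A.domain, A ⟨T t x, h⟩ = D x
  tendsto : ∀ x : X, Tendsto (fun t => T t x) (𝓝[>] 0) (𝓝 x)

variable {ω θ : ℝ}

theorem IsSectorial.continuousOn_scaledResolvent_ray (hA : IsSectorial A ω) (h0 : 0 < θ)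
    (h1 : θ < Real.pi / 2) (hω : ω < θ) {φ : ℝ} (hφ : |φ| = θ) {t : ℝ} (ht : 0 < t) :
    ContinuousOn (fun r : ℝ => scaledResolvent A (r * ray φ - 1) t) (Ici 0) :=
  hA.continuousOn_scaledResolvent.comp (f := fun r : ℝ => ((r : ℂ) * ray φ - 1, t))
    (by fun_prop) fun r hr => ⟨hω.trans_le (le_abs_arg_vertex h0 h1 hφ r), ht⟩

/-- T(t) is the usual integral of e^{-tz} R(z, A) after the substitution ζ = tz, which makes the
contour independent of t. All resolvent bounds on it are then uniform in t > 0, which gives both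
‖T(t)‖ ≤ N and ‖t A T(t)‖ ≤ N. -/
theorem IsSectorial.exists_isBoundedAnalytic [CompleteSpace X] (hA : IsSectorial A ω)
    (hω : ω < Real.pi / 2) (hdom : Dense (A.domain : Set X)) :
    ∃ (T : ℝ → X →L[ℂ] X) (N : ℝ), IsBoundedAnalytic A T N := by
  obtain ⟨θ, hθ1, h1⟩ := exists_between hω
  have h0 : 0 < θ := hA.nonneg.trans_lt hθ1
  have hc : 0 < Real.cos θ := Real.cos_pos_of_mem_Ioo ⟨by linarith, h1⟩
  have hsin : 0 < Real.sin θ := Real.sin_pos_of_pos_of_lt_pi h0 (by linarith)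
  obtain ⟨M, hM1, hM⟩ := hA.exists_scaledResolvent_bound hθ1 (by linarith)
  have hv : ∀ φ : ℝ, |φ| = θ → ∀ r : ℝ, 0 ≤ r → ω < |((r : ℂ) * ray φ - 1).arg| :=
    fun φ hφ r hr => hθ1.trans_le (le_abs_arg_vertex h0 h1 hφ r)
  have hne : ∀ φ : ℝ, |φ| = θ → ∀ r : ℝ, 0 < ‖(r : ℂ) * ray φ - 1‖ :=
    fun φ hφ r => hsin.trans_le (sin_le_norm_vertex h0 h1 hφ r)
  have hGb : ∀ φ : ℝ, |φ| = θ → ∀ r : ℝ, 0 ≤ r → ∀ t : ℝ, 0 < t →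
      ‖scaledResolvent A (r * ray φ - 1) t‖ ≤ M / ‖(r : ℂ) * ray φ - 1‖ :=
    fun φ hφ r hr t ht => hM _ (le_abs_arg_vertex h0 h1 hφ r) t ht
  have hGb1 : ∀ φ : ℝ, |φ| = θ → ∀ r : ℝ, 0 ≤ r → ∀ t : ℝ, 0 < t →
      ‖scaledResolvent A (r * ray φ - 1) t‖ ≤ M / Real.sin θ :=
    fun φ hφ r hr t ht => (hGb φ hφ r hr t ht).trans
      (div_le_div_of_nonneg_left (by linarith) hsin (sin_le_norm_vertex h0 h1 hφ r))
  have hGb2 : ∀ φ : ℝ, |φ| = θ → ∀ r : ℝ, 0 ≤ r → ∀ t : ℝ, 0 < t →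
      ‖((r : ℂ) * ray φ - 1) • scaledResolvent A (r * ray φ - 1) t‖ ≤ M := by
    intro φ hφ r hr t ht
    rw [norm_smul, mul_comm, ← le_div_iff₀ (hne φ hφ r)]
    exact hGb φ hφ r hr t ht
  have hζc : ∀ φ : ℝ, ContinuousOn (fun r : ℝ => (r : ℂ) * ray φ - 1) (Ici 0) := fun φ => by
    fun_prop
  have hGc := fun φ (hφ : |φ| = θ) t (ht : (0 : ℝ) < t) =>
    hA.continuousOn_scaledResolvent_ray h0 h1 hθ1 hφ ht
  have hB1 : ∀ t : ℝ, 0 < t → HankelBounded θ (fun ζ => scaledResolvent A ζ t) :=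
    fun t ht φ hφ => ⟨hGc φ hφ t ht, _, fun r hr => hGb1 φ hφ r hr t ht⟩
  have hB2 : ∀ t : ℝ, 0 < t → HankelBounded θ (fun ζ => ζ • scaledResolvent A ζ t) :=
    fun t ht φ hφ => ⟨ContinuousOn.smul (hζc φ) (hGc φ hφ t ht), _,
      fun r hr => hGb2 φ hφ r hr t ht⟩
  have hb3 : ∀ φ : ℝ, |φ| = θ → ∀ r : ℝ, 0 ≤ r → ∀ t : ℝ, 0 < t →
      ‖(((r : ℂ) * ray φ - 1) • scaledResolvent A (r * ray φ - 1) t - 1) *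
        scaledResolvent A (r * ray φ - 1) t‖ ≤ (M + 1) * (M / Real.sin θ) := by
    intro φ hφ r hr t ht
    refine (norm_mul_le _ _).trans ?_
    refine mul_le_mul ?_ (hGb1 φ hφ r hr t ht) (norm_nonneg _) (by linarith)
    exact (norm_sub_le _ _).trans (add_le_add (hGb2 φ hφ r hr t ht)
      ContinuousLinearMap.norm_id_le)
  have hB3 : ∀ t : ℝ, 0 < t → HankelBounded θ (fun ζ =>
      (ζ • scaledResolvent A ζ t - 1) * scaledResolvent A ζ t) :=
    fun t ht φ hφ => ⟨((ContinuousOn.smul (hζc φ) (hGc φ hφ t ht)).sub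
      continuousOn_const).mul (hGc φ hφ t ht), _, fun r hr => hb3 φ hφ r hr t ht⟩
  set T : ℝ → X →L[ℂ] X := fun t =>
    if t ≤ 0 then 1 else hankel θ (fun ζ => scaledResolvent A ζ t) with hT
  -- S(t) will turn out to be t A T(t).
  set S : ℝ → X →L[ℂ] X := fun t => hankel θ (fun ζ => ζ • scaledResolvent A ζ t) with hS
  have hTpos : ∀ t : ℝ, 0 < t → T t = hankel θ (fun ζ => scaledResolvent A ζ t) :=
    fun t ht => if_neg (not_le.2 ht)
  have hT0 : T 0 = 1 := if_pos le_rfl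
  set N := max 1 (max (hankelConst θ * (M / Real.sin θ)) (hankelConst θ * M)) with hN
  have hTn : ∀ t : ℝ, 0 ≤ t → ‖T t‖ ≤ N := by
    intro t ht
    rcases ht.eq_or_lt with rfl | ht
    · rw [hT0]
      exact ContinuousLinearMap.norm_id_le.trans (le_max_left _ _)
    · rw [hTpos t ht]
      refine (norm_hankel_le h0.le hc fun φ hφ r hr => hGb1 φ hφ r hr.le t ht).trans ?_
      exact (le_max_left _ _).trans (le_max_right _ _)
  have hSn : ∀ t : ℝ, 0 < t → ‖S t‖ ≤ N := fun t ht =>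
    (norm_hankel_le h0.le hc fun φ hφ r hr => hGb2 φ hφ r hr.le t ht).trans
      ((le_max_right _ _).trans (le_max_right _ _))
  -- With G = (ζ - tA)⁻¹ the resolvent identity reads G = J_t (G + ζG - 1), and the constant -1
  -- integrates to 0. Since t A J_t = 1 - J_t, the result also gives t A T(t) = S(t).
  have hTS : ∀ t : ℝ, 0 < t → T t = unitResolvent A t * (T t + S t) := by
    intro t ht
    have e1 : hankel θ (fun ζ => scaledResolvent A ζ t + ζ • scaledResolvent A ζ t) +
        hankel θ (fun _ => (-1 : X →L[ℂ] X)) = T t + S t := by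
      rw [hankel_const h0.le hc, add_zero, hankel_add h0.le hc (hB1 t ht) (hB2 t ht), hTpos t ht]
    rw [← hankel_add h0.le hc ((hB1 t ht).add (hB2 t ht)) (HankelBounded.const θ _)] at e1
    have e2 := hankel_clm h0.le hc (((hB1 t ht).add (hB2 t ht)).add
      (HankelBounded.const θ (-1 : X →L[ℂ] X)))
      (ContinuousLinearMap.mul ℂ (X →L[ℂ] X) (unitResolvent A t))
    rw [e1] at e2
    simp only [ContinuousLinearMap.mul_apply'] at e2
    rw [← e2, hTpos t ht]
    refine hankel_congr h0.le fun φ hφ r hr => ?_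
    have hz := hv φ hφ r hr.le
    have e3 := hA.scaledResolvent_eq hz ht
    rw [(hA.commute_scaledResolvent_unitResolvent hz ht ht).eq] at e3
    nth_rw 1 [e3]
    simp only [mul_add, mul_neg, mul_one, mul_smul_comm]
    module
  have hTD : ∀ t : ℝ, 0 < t → HasDerivAt T (-((t : ℂ)⁻¹ • S t)) t := by
    intro t ht
    have hball : ∀ u ∈ Metric.ball t (t / 2), t / 2 < u := fun u hu => by
      rw [Metric.mem_ball, Real.dist_eq, abs_lt] at hu
      linarith [hu.1]
    have hd := hasDerivAt_hankel (θ := θ) (t₀ := t) (δ := t / 2)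
      (B := fun t ζ => scaledResolvent A ζ t)
      (B' := fun t ζ => (t : ℂ)⁻¹ • ((ζ • scaledResolvent A ζ t - 1) * scaledResolvent A ζ t))
      (K := (t / 2)⁻¹ * ((M + 1) * (M / Real.sin θ))) h0.le hc (by linarith)
      (fun u hu => hB1 u (by linarith [hball u hu])) ((hB3 t ht).const_smul _)
      (fun u hu φ hφ r hr => by
        have hu0 := hball u hu
        rw [norm_smul, norm_inv, Complex.norm_real, Real.norm_of_nonneg (by linarith)]
        refine mul_le_mul (inv_anti₀ (by linarith) hu0.le)
          (hb3 φ hφ r hr.le u (by linarith)) (norm_nonneg _) (by positivity))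
      (fun u hu φ hφ r hr => hA.hasDerivAt_scaledResolvent_right (hv φ hφ r hr.le)
        (by linarith [hball u hu]))
    have hd2 : HasDerivAt T _ t := hd.congr_of_eventuallyEq (by
      filter_upwards [lt_mem_nhds ht] with u hu
      exact hTpos u hu)
    refine hd2.congr_deriv ?_
    rw [hankel_smul, ← smul_neg]
    congr 1
    have hB4 : HankelBounded θ (fun ζ => scaledResolvent A ζ t -
        ζ • (scaledResolvent A ζ t * scaledResolvent A ζ t) - ζ • scaledResolvent A ζ t) := by
      have h := ((hB3 t ht).const_smul (-1)).add ((hB2 t ht).const_smul (-1))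
      refine Eq.mp (congrArg (HankelBounded θ) (funext fun ζ => ?_)) h
      simp only [sub_mul, smul_mul_assoc, one_mul]
      module
    -- Differentiating in t leaves the integral of ζG² - G. As d/dζ (ζG) = G - ζG², integration by
    -- parts replaces it by minus the integral of ζG, that is, by -S(t).
    have e := hankel_deriv_sub_self (θ := θ) (B := fun ζ => ζ • scaledResolvent A ζ t)
      (B' := fun ζ => scaledResolvent A ζ t -
        ζ • (scaledResolvent A ζ t * scaledResolvent A ζ t)) h0.le hc (hB2 t ht)
      hB4
      (fun φ hφ r hr => by
        refine ((hasDerivAt_id _).smul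
          (hA.hasDerivAt_scaledResolvent (hv φ hφ r hr.le) ht)).congr_deriv ?_
        simp only [id]
        module)
    have e2 : hankel θ (fun ζ => (ζ • scaledResolvent A ζ t - 1) * scaledResolvent A ζ t) +
        hankel θ (fun ζ => ζ • scaledResolvent A ζ t) = 0 := by
      rw [← hankel_add h0.le hc (hB3 t ht) (hB2 t ht), ← neg_zero, ← e, ← neg_one_smul ℂ,
        ← hankel_smul]
      congr 1
      ext1 ζ
      simp only [sub_mul, smul_mul_assoc, one_mul]
      module
    exact eq_neg_of_add_eq_zero_left e2
  refine ⟨T, N, hT0, hTn, ?_, ?_, ?_⟩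
  · intro t ht s hs
    rcases ht.eq_or_lt with rfl | ht
    · rw [hT0]
      exact Commute.one_left _
    · have e1 := hankel_clm h0.le hc (hB1 t ht)
        (ContinuousLinearMap.mul ℂ (X →L[ℂ] X) (unitResolvent A s))
      have e2 := hankel_clm h0.le hc (hB1 t ht)
        ((ContinuousLinearMap.mul ℂ (X →L[ℂ] X)).flip (unitResolvent A s))
      simp only [ContinuousLinearMap.mul_apply', ContinuousLinearMap.flip_apply] at e1 e2
      rw [hTpos t ht, Commute, SemiconjBy, ← e1, ← e2]
      exact hankel_congr h0.le fun φ hφ r hr =>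
        (hA.commute_scaledResolvent_unitResolvent (hv φ hφ r hr.le) ht hs).eq
  · intro t ht
    refine ⟨(t : ℂ)⁻¹ • S t, hTD t ht, ?_, fun x => ?_⟩
    · rw [norm_smul, norm_inv, Complex.norm_real, Real.norm_of_nonneg ht.le, div_eq_inv_mul]
      exact mul_le_mul_of_nonneg_left (hSn t ht) (by positivity)
    · have ht' : (t : ℂ) ≠ 0 := by exact_mod_cast ht.ne'
      have e := DFunLike.congr_fun (hTS t ht) x
      rw [mul_apply_eq_comp] at e
      have hm := hA.unitResolvent_mem_domain ht ((T t + S t) x)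
      have h2 := hA.smul_apply_unitResolvent ht ((T t + S t) x)
      have hm' : T t x ∈ A.domain := by rw [e]; exact hm
      have e3 : (⟨_, hm⟩ : A.domain) = ⟨T t x, hm'⟩ := Subtype.ext e.symm
      rw [e3, ← e] at h2
      refine ⟨hm', ?_⟩
      rw [smul_apply, eq_inv_smul_iff₀ ht', h2, add_apply, add_sub_cancel_left]
  -- For x in D(A), (ζ - tA)⁻¹x = ζ⁻¹x + t ζ⁻¹ (ζ - tA)⁻¹ A x. The first term integrates to x and
  -- the second is O(t); density and the uniform bound on T(t) give all x.
  · have hdomlim : ∀ x ∈ A.domain, Tendsto (fun t => T t x) (𝓝[>] 0) (𝓝 x) := by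
      intro x hx
      set y := A ⟨x, hx⟩ with hy
      have hBi : ∀ t : ℝ, 0 < t → HankelBounded θ (fun ζ => ζ⁻¹ • scaledResolvent A ζ t y) := by
        intro t ht φ hφ
        obtain ⟨c1, K1, b1⟩ := hankelBounded_inv h0 h1 φ hφ
        refine ⟨c1.smul ((hGc φ hφ t ht).clm_apply continuousOn_const),
          K1 * (M / Real.sin θ * ‖y‖), fun r hr => ?_⟩
        rw [norm_smul]
        refine mul_le_mul (b1 r hr) ?_ (norm_nonneg _) ((norm_nonneg _).trans (b1 r hr))
        exact (ContinuousLinearMap.le_opNorm _ _).trans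
          (mul_le_mul_of_nonneg_right (hGb1 φ hφ r hr t ht) (norm_nonneg _))
      have hval : ∀ t : ℝ, 0 < t → T t x =
          x + (t : ℂ) • hankel θ (fun ζ => ζ⁻¹ • scaledResolvent A ζ t y) := by
        intro t ht
        have e1 := hankel_clm h0.le hc (hB1 t ht) (ContinuousLinearMap.apply ℂ X x)
        simp only [ContinuousLinearMap.apply_apply] at e1
        have e2 := hankel_clm h0.le hc (hankelBounded_inv h0 h1)
          (ContinuousLinearMap.toSpanSingleton ℂ x)
        simp only [ContinuousLinearMap.toSpanSingleton_apply] at e2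
        rw [hankel_inv h0 h1, one_smul] at e2
        rw [hTpos t ht, ← e1, ← hankel_smul]
        nth_rw 2 [← e2]
        have hBx : HankelBounded θ (fun ζ : ℂ => ζ⁻¹ • x) :=
          (hankelBounded_inv h0 h1).clm (ContinuousLinearMap.toSpanSingleton ℂ x)
        rw [← hankel_add h0.le hc hBx ((hBi t ht).const_smul _)]
        refine hankel_congr h0.le fun φ hφ r hr => ?_
        have hz := hv φ hφ r hr.le
        have hz0 : (r : ℂ) * ray φ - 1 ≠ 0 := norm_pos_iff.1 (hne φ hφ r)
        have e3 := hA.scaledResolvent_apply_sub hz ht ⟨x, hx⟩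
        rw [map_sub, map_smul, map_smul, ← hy] at e3
        rw [smul_comm (t : ℂ), ← smul_add, eq_inv_smul_iff₀ hz0]
        exact sub_eq_iff_eq_add.1 e3
      have hlim : Tendsto (fun t : ℝ => t * (hankelConst θ *
          ((Real.sin θ)⁻¹ * (M / Real.sin θ * ‖y‖)))) (𝓝[>] 0) (𝓝 0) := by
        refine tendsto_nhdsWithin_of_tendsto_nhds ?_
        refine Continuous.tendsto' (by fun_prop) _ _ ?_
        simp
      rw [tendsto_iff_norm_sub_tendsto_zero]
      refine squeeze_zero' (Eventually.of_forall fun _ => norm_nonneg _) ?_ hlim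
      filter_upwards [self_mem_nhdsWithin] with t ht
      have ht0 : (0 : ℝ) < t := ht
      rw [hval t ht, add_sub_cancel_left, norm_smul, Complex.norm_real, Real.norm_of_nonneg ht0.le]
      refine mul_le_mul_of_nonneg_left (norm_hankel_le h0.le hc fun φ hφ r hr => ?_) ht0.le
      rw [norm_smul, norm_inv]
      refine mul_le_mul (inv_anti₀ hsin (sin_le_norm_vertex h0 h1 hφ r)) ?_ (norm_nonneg _)
        (by positivity)
      exact (ContinuousLinearMap.le_opNorm _ _).trans
        (mul_le_mul_of_nonneg_right (hGb1 φ hφ r hr.le t ht0) (norm_nonneg _))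
    intro x
    have hNpos : 0 < N := lt_of_lt_of_le one_pos (le_max_left _ _)
    rw [Metric.tendsto_nhds]
    intro ε hε
    obtain ⟨y, hy, hxy⟩ := hdom.exists_dist_lt x (ε := ε / (3 * N)) (by positivity)
    have h2 := (Metric.tendsto_nhds.1 (hdomlim y hy)) (ε / 3) (by linarith)
    filter_upwards [h2, self_mem_nhdsWithin] with t ht ht0
    have ht0' : (0 : ℝ) < t := ht0
    rw [dist_eq_norm] at *
    have h3 : ‖T t x - T t y‖ ≤ N * ‖x - y‖ := by
      rw [← map_sub]
      exact (ContinuousLinearMap.le_opNorm _ _).trans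
        (mul_le_mul_of_nonneg_right (hTn t ht0'.le) (norm_nonneg _))
    have h4 : N * ‖x - y‖ < ε / 3 := by
      calc N * ‖x - y‖ < N * (ε / (3 * N)) := mul_lt_mul_of_pos_left hxy hNpos
        _ = ε / 3 := by field_simp
    have h5 : ‖x - y‖ < ε / 3 := by
      refine hxy.trans_le (div_le_div_of_nonneg_left hε.le (by norm_num) ?_)
      have : 1 ≤ N := le_max_left _ _
      linarith
    calc ‖T t x - x‖ = ‖(T t x - T t y) + (T t y - y) + -(x - y)‖ := by congr 1; abel
      _ ≤ ‖T t x - T t y‖ + ‖T t y - y‖ + ‖x - y‖ := by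
          refine (norm_add₃_le).trans ?_
          rw [norm_neg]
      _ < ε := by linarith

end SemigroupConstruction

/-! ### Cauchy problem, semigroup law, generator and uniqueness. -/

section SemigroupLaw

variable {X : Type*} [NormedAddCommGroup X] [NormedSpace ℂ X] {A : X →ₗ.[ℂ] X}
  {ω N : ℝ} {T : ℝ → X →L[ℂ] X}

theorem IsBoundedAnalytic.apply_comm (hA : IsSectorial A ω) (hT : IsBoundedAnalytic A T N)
    {t : ℝ} (ht : 0 ≤ t) (x : A.domain) :
    ∃ h : T t x ∈ A.domain, A ⟨T t x, h⟩ = T t (A x) := by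
  have h1 := hA.unitResolvent_apply_add one_pos x
  have h2 : unitResolvent A 1 (T t ((x : X) + ((1 : ℝ) : ℂ) • A x)) = T t x := by
    rw [← mul_apply_eq_comp, ← (hT.commute t ht 1 one_pos).eq, mul_apply_eq_comp, h1]
  have hm := hA.unitResolvent_mem_domain one_pos (T t ((x : X) + ((1 : ℝ) : ℂ) • A x))
  have h3 := hA.smul_apply_unitResolvent one_pos (T t ((x : X) + ((1 : ℝ) : ℂ) • A x))
  have hm' : T t x ∈ A.domain := by rwa [h2] at hm
  have e : (⟨_, hm⟩ : A.domain) = ⟨T t x, hm'⟩ := Subtype.ext h2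
  rw [e, h2, Complex.ofReal_one, one_smul, one_smul, map_add, add_sub_cancel_left] at h3
  exact ⟨hm', h3⟩

theorem IsBoundedAnalytic.continuousOn_apply (hT : IsBoundedAnalytic A T N) (x : X) :
    ContinuousOn (fun t => T t x) (Ici 0) := by
  intro t ht
  rcases (show (0 : ℝ) ≤ t from ht).eq_or_lt with rfl | ht
  · rw [← continuousWithinAt_Ioi_iff_Ici, ContinuousWithinAt, hT.map_zero]
    exact hT.tendsto x
  · obtain ⟨D, hD, -⟩ := hT.deriv t ht
    exact (hD.continuousAt.clm_apply continuousAt_const).continuousWithinAt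

theorem IsBoundedAnalytic.continuousOn_uncurry (hT : IsBoundedAnalytic A T N) :
    ContinuousOn (fun p : ℝ × X => T p.1 p.2) (Ici 0 ×ˢ univ) := by
  rintro ⟨t, x⟩ ⟨ht, -⟩
  have h1 : Tendsto (fun p : ℝ × X => T p.1 x) (𝓝[Ici 0 ×ˢ univ] (t, x)) (𝓝 (T t x)) := by
    refine (hT.continuousOn_apply x t ht).tendsto.comp ?_
    rw [nhdsWithin_prod_eq]
    exact tendsto_fst
  have h2 : Tendsto (fun p : ℝ × X => N * ‖p.2 - x‖) (𝓝[Ici 0 ×ˢ univ] (t, x)) (𝓝 0) := by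
    refine tendsto_nhdsWithin_of_tendsto_nhds (Continuous.tendsto' (by fun_prop) _ _ ?_)
    simp
  have h3 : Tendsto (fun p : ℝ × X => T p.1 (p.2 - x)) (𝓝[Ici 0 ×ˢ univ] (t, x)) (𝓝 0) := by
    refine squeeze_zero_norm' ?_ h2
    filter_upwards [self_mem_nhdsWithin] with p hp
    exact (ContinuousLinearMap.le_opNorm _ _).trans
      (mul_le_mul_of_nonneg_right (hT.norm_le _ hp.1) (norm_nonneg _))
  have h4 := h3.add h1
  rw [zero_add] at h4
  refine h4.congr fun p => ?_
  rw [map_sub, sub_add_cancel]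

/-- Uniqueness for the Cauchy problem `u' = -A u`. -/
theorem IsBoundedAnalytic.eq_of_hasDerivWithinAt (hA : IsSectorial A ω)
    (hT : IsBoundedAnalytic A T N) {t : ℝ} (ht : 0 ≤ t) {u : ℝ → X}
    (hc : ContinuousOn u (Icc 0 t))
    (hd : ∀ s ∈ Ico 0 t, ∃ h : u s ∈ A.domain, HasDerivWithinAt u (-A ⟨u s, h⟩) (Ici s) s) :
    u t = T t (u 0) := by
  -- The curve T(t - s)u(s) joins T(t)u(0) to u(t), and its derivative A T(t - s)u(s) - T(t - s)A
  -- u(s) vanishes.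
  set v : ℝ → X := fun s => T (t - s) (u s) with hv
  have hvc : ContinuousOn v (Icc 0 t) :=
    hT.continuousOn_uncurry.comp (f := fun s => (t - s, u s))
      (ContinuousOn.prodMk (by fun_prop) hc) fun s hs => ⟨sub_nonneg.2 hs.2, mem_univ _⟩
  have hvd : ∀ s ∈ Ico 0 t, HasDerivWithinAt v 0 (Ici s) s := by
    intro s hs
    obtain ⟨hus, hus'⟩ := hd s hs
    have hts : 0 < t - s := sub_pos.2 hs.2
    obtain ⟨D, hD, -, hDA⟩ := hT.deriv (t - s) hts
    have h1 : HasDerivAt (fun s => T (t - s)) D s := by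
      simpa using HasDerivAt.comp_const_sub t s hD
    have h2 : HasDerivAt (fun s => (T (t - s)).restrictScalars ℝ) (D.restrictScalars ℝ) s :=
      ((ContinuousLinearMap.restrictScalarsL ℂ X X ℝ ℝ).hasFDerivAt.comp_hasDerivAt s h1)
    refine (h2.hasDerivWithinAt.clm_apply hus').congr_deriv ?_
    simp only [ContinuousLinearMap.coe_restrictScalars', map_neg]
    obtain ⟨h3, h4⟩ := hDA (u s)
    obtain ⟨h5, h6⟩ := hT.apply_comm hA hts.le ⟨u s, hus⟩
    rw [← h4, ← h6, add_neg_cancel]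
  have h := constant_of_has_deriv_right_zero hvc hvd t ⟨ht, le_rfl⟩
  simpa [hv, hT.map_zero] using h

theorem IsBoundedAnalytic.hasDerivWithinAt_apply (hA : IsSectorial A ω)
    (hT : IsBoundedAnalytic A T N) (x : A.domain) {s : ℝ} (hs : 0 ≤ s) :
    HasDerivWithinAt (fun t => T t (x : X)) (-T s (A x)) (Ici s) s := by
  have hpos : ∀ s : ℝ, 0 < s → HasDerivAt (fun t => T t (x : X)) (-T s (A x)) s := by
    intro s hs
    obtain ⟨D, hD, -, hDA⟩ := hT.deriv s hs
    obtain ⟨h3, h4⟩ := hDA x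
    obtain ⟨h5, h6⟩ := hT.apply_comm hA hs.le x
    rw [← h6, h4]
    have := ((ContinuousLinearMap.apply ℂ X (x : X)).restrictScalars ℝ).hasFDerivAt.comp_hasDerivAt
      s hD
    exact this
  rcases hs.eq_or_lt with rfl | hs
  -- At 0 only strong continuity is known, so the right derivative is obtained as the limit of the
  -- derivatives at positive times.
  · refine hasDerivWithinAt_Ici_of_tendsto_deriv (s := Ioi 0)
      (fun s hs => (hpos s hs).differentiableAt.differentiableWithinAt)
      ((hT.continuousOn_apply (x : X) 0 self_mem_Ici).mono Ioi_subset_Ici_self)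
      self_mem_nhdsWithin ?_
    have h1 := (hT.tendsto (A x)).neg
    rw [hT.map_zero]
    refine h1.congr' ?_
    filter_upwards [self_mem_nhdsWithin] with s hs
    exact (hpos s hs).deriv.symm
  · exact (hpos s hs).hasDerivWithinAt

/-- For a > 0 the curve s ↦ T(s + a)x lies in D(A) and solves the Cauchy problem with initial value
T(a)x, for every x, so uniqueness applies. -/
theorem IsBoundedAnalytic.map_add (hA : IsSectorial A ω) (hT : IsBoundedAnalytic A T N)
    {t a : ℝ} (ht : 0 ≤ t) (ha : 0 ≤ a) : T (t + a) = T t * T a := by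
  rcases ha.eq_or_lt with rfl | ha
  · rw [add_zero, hT.map_zero, mul_one]
  ext x
  have h := hT.eq_of_hasDerivWithinAt hA (u := fun s => T (s + a) x) ht ?_ ?_
  · simpa using h
  · exact (hT.continuousOn_apply x).comp (by fun_prop) fun s hs => by
      have := hs.1
      simp only [mem_Ici]
      linarith
  · intro s hs
    have hsa : 0 < s + a := by linarith [hs.1]
    obtain ⟨D, hD, -, hDA⟩ := hT.deriv (s + a) hsa
    obtain ⟨h3, h4⟩ := hDA x
    refine ⟨h3, ?_⟩
    rw [h4]
    have h1 := HasDerivAt.comp_add_const s a hD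
    have := ((ContinuousLinearMap.apply ℂ X x).restrictScalars ℝ).hasFDerivAt.comp_hasDerivAt s h1
    exact this.hasDerivWithinAt

theorem tendsto_coe_nnreal_nhdsGT : Tendsto ((↑) : ℝ≥0 → ℝ) (𝓝[>] 0) (𝓝[>] 0) := by
  refine tendsto_nhdsWithin_iff.2 ⟨?_, ?_⟩
  · exact (NNReal.continuous_coe.tendsto' 0 0 rfl).mono_left nhdsWithin_le_nhds
  · filter_upwards [self_mem_nhdsWithin] with h hh
    exact_mod_cast hh

theorem mem_neg_graph_iff {x y : X} :
    (x, y) ∈ (-A).graph ↔ ∃ h : x ∈ A.domain, -A ⟨x, h⟩ = y := by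
  rw [LinearPMap.mem_graph_iff]
  constructor
  · rintro ⟨w, hw1, hw2⟩
    have hw : (w : X) ∈ A.domain := w.2
    have hx : x ∈ A.domain := (show (w : X) = x from hw1) ▸ hw
    refine ⟨hx, ?_⟩
    have e : (⟨w, hw⟩ : A.domain) = ⟨x, hx⟩ := Subtype.ext hw1
    rw [← e]
    exact hw2
  · rintro ⟨h, hy⟩
    exact ⟨⟨x, h⟩, rfl, hy⟩

theorem IsBoundedAnalytic.isSemigroup (hA : IsSectorial A ω) (hT : IsBoundedAnalytic A T N) :
    IsSemigroupGeneratedByNeg (fun t : ℝ≥0 => T t) A where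
  map_zero := hT.map_zero
  map_add s t := hT.map_add hA s.2 t.2
  strongly_continuous x :=
    (hT.continuousOn_apply x).comp_continuous NNReal.continuous_coe fun t => t.2
  generator x y := by
    have hlim : ∀ x : A.domain, Tendsto (fun h : ℝ≥0 => ((h : ℝ)⁻¹) • (T h (x : X) - (x : X)))
        (𝓝[>] 0) (𝓝 (-A x)) := by
      intro x
      have h1 := (hT.hasDerivWithinAt_apply hA x le_rfl)
      rw [hasDerivWithinAt_iff_tendsto_slope, Ici_sdiff_left, hT.map_zero] at h1
      refine (h1.comp tendsto_coe_nnreal_nhdsGT).congr fun h => ?_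
      simp [slope_def_module, hT.map_zero]
    rw [mem_neg_graph_iff]
    constructor
    · rintro ⟨h, rfl⟩
      exact hlim ⟨x, h⟩
    · intro h
      -- The generator is no larger than -A: J_1 applied to the difference quotients gives J_1 y =
      -- -A J_1 x = J_1 x - x, hence x = J_1(x - y) lies in D(A).
      have hJ := hA.unitResolvent_mem_domain one_pos x
      have h1 := hlim ⟨_, hJ⟩
      have h2 := ((unitResolvent A 1).continuous.tendsto y).comp h
      have h3 : Tendsto (fun h : ℝ≥0 => ((h : ℝ)⁻¹) •
          (T h (unitResolvent A 1 x) - unitResolvent A 1 x)) (𝓝[>] 0)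
          (𝓝 (unitResolvent A 1 y)) := by
        refine h2.congr fun h => ?_
        simp only [Function.comp]
        rw [ContinuousLinearMap.map_smul_of_tower, map_sub, ← mul_apply_eq_comp,
          ← (hT.commute h h.2 1 one_pos).eq, mul_apply_eq_comp]
      have h4 := tendsto_nhds_unique h1 h3
      have h5 := hA.smul_apply_unitResolvent one_pos x
      rw [Complex.ofReal_one, one_smul] at h5
      rw [h5] at h4
      have h6 : unitResolvent A 1 (x - y) = x := by
        rw [map_sub, ← h4]
        abel
      have hm := hA.unitResolvent_mem_domain one_pos (x - y)
      have h7 := hA.smul_apply_unitResolvent one_pos (x - y)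
      have hm' : x ∈ A.domain := by rwa [h6] at hm
      have e : (⟨_, hm⟩ : A.domain) = ⟨x, hm'⟩ := Subtype.ext h6
      rw [Complex.ofReal_one, one_smul, e, h6] at h7
      refine ⟨hm', ?_⟩
      rw [h7]
      abel

/-- Admissibility provides some semigroup generated by -A, which must be matched with the
constructed one. On D(A) its orbits solve the Cauchy problem; density does the rest. -/
theorem IsBoundedAnalytic.eq_semigroup (hA : IsSectorial A ω) (hdom : Dense (A.domain : Set X))
    (hT : IsBoundedAnalytic A T N) {T' : ℝ≥0 → X →L[ℂ] X}
    (hT' : IsSemigroupGeneratedByNeg T' A) (t : ℝ≥0) : T' t = T t := by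
  have hon : ∀ x ∈ A.domain, T' t x = T t x := by
    intro x hx
    have h := hT.eq_of_hasDerivWithinAt hA (u := fun s => T' s.toNNReal x) t.2 ?_ ?_
    · simpa [hT'.map_zero] using h
    · exact ((hT'.strongly_continuous x).comp continuous_real_toNNReal).continuousOn
    · intro s hs
      have hg := hT'.mem_neg_graph s.toNNReal (mem_neg_graph_iff.2 ⟨hx, rfl⟩)
      obtain ⟨h, h'⟩ := mem_neg_graph_iff.1 hg
      refine ⟨h, ?_⟩
      rw [h', hasDerivWithinAt_iff_tendsto_slope, Ici_sdiff_left]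
      have h1 := (hT'.generator x _).1 (mem_neg_graph_iff.2 ⟨hx, rfl⟩)
      have h2 := ((T' s.toNNReal).continuous.tendsto _).comp h1
      have h3 : Tendsto (fun r : ℝ => (r - s).toNNReal) (𝓝[>] s) (𝓝[>] 0) := by
        refine tendsto_nhdsWithin_iff.2 ⟨?_, ?_⟩
        · refine tendsto_nhdsWithin_of_tendsto_nhds (Continuous.tendsto' (by fun_prop) _ _ ?_)
          simp
        · filter_upwards [self_mem_nhdsWithin] with r hr
          exact Real.toNNReal_pos.2 (sub_pos.2 hr)
      refine (h2.comp h3).congr' ?_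
      filter_upwards [self_mem_nhdsWithin] with r hr
      have hr' : 0 < r - s := sub_pos.2 hr
      simp only [Function.comp]
      rw [ContinuousLinearMap.map_smul_of_tower, map_sub, ← mul_apply_eq_comp, ← hT'.map_add,
        ← Real.toNNReal_add hs.1 hr'.le, add_sub_cancel, Real.coe_toNNReal _ hr'.le,
        slope_def_module]
  have := Continuous.ext_on hdom (T' t).continuous (T t).continuous hon
  exact ContinuousLinearMap.ext fun x => congrFun this x

end SemigroupLaw

/-! ### Weighted exponential norms and Laplace transforms of the semigroup. -/

section LaplaceTransform

/-- The power of l is dictated by the scaling u = ls. For finite q the norm is a Gamma integral,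
convergent since βq + 1 > 0; for q = ∞ it is the supremum of u^β e^{-u}, where u^β ≤ 1 + u^n ≤ (1 +
n!) e^u for an integer n ≥ β. -/
theorem exists_eLpNorm_rpow_mul_exp_le {q : ℝ≥0∞} (hq : 1 ≤ q) {β : ℝ}
    (hβ : -(1 / q).toReal < β) :
    ∃ K : ℝ, 0 ≤ K ∧ ∀ l : ℝ, 0 < l →
      eLpNorm (fun s : ℝ => s ^ β * Real.exp (-(l * s))) q (volume.restrict (Ioi 0)) ≤
        ENNReal.ofReal (K * l ^ (-(β + (1 / q).toReal))) := by
  by_cases hqt : q = ∞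
  · subst hqt
    simp only [ENNReal.div_top, ENNReal.toReal_zero, neg_zero, add_zero] at hβ ⊢
    obtain ⟨n, hn⟩ := exists_nat_ge β
    refine ⟨1 + n.factorial, by positivity, fun l hl => ?_⟩
    rw [eLpNorm_exponent_top]
    refine eLpNormEssSup_le_of_ae_bound ((ae_restrict_mem measurableSet_Ioi).mono fun s hs => ?_)
    have hs' : (0 : ℝ) < s := hs
    rw [Real.norm_of_nonneg (by positivity)]
    set u := l * s with hu
    have hu0 : 0 < u := by positivity
    have h1 : u ^ β ≤ 1 + u ^ n := by
      rcases le_total u 1 with h | h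
      · have := Real.rpow_le_one hu0.le h hβ.le
        have : 0 ≤ u ^ n := by positivity
        linarith
      · have := Real.rpow_le_rpow_of_exponent_le h hn
        rw [Real.rpow_natCast] at this
        linarith
    have h2 : u ^ n ≤ n.factorial * Real.exp u := by
      have := Real.pow_div_factorial_le_exp u hu0.le n
      rwa [div_le_iff₀' (by positivity)] at this
    have h3 : 1 ≤ Real.exp u := Real.one_le_exp hu0.le
    have h4 : s ^ β = l ^ (-β) * u ^ β := by
      rw [hu, Real.mul_rpow hl.le hs'.le, ← mul_assoc, ← Real.rpow_add hl]
      simp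
    rw [h4, Real.exp_neg, mul_comm _ (l ^ (-β)), mul_assoc]
    refine mul_le_mul_of_nonneg_left ?_ (by positivity)
    rw [← div_eq_mul_inv, div_le_iff₀ (Real.exp_pos _)]
    linarith
  · have hq0 : q ≠ 0 := (one_pos.trans_le hq).ne'
    set r := q.toReal with hr
    have hr0 : 0 < r := ENNReal.toReal_pos hq0 hqt
    have hinv : (1 / q).toReal = r⁻¹ := by rw [one_div, ENNReal.toReal_inv]
    rw [hinv] at hβ ⊢
    have ha : 0 < β * r + 1 := by
      have h := mul_lt_mul_of_pos_right hβ hr0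
      rw [neg_mul, inv_mul_cancel₀ hr0.ne'] at h
      linarith
    refine ⟨((1 / r) ^ (β * r + 1) * Real.Gamma (β * r + 1)) ^ r⁻¹,
      Real.rpow_nonneg (mul_nonneg (by positivity) (Real.Gamma_pos_of_pos ha).le) _,
      fun l hl => ?_⟩
    have hI := Real.integral_rpow_mul_exp_neg_mul_Ioi ha (mul_pos hl hr0)
    have hG := Real.Gamma_pos_of_pos ha
    rw [eLpNorm_eq_lintegral_rpow_enorm_toReal hq0 hqt, ← hr, one_div]
    have e : ∫⁻ s in Ioi (0 : ℝ), ‖s ^ β * Real.exp (-(l * s))‖ₑ ^ r =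
        ENNReal.ofReal ((1 / (l * r)) ^ (β * r + 1) * Real.Gamma (β * r + 1)) := by
      rw [← hI, ofReal_integral_eq_lintegral_ofReal]
      · refine setLIntegral_congr_fun measurableSet_Ioi fun s hs => ?_
        have hs' : (0 : ℝ) < s := hs
        rw [Real.enorm_of_nonneg (by positivity), ENNReal.ofReal_rpow_of_pos (by positivity),
          Real.mul_rpow (by positivity) (by positivity), ← Real.rpow_mul hs'.le, ← Real.exp_mul,
          add_sub_cancel_right]
        congr 3
        ring
      · by_contra hni
        have : Integrable (fun s : ℝ => s ^ (β * r + 1 - 1) * Real.exp (-(l * r * s)))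
            (volume.restrict (Ioi 0)) := by
          by_contra hni
          rw [integral_undef hni] at hI
          have : 0 < (1 / (l * r)) ^ (β * r + 1) * Real.Gamma (β * r + 1) := by positivity
          linarith
        exact hni this
      · refine (ae_restrict_mem measurableSet_Ioi).mono fun s hs => ?_
        have hs' : (0 : ℝ) < s := hs
        simp only [Pi.zero_apply]
        positivity
    rw [e, ENNReal.ofReal_rpow_of_pos (by positivity)]
    refine ENNReal.ofReal_le_ofReal (le_of_eq ?_)
    have e2 : (1 / (l * r)) ^ (β * r + 1) = l ^ (-(β * r + 1)) * (1 / r) ^ (β * r + 1) := by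
      rw [← one_div_mul_one_div, Real.mul_rpow (by positivity) (by positivity), one_div l,
        Real.inv_rpow hl.le, Real.rpow_neg hl.le]
    have e3 : -(β * r + 1) * r⁻¹ = -(β + r⁻¹) := by
      field_simp
    rw [e2, mul_assoc, Real.mul_rpow (by positivity) (by positivity), ← Real.rpow_mul hl.le,
      mul_comm, e3, one_div]

variable {X : Type*} [NormedAddCommGroup X] [NormedSpace ℂ X]
  {A : X →ₗ.[ℂ] X} {ω N : ℝ} {T : ℝ → X →L[ℂ] X}

theorem IsBoundedAnalytic.integrableOn_pow_mul_exp (hT : IsBoundedAnalytic A T N) (k : ℕ)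
    {l : ℝ} (hl : 0 < l) (y : X) :
    IntegrableOn (fun s : ℝ => (s ^ k * Real.exp (-l * s)) • T s y) (Ioi 0) := by
  have h1 : IntegrableOn (fun s : ℝ => s ^ k * Real.exp (-l * s)) (Ioi 0) := by
    have := integrableOn_rpow_mul_exp_neg_mul_rpow (p := 1) (s := k) (b := l)
      (by have : (0 : ℝ) ≤ k := k.cast_nonneg
          linarith) one_pos hl
    simpa using this
  refine (Integrable.mul_const h1 (N * ‖y‖)).mono' ?_ ?_
  · refine ContinuousOn.aestronglyMeasurable ?_ measurableSet_Ioi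
    have hc : Continuous fun s : ℝ => s ^ k * Real.exp (-l * s) := by fun_prop
    exact hc.continuousOn.smul ((hT.continuousOn_apply y).mono Ioi_subset_Ici_self)
  · refine (ae_restrict_mem measurableSet_Ioi).mono fun s hs => ?_
    have hs' : (0 : ℝ) < s := hs
    rw [norm_smul, Real.norm_of_nonneg (by positivity)]
    refine mul_le_mul_of_nonneg_left ?_ (by positivity)
    exact (ContinuousLinearMap.le_opNorm _ _).trans
      (mul_le_mul_of_nonneg_right (hT.norm_le s hs'.le) (norm_nonneg _))

theorem IsSectorial.neg_mem_resolventSet (hA : IsSectorial A ω) {l : ℝ} (hl : 0 < l) :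
    -(l : ℂ) ∈ resolventSet A := by
  refine hA.mem_resolventSet ?_
  rw [← Complex.ofReal_neg, Complex.arg_ofReal_of_neg (by linarith), abs_of_pos Real.pi_pos]
  exact hA.lt_pi

/-- Powers of the resolvent as Laplace transforms of the semigroup. -/
theorem IsBoundedAnalytic.integral_pow_mul_exp [CompleteSpace X] (hA : IsSectorial A ω)
    (hT : IsBoundedAnalytic A T N) {l : ℝ} (hl : 0 < l) (k : ℕ) (y : X) :
    ∫ s in Ioi (0 : ℝ), (s ^ k * Real.exp (-l * s)) • T s y =
      (k.factorial : ℝ) • (invShift A (l : ℂ) ^ (k + 1)) y := by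
  -- Integration by parts with z = (l + A)⁻¹y. Here f' stands for the derivative of f plus l f, so
  -- that y = lz + Az makes (f T z)' = f' T z - f T y. For f = s^k e^{-ls} this f' is k s^{k-1}
  -- e^{-ls}, which lowers the power by one.
  have step : ∀ (f f' : ℝ → ℝ) (y : X), (∀ s, HasDerivAt f (f' s - l * f s) s) →
      Tendsto f atTop (𝓝 0) →
      IntegrableOn (fun s => f' s • T s (invShift A (l : ℂ) y)) (Ioi 0) →
      IntegrableOn (fun s => f s • T s y) (Ioi 0) →
      (∫ s in Ioi (0 : ℝ), f' s • T s (invShift A (l : ℂ) y)) - ∫ s in Ioi (0 : ℝ), f s • T s y =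
        -(f 0 • invShift A (l : ℂ) y) := by
    intro f f' y hf hlim hi' hi
    obtain ⟨hz, hz'⟩ := invShift_spec (hA.neg_mem_resolventSet hl) y
    set z := invShift A (l : ℂ) y with hzdef
    have hdz : ∀ s : ℝ, 0 < s → HasDerivAt (fun s => f s • T s z) (f' s • T s z - f s • T s y) s := by
      intro s hs
      have h1 := hT.hasDerivWithinAt_apply hA ⟨z, hz⟩ hs.le
      have h2 : HasDerivAt (fun t => T t z) (-T s (A ⟨z, hz⟩)) s := by
        obtain ⟨D, hD, -, hDA⟩ := hT.deriv s hs
        have h3 := ((ContinuousLinearMap.apply ℂ X z).restrictScalars ℝ).hasFDerivAt.comp_hasDerivAt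
          s hD
        have h4 : HasDerivAt (fun t => T t z) ((-D) z) s := h3
        have h5 := h4.hasDerivWithinAt (s := Ici s)
        rwa [(uniqueDiffWithinAt_Ici s).eq_deriv _ h5 h1] at h4
      refine ((hf s).smul h2).congr_deriv ?_
      have h6 := congrArg (T s) hz'
      rw [_root_.map_add, map_smul, Complex.coe_smul] at h6
      rw [← h6, sub_smul, smul_add, smul_neg, mul_smul, smul_comm l]
      abel
    have hcw : ContinuousWithinAt (fun s => f s • T s z) (Ici 0) 0 :=
      (hf 0).continuousAt.continuousWithinAt.smul (hT.continuousOn_apply z 0 self_mem_Ici)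
    have hlim' : Tendsto (fun s => f s • T s z) atTop (𝓝 0) := by
      have h1 := hlim.norm.mul_const (N * ‖z‖)
      rw [norm_zero, zero_mul] at h1
      refine squeeze_zero_norm' ?_ h1
      filter_upwards [eventually_ge_atTop 0] with s hs
      rw [norm_smul]
      refine mul_le_mul_of_nonneg_left ?_ (norm_nonneg _)
      exact (ContinuousLinearMap.le_opNorm _ _).trans
        (mul_le_mul_of_nonneg_right (hT.norm_le s hs) (norm_nonneg _))
    have h := integral_Ioi_of_hasDerivAt_of_tendsto hcw (fun s hs => hdz s hs) (hi'.sub hi) hlim'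
    rw [integral_sub hi' hi, zero_sub, hT.map_zero, one_apply_eq_self] at h
    exact h
  have hlimk : ∀ k : ℕ, Tendsto (fun s : ℝ => s ^ k * Real.exp (-l * s)) atTop (𝓝 0) := fun k => by
    simpa using tendsto_rpow_mul_exp_neg_mul_atTop_nhds_zero k l hl
  have hexp : ∀ s : ℝ, HasDerivAt (fun s : ℝ => Real.exp (-l * s)) (-(l * Real.exp (-l * s))) s := by
    intro s
    refine (((hasDerivAt_id s).const_mul (-l)).exp).congr_deriv ?_
    simp only [id, mul_one]
    ring
  induction k generalizing y with
  | zero =>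
    have h := step (fun s => s ^ 0 * Real.exp (-l * s)) (fun _ => 0) y ?_ (hlimk 0) ?_
      (hT.integrableOn_pow_mul_exp 0 hl y)
    · simp only [zero_smul, integral_zero, zero_sub] at h
      rw [neg_injective h]
      simp
    · intro s
      simpa using hexp s
    · simp only [zero_smul]
      exact integrableOn_zero
  | succ k ih =>
    have h := step (fun s => s ^ (k + 1) * Real.exp (-l * s))
      (fun s => ((k + 1 : ℕ) : ℝ) * (s ^ k * Real.exp (-l * s))) y ?_ (hlimk _) ?_
      (hT.integrableOn_pow_mul_exp (k + 1) hl y)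
    · simp only [mul_smul ((k + 1 : ℕ) : ℝ)] at h
      rw [integral_smul, ih, zero_pow (Nat.succ_ne_zero k), zero_mul, zero_smul, neg_zero,
        sub_eq_zero] at h
      rw [← h, smul_smul, ← mul_apply_eq_comp, ← pow_succ, Nat.factorial_succ, Nat.cast_mul]
    · intro s
      refine ((hasDerivAt_pow (k + 1) s).mul (hexp s)).congr_deriv ?_
      simp only [Nat.add_sub_cancel]
      ring
    · simp only [mul_smul ((k + 1 : ℕ) : ℝ)]
      exact (hT.integrableOn_pow_mul_exp k hl _).smul _

end LaplaceTransform

/-! ### Admissibility implies boundedness of W_C. -/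

section Necessity

variable {X Y : Type*} [NormedAddCommGroup X] [NormedSpace ℂ X]
  [NormedAddCommGroup Y] [NormedSpace ℂ Y] {A : X →ₗ.[ℂ] X} {ω N : ℝ} {T : ℝ → X →L[ℂ] X} {k : ℕ}

/-- The bounded operator `C (1 + A)^{-k}`. -/
def obsInv (C : DomSpace A k →L[ℂ] Y) : X →L[ℂ] Y := C ∘L invShiftPow A 1 k

theorem IsBoundedAnalytic.commute_pow (hT : IsBoundedAnalytic A T N) {t : ℝ} (ht : 0 ≤ t)
    {s : ℝ} (hs : 0 < s) (k : ℕ) : Commute (T t) (unitResolvent A s ^ k) :=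
  (hT.commute t ht s hs).pow_right k

/-- T(t) commutes with (1 + A)^{-k}, so C T(t)x can be computed from (1 + A)^k x with a bounded
operator; integrals and limits may then be moved through C. -/
theorem IsBoundedAnalytic.obs_onDom (hA : IsSectorial A ω) (hT : IsBoundedAnalytic A T N)
    {T' : ℝ≥0 → X →L[ℂ] X} (hT' : IsSemigroupGeneratedByNeg T' A) (hTT : ∀ t : ℝ≥0, T' t = T t)
    (C : DomSpace A k →L[ℂ] Y) (t : ℝ≥0) (x : DomSpace A k) :
    C (hT'.onDom k t x) = obsInv C (T t (DomSpace.toX A k x)) := by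
  have h : DomSpace.incl A k (hT'.onDom k t x) =
      DomSpace.incl A k (invShiftPow A 1 k (T t (DomSpace.toX A k x))) := by
    rw [incl_invShiftPow, invShift_one, ← mul_apply_eq_comp,
      ← (hT.commute_pow t.coe_nonneg one_pos k).eq, mul_apply_eq_comp, hA.unitResolvent_pow_toX, ← hTT]
    rfl
  exact congrArg C (Subtype.ext h)

theorem IsSectorial.obs_invShiftPow (hA : IsSectorial A ω) (C : DomSpace A k →L[ℂ] Y)
    {l : ℝ} (hl : 0 < l) (y : X) :
    C (invShiftPow A (l : ℂ) k ((unitResolvent A 1 ^ k) y)) =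
      obsInv C ((invShift A (l : ℂ) ^ k) y) := by
  have hc : Commute (invShift A (l : ℂ)) (unitResolvent A 1) := by
    rw [invShift_eq_unitResolvent hl]
    exact (hA.commute_unitResolvent (inv_pos.2 hl) one_pos).smul_left _
  have h : DomSpace.incl A k (invShiftPow A (l : ℂ) k ((unitResolvent A 1 ^ k) y)) =
      DomSpace.incl A k (invShiftPow A 1 k ((invShift A (l : ℂ) ^ k) y)) := by
    rw [incl_invShiftPow, incl_invShiftPow, invShift_one, ← mul_apply_eq_comp,
      (hc.pow_pow k k).eq, mul_apply_eq_comp]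
  exact congrArg C (Subtype.ext h)

/-- Hölder's inequality applied to the Laplace formula for (l + A)^{-k}, with the powers of l
matched through 1/p + 1/q = 1. -/
theorem isBounded_weissSet_of_isLpAdmissible [CompleteSpace X] [CompleteSpace Y] {p : ℝ≥0∞}
    (hp : 1 ≤ p) (hA : IsSectorial A ω) (hω : ω < Real.pi / 2) (hdom : Dense (A.domain : Set X))
    (hk : 1 ≤ k) {C : DomSpace A k →L[ℂ] Y} {α : ℝ} (hα' : α < k - (1 / p).toReal)
    (h : IsLpAdmissible p α A C) : Bornology.IsBounded (weissSet p α A C) := by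
  obtain ⟨T', hT', M, hM⟩ := h
  obtain ⟨T, N, hT⟩ := hA.exists_isBoundedAnalytic hω hdom
  have hTT := hT.eq_semigroup hA hdom hT'
  obtain ⟨j, rfl⟩ : ∃ j, k = j + 1 := ⟨k - 1, by omega⟩
  set q := p.conjExponent with hq
  have hpq : p.HolderConjugate q := ENNReal.HolderConjugate.conjExponent hp
  have hqp : ENNReal.HolderTriple q p 1 := ENNReal.HolderTriple.symm
  have hq1 : 1 ≤ q := ENNReal.HolderConjugate.one_le q p
  have hsum : (1 / p).toReal + (1 / q).toReal = 1 := by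
    rw [one_div, one_div, ← ENNReal.toReal_add, ENNReal.HolderConjugate.inv_add_inv_eq_one p q,
      ENNReal.toReal_one]
    · exact ENNReal.inv_ne_top.2 (one_pos.trans_le hp).ne'
    · exact ENNReal.inv_ne_top.2 (one_pos.trans_le hq1).ne'
  have hβ : -(1 / q).toReal < (j : ℝ) - α := by
    push_cast at hα'
    linarith
  obtain ⟨K, hK0, hK⟩ := exists_eLpNorm_rpow_mul_exp_le hq1 hβ
  have hexp : (j : ℝ) - α + (1 / q).toReal = ((j + 1 : ℕ) : ℝ) - α - (1 / p).toReal := by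
    push_cast
    linarith
  rw [hexp] at hK
  set γ := ((j + 1 : ℕ) : ℝ) - α - (1 / p).toReal with hγ
  -- The estimate is proved on the range of J_1^k, where the orbit is observed by C, and extended to
  -- X by density at the end.
  have key : ∀ l : ℝ, 0 < l → ∀ y : X,
      ‖C (invShiftPow A (l : ℂ) (j + 1) ((unitResolvent A 1 ^ (j + 1)) y))‖ ≤
        K * l ^ (-γ) * M * ‖(unitResolvent A 1 ^ (j + 1)) y‖ := by
    intro l hl y
    set x : DomSpace A (j + 1) := invShiftPow A 1 (j + 1) y with hx
    have hxi : DomSpace.incl A (j + 1) x = (unitResolvent A 1 ^ (j + 1)) y := by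
      rw [hx, incl_invShiftPow, invShift_one]
    have hxX : DomSpace.toX A (j + 1) x = y := by
      have := toX_invShiftPowLin (A := A) (z := ((1 : ℝ) : ℂ)) (hA.neg_mem_resolventSet one_pos)
        (j + 1) y
      simp only [Complex.ofReal_one, sub_self, zero_smul, add_zero, one_pow,
        one_apply_eq_self] at this
      exact this
    rw [hA.obs_invShiftPow C hl, ← hxi]
    have hI := hT.integral_pow_mul_exp hA hl j y
    have hint := hT.integrableOn_pow_mul_exp j hl y
    have hI2 := congrArg (obsInv C) hI
    rw [← ContinuousLinearMap.integral_comp_comm _ hint, ContinuousLinearMap.map_smul_of_tower]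
      at hI2
    have hint2 := (obsInv C).integrable_comp hint
    have hlim := (intervalIntegral_tendsto_integral_Ioi 0 hint2 tendsto_id).norm
    rw [hI2] at hlim
    have hB0 : 0 ≤ K * l ^ (-γ) * M * ‖DomSpace.incl A (j + 1) x‖ := by positivity
    have hbd : ‖(j.factorial : ℝ) • obsInv C ((invShift A (l : ℂ) ^ (j + 1)) y)‖ ≤
        K * l ^ (-γ) * M * ‖DomSpace.incl A (j + 1) x‖ := by
      refine le_of_tendsto hlim ?_
      filter_upwards [eventually_gt_atTop 0] with τ hτ
      rw [id, intervalIntegral.integral_of_le hτ.le]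
      obtain ⟨hm, hb⟩ := hM τ hτ x
      set μ := volume.restrict (Ioc 0 τ) with hμ
      have hμ1 : μ ≤ volume.restrict (Icc 0 τ) := Measure.restrict_mono Ioc_subset_Icc_self le_rfl
      have hμ2 : μ ≤ volume.restrict (Ioi 0) := Measure.restrict_mono Ioc_subset_Ioi_self le_rfl
      set a : ℝ → ℝ := fun s => s ^ ((j : ℝ) - α) * Real.exp (-(l * s)) with ha
      set b : ℝ → Y := fun t => t ^ α • C (hT'.onDom (j + 1) t.toNNReal x) with hbdef
      have hams : AEStronglyMeasurable a μ := by
        refine ContinuousOn.aestronglyMeasurable ?_ measurableSet_Ioc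
        refine ContinuousOn.mul (fun s hs => ?_) (by fun_prop)
        exact (Real.continuousAt_rpow_const _ _ (Or.inl hs.1.ne')).continuousWithinAt
      -- Hölder for s^j e^{-ls} = (s^{j-α} e^{-ls}) s^α; admissibility controls the second weight
      -- uniformly in τ, so τ → ∞ is harmless.
      have h1 := eLpNorm_smul_le_mul_eLpNorm (p := q) (q := p) (r := 1)
        (hm.1.mono_measure hμ1) hams
      have h2 : eLpNorm (a • b) 1 μ ≤
          ENNReal.ofReal (K * l ^ (-γ)) * (M * ‖DomSpace.incl A (j + 1) x‖ₑ) :=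
        h1.trans (mul_le_mul' ((eLpNorm_mono_measure _ hμ2).trans (hK l hl))
          ((eLpNorm_mono_measure _ hμ1).trans hb))
      have h3 : ∫ s in Ioc 0 τ, (obsInv C) ((s ^ j * Real.exp (-l * s)) • T s y) =
          ∫ s, (a • b) s ∂μ := by
        refine setIntegral_congr_fun measurableSet_Ioc fun s hs => ?_
        have hs0 : 0 < s := hs.1
        simp only [ha, hbdef, Pi.smul_apply']
        rw [hT.obs_onDom hA hT' hTT, hxX, Real.coe_toNNReal _ hs0.le, smul_smul,
          ContinuousLinearMap.map_smul_of_tower]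
        congr 1
        rw [mul_right_comm, ← Real.rpow_add hs0, sub_add_cancel, Real.rpow_natCast, neg_mul]
      rw [h3]
      have h4 := (enorm_integral_le_lintegral_enorm (μ := μ) (a • b)).trans
        ((eLpNorm_one_eq_lintegral_enorm (f := a • b) (μ := μ)).symm.le.trans h2)
      have e : ENNReal.ofReal (K * l ^ (-γ)) * (M * ‖DomSpace.incl A (j + 1) x‖ₑ) =
          ENNReal.ofReal (K * l ^ (-γ) * M * ‖DomSpace.incl A (j + 1) x‖) := by
        rw [← ofReal_norm, ← ENNReal.ofReal_coe_nnreal, ← ENNReal.ofReal_mul M.coe_nonneg,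
          ← ENNReal.ofReal_mul (by positivity)]
        congr 1
        ring
      rw [e, ← ofReal_norm] at h4
      exact (ENNReal.ofReal_le_ofReal_iff hB0).1 h4
    -- The factor j! from the Laplace formula is at least 1 and may be discarded.
    rw [norm_smul, Real.norm_of_nonneg (by positivity)] at hbd
    refine le_trans (le_mul_of_one_le_left (norm_nonneg _) ?_) hbd
    exact_mod_cast Nat.succ_le_of_lt j.factorial_pos
  rw [isBounded_iff_forall_norm_le]
  refine ⟨K * M, ?_⟩
  rintro _ ⟨l, hl, rfl⟩
  refine ContinuousLinearMap.opNorm_le_bound _ (by positivity) fun x => ?_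
  have hcl : IsClosed {x : X | ‖(l ^ γ • (C ∘L invShiftPow A (l : ℂ) (j + 1))) x‖ ≤
      K * M * ‖x‖} := isClosed_le (by fun_prop) (by fun_prop)
  have hsub : range ⇑(unitResolvent A 1 ^ (j + 1)) ⊆
      {x : X | ‖(l ^ γ • (C ∘L invShiftPow A (l : ℂ) (j + 1))) x‖ ≤ K * M * ‖x‖} := by
    rintro _ ⟨y, rfl⟩
    rw [mem_ofPred_eq, smul_apply, ContinuousLinearMap.comp_apply, norm_smul,
      Real.norm_of_nonneg (by positivity)]
    calc _ ≤ l ^ γ * (K * l ^ (-γ) * M * ‖(unitResolvent A 1 ^ (j + 1)) y‖) :=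
          mul_le_mul_of_nonneg_left (key l hl y) (by positivity)
      _ = (l ^ γ * l ^ (-γ)) * (K * M * ‖(unitResolvent A 1 ^ (j + 1)) y‖) := by ring
      _ = _ := by rw [← Real.rpow_add hl, add_neg_cancel, Real.rpow_zero, one_mul]
  exact hcl.closure_subset_iff.2 hsub (hA.denseRange_unitResolvent_pow hdom (j + 1) x)

end Necessity

/-! ### Integrals of (1 - J_s)^{a+1} J_s^{b+1} against ds/s. -/

section MultiplicativeIntegrals

/-- Only a limit at 0+ is required. This matters because `unitResolvent A 0` has the default value
0, whereas J_s x tends to x on `core A`. -/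
theorem integral_Ioi_zero_of_hasDerivAt_of_tendsto {E : Type*} [NormedAddCommGroup E]
    [NormedSpace ℝ E] [CompleteSpace E] {f f' : ℝ → E} {a m : E}
    (h0 : Tendsto f (𝓝[>] 0) (𝓝 a)) (hd : ∀ s ∈ Ioi (0 : ℝ), HasDerivAt f (f' s) s)
    (hi : IntegrableOn f' (Ioi 0)) (hm : Tendsto f atTop (𝓝 m)) :
    ∫ s in Ioi (0 : ℝ), f' s = m - a := by
  have hc : ContinuousWithinAt (Function.update f 0 a) (Ici 0) 0 := by
    rw [← Ioi_insert, continuousWithinAt_insert_self, ContinuousWithinAt,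
      Function.update_self]
    refine h0.congr' ?_
    filter_upwards [self_mem_nhdsWithin] with s hs
    rw [Function.update_of_ne (ne_of_gt hs)]
  have h := integral_Ioi_of_hasDerivAt_of_tendsto (f' := f') (m := m) hc (fun s hs => ?_) hi ?_
  · rwa [Function.update_self] at h
  · refine (hd s hs).congr_of_eventuallyEq ?_
    filter_upwards [lt_mem_nhds (show (0 : ℝ) < s from hs)] with u hu
    rw [Function.update_of_ne hu.ne']
  · refine hm.congr' ?_
    filter_upwards [eventually_gt_atTop 0] with u hu
    rw [Function.update_of_ne hu.ne']

variable {X : Type*} [NormedAddCommGroup X] [NormedSpace ℂ X] {A : X →ₗ.[ℂ] X} {ω : ℝ}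

theorem commute_one_sub_self {R : Type*} [Ring R] (a : R) : Commute (1 - a) a :=
  (Commute.one_left a).sub_left (Commute.refl a)

theorem IsSectorial.exists_unitResolvent_bounds (hA : IsSectorial A ω) :
    ∃ M : ℝ, 1 ≤ M ∧ ∀ s : ℝ, 0 < s → ‖unitResolvent A s‖ ≤ M ∧ ‖1 - unitResolvent A s‖ ≤ M := by
  obtain ⟨M, hM1, hM⟩ := hA.exists_unitResolvent_bound
  refine ⟨1 + M, by linarith, fun s hs => ⟨(hM s hs).trans (by linarith), ?_⟩⟩
  exact (norm_sub_le _ _).trans (add_le_add ContinuousLinearMap.norm_id_le (hM s hs))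

theorem norm_pow_apply_le {L : X →L[ℂ] X} {M : ℝ} (hL : ‖L‖ ≤ M) (n : ℕ) (x : X) :
    ‖(L ^ n) x‖ ≤ M ^ n * ‖x‖ := by
  induction n with
  | zero => simp
  | succ n ih =>
    rw [pow_succ', mul_apply_eq_comp, pow_succ' M, mul_assoc]
    exact (L.le_opNorm _).trans (mul_le_mul hL ih (norm_nonneg _) ((norm_nonneg _).trans hL))

theorem IsSectorial.one_sub_unitResolvent_mul (hA : IsSectorial A ω) {s : ℝ} (hs : 0 < s) :
    (1 - unitResolvent A s) * unitResolvent A 1 =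
      (s : ℂ) • (unitResolvent A s * (1 - unitResolvent A 1)) := by
  have := hA.unitResolvent_swap hs one_pos
  rwa [Complex.ofReal_one, one_smul] at this

theorem IsSectorial.unitResolvent_mul_one_sub (hA : IsSectorial A ω) {s : ℝ} (hs : 0 < s) :
    unitResolvent A s * (1 - unitResolvent A 1) =
      (s : ℂ)⁻¹ • ((1 - unitResolvent A s) * unitResolvent A 1) := by
  have hs' : (s : ℂ) ≠ 0 := by exact_mod_cast hs.ne'
  rw [hA.one_sub_unitResolvent_mul hs, smul_smul, inv_mul_cancel₀ hs', one_smul]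

/-- The elements of `D(A) ∩ R(A)` on which integrals with respect to `ds / s` converge. -/
def core (A : X →ₗ.[ℂ] X) : Set X :=
  range ⇑((1 - unitResolvent A 1) * unitResolvent A 1)

theorem IsSectorial.dense_core (hA : IsSectorial A ω) (hdom : Dense (A.domain : Set X))
    (hran : DenseRange fun x : A.domain => A x) : Dense (core A) :=
  (hA.denseRange_one_sub_unitResolvent hran).comp (hA.denseRange_unitResolvent hdom)
    (1 - unitResolvent A 1).continuous

/-- For x = (1 - J_1)J_1 y, a factor J_1 is traded by (1 - J_s)J_1 = s J_s(1 - J_1), which gains s,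
and a factor 1 - J_1 by the inverse relation, which gains 1/s. -/
theorem IsSectorial.exists_core_bounds (hA : IsSectorial A ω) {x : X} (hx : x ∈ core A) :
    ∃ K : ℝ, 0 ≤ K ∧ ∀ s : ℝ, 0 < s →
      ‖(1 - unitResolvent A s) x‖ ≤ K * s ∧ ‖unitResolvent A s x‖ ≤ K * s⁻¹ := by
  obtain ⟨y, rfl⟩ := hx
  obtain ⟨M, hM1, hM⟩ := hA.exists_unitResolvent_bounds
  set J := unitResolvent A 1 with hJ
  refine ⟨M * ‖(1 - J) ((1 - J) y)‖ + M * ‖J (J y)‖, by positivity, fun s hs => ⟨?_, ?_⟩⟩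
  · have e : (1 - unitResolvent A s) (((1 - J) * J) y) =
        (s : ℂ) • unitResolvent A s ((1 - J) ((1 - J) y)) := by
      rw [(commute_one_sub_self J).eq, ← mul_apply_eq_comp, ← mul_assoc, hJ,
        hA.one_sub_unitResolvent_mul hs]
      rfl
    rw [e, norm_smul, Complex.norm_real, Real.norm_of_nonneg hs.le, mul_comm]
    refine mul_le_mul_of_nonneg_right ?_ hs.le
    refine ((ContinuousLinearMap.le_opNorm _ _).trans
      (mul_le_mul_of_nonneg_right (hM s hs).1 (norm_nonneg _))).trans ?_
    have : 0 ≤ M * ‖J (J y)‖ := by positivity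
    linarith
  · have e : unitResolvent A s (((1 - J) * J) y) =
        (s : ℂ)⁻¹ • (1 - unitResolvent A s) (J (J y)) := by
      rw [← mul_apply_eq_comp, ← mul_assoc, hJ, hA.unitResolvent_mul_one_sub hs]
      rfl
    rw [e, norm_smul, norm_inv, Complex.norm_real, Real.norm_of_nonneg hs.le, mul_comm]
    refine mul_le_mul_of_nonneg_right ?_ (inv_nonneg.2 hs.le)
    refine ((ContinuousLinearMap.le_opNorm _ _).trans
      (mul_le_mul_of_nonneg_right (hM s hs).2 (norm_nonneg _))).trans ?_
    have : 0 ≤ M * ‖(1 - J) ((1 - J) y)‖ := by positivity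
    linarith

/-- The operator `(1 - J_s)^(a+1) J_s^(b+1)`, where `J_s = (1 + s A)⁻¹`. -/
def betaOp (A : X →ₗ.[ℂ] X) (a b : ℕ) (s : ℝ) : X →L[ℂ] X :=
  (1 - unitResolvent A s) ^ (a + 1) * unitResolvent A s ^ (b + 1)

theorem betaOp_succ_left (a b : ℕ) (s : ℝ) :
    betaOp A (a + 1) b s = betaOp A a b s - betaOp A a (b + 1) s := by
  simp only [betaOp]
  rw [pow_succ _ (a + 1), pow_succ' _ (b + 1), mul_assoc, sub_mul, one_mul, mul_sub]

theorem continuousOn_betaOp (hA : IsSectorial A ω) (a b : ℕ) :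
    ContinuousOn (betaOp A a b) (Ioi 0) :=
  ((continuousOn_const.sub hA.continuousOn_unitResolvent).pow _).mul
    (hA.continuousOn_unitResolvent.pow _)

/-- The two core bounds combine through min(s, 1/s) ≤ 4s/(s + 1)². The constants do not depend on b
except through M^b, a geometric growth that the later expansion in powers of z + 1 has to beat. -/
theorem IsSectorial.exists_betaOp_bound (hA : IsSectorial A ω) {x : X} (hx : x ∈ core A) (a : ℕ) :
    ∃ K M : ℝ, 0 ≤ K ∧ 1 ≤ M ∧ ∀ b : ℕ, ∀ s : ℝ, 0 < s →
      ‖betaOp A a b s x‖ ≤ K * M ^ b * (s * (s + 1) ^ (-2 : ℝ)) := by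
  obtain ⟨M, hM1, hM⟩ := hA.exists_unitResolvent_bounds
  obtain ⟨K, hK0, hK⟩ := hA.exists_core_bounds hx
  refine ⟨4 * (M ^ (a + 1) * K), M, by positivity, hM1, fun b s hs => ?_⟩
  have h1 : ‖betaOp A a b s x‖ ≤ M ^ (a + 1) * (M ^ b * (K * s⁻¹)) := by
    rw [betaOp, mul_apply_eq_comp, pow_succ (unitResolvent A s), mul_apply_eq_comp]
    refine (norm_pow_apply_le (hM s hs).2 _ _).trans
      (mul_le_mul_of_nonneg_left ?_ (by positivity))
    exact (norm_pow_apply_le (hM s hs).1 _ _).trans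
      (mul_le_mul_of_nonneg_left (hK s hs).2 (by positivity))
  have h2 : ‖betaOp A a b s x‖ ≤ M ^ (b + 1) * (M ^ a * (K * s)) := by
    rw [betaOp, ((commute_one_sub_self (unitResolvent A s)).pow_pow _ _).eq, mul_apply_eq_comp,
      pow_succ (1 - unitResolvent A s), mul_apply_eq_comp]
    refine (norm_pow_apply_le (hM s hs).1 _ _).trans
      (mul_le_mul_of_nonneg_left ?_ (by positivity))
    exact (norm_pow_apply_le (hM s hs).2 _ _).trans
      (mul_le_mul_of_nonneg_left (hK s hs).1 (by positivity))
  have e : (s + 1) ^ (-2 : ℝ) = ((s + 1) ^ 2)⁻¹ := by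
    rw [Real.rpow_neg (by positivity)]
    norm_cast
  rw [e]
  set P := M ^ (a + 1) * M ^ b * K with hP
  have hP0 : 0 ≤ P := by positivity
  have h1' : ‖betaOp A a b s x‖ ≤ P * s⁻¹ := h1.trans_eq (by rw [hP]; ring)
  have h2' : ‖betaOp A a b s x‖ ≤ P * s := h2.trans_eq (by rw [hP]; ring)
  have h3 : 4 * (M ^ (a + 1) * K) * M ^ b * (s * ((s + 1) ^ 2)⁻¹) =
      P * (4 * s / (s + 1) ^ 2) := by rw [hP]; ring
  rw [h3]
  rcases le_total s 1 with h | h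
  · refine h2'.trans (mul_le_mul_of_nonneg_left ?_ hP0)
    rw [le_div_iff₀ (by positivity)]
    have : (s + 1) ^ 2 ≤ 4 := by nlinarith
    nlinarith
  · refine h1'.trans (mul_le_mul_of_nonneg_left ?_ hP0)
    rw [le_div_iff₀ (by positivity), inv_mul_le_iff₀ hs]
    nlinarith

theorem integrableOn_add_one_rpow :
    IntegrableOn (fun s : ℝ => (s + 1) ^ (-2 : ℝ)) (Ioi 0) :=
  integrableOn_add_rpow_Ioi_of_lt (by norm_num) (by norm_num)

theorem IsSectorial.integrableOn_mul_betaOp (hA : IsSectorial A ω) {x : X} (hx : x ∈ core A)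
    {E : Type*} [NormedAddCommGroup E] [NormedSpace ℂ E] {B : ℝ → X →L[ℂ] E}
    (hB : ContinuousOn B (Ioi 0)) {K : ℝ} (hK : ∀ s : ℝ, 0 < s → ‖B s‖ ≤ K) (a b : ℕ) :
    IntegrableOn (fun s : ℝ => (s : ℂ)⁻¹ • B s (betaOp A a b s x)) (Ioi 0) := by
  obtain ⟨K', M, hK', hM, hb⟩ := hA.exists_betaOp_bound hx a
  refine (integrableOn_add_one_rpow.const_mul (K * (K' * M ^ b))).mono' ?_ ?_
  · refine ContinuousOn.aestronglyMeasurable ?_ measurableSet_Ioi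
    refine ContinuousOn.smul (ContinuousOn.inv₀ (by fun_prop) fun s hs => ?_)
      (hB.clm_apply ((continuousOn_betaOp hA a b).clm_apply continuousOn_const))
    exact_mod_cast (ne_of_gt hs : s ≠ 0)
  · refine (ae_restrict_mem measurableSet_Ioi).mono fun s hs => ?_
    have hs' : (0 : ℝ) < s := hs
    have hK0 : 0 ≤ K := (norm_nonneg _).trans (hK s hs')
    rw [norm_smul, norm_inv, Complex.norm_real, Real.norm_of_nonneg hs'.le]
    calc s⁻¹ * ‖B s (betaOp A a b s x)‖
        ≤ s⁻¹ * (K * (K' * M ^ b * (s * (s + 1) ^ (-2 : ℝ)))) := by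
          refine mul_le_mul_of_nonneg_left ?_ (by positivity)
          exact (ContinuousLinearMap.le_opNorm _ _).trans
            (mul_le_mul (hK s hs') (hb b s hs') (norm_nonneg _) hK0)
      _ = K * (K' * M ^ b) * (s + 1) ^ (-2 : ℝ) := by field_simp

theorem IsSectorial.integrableOn_betaOp (hA : IsSectorial A ω) {x : X} (hx : x ∈ core A)
    (a b : ℕ) : IntegrableOn (fun s : ℝ => (s : ℂ)⁻¹ • betaOp A a b s x) (Ioi 0) :=
  hA.integrableOn_mul_betaOp hx (B := fun _ => ContinuousLinearMap.id ℂ X) continuousOn_const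
    (fun _ _ => ContinuousLinearMap.norm_id_le) a b

theorem IsSectorial.hasDerivAt_unitResolvent_pow (hA : IsSectorial A ω) {s : ℝ} (hs : 0 < s)
    (n : ℕ) : HasDerivAt (fun s => unitResolvent A s ^ n)
      (-((n : ℂ) • (s : ℂ)⁻¹ • ((1 - unitResolvent A s) * unitResolvent A s ^ n))) s := by
  induction n with
  | zero => simpa using hasDerivAt_const s (1 : X →L[ℂ] X)
  | succ n ih =>
    simp only [pow_succ']
    refine ((hA.hasDerivAt_unitResolvent hs).mul ih).congr_deriv ?_
    have h := (commute_one_sub_self (unitResolvent A s)).eq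
    rw [mul_neg, mul_smul_comm, mul_smul_comm, ← mul_assoc, ← h, neg_mul, smul_mul_assoc,
      mul_assoc]
    push_cast
    module

theorem IsSectorial.tendsto_unitResolvent_pow_zero (hA : IsSectorial A ω) {x : X}
    (hx : x ∈ core A) (n : ℕ) :
    Tendsto (fun s => (unitResolvent A s ^ n) x) (𝓝[>] 0) (𝓝 x) := by
  obtain ⟨M, hM1, hM⟩ := hA.exists_unitResolvent_bounds
  obtain ⟨K, hK0, hK⟩ := hA.exists_core_bounds hx
  have hlim : Tendsto (fun s : ℝ => (n : ℝ) * M ^ n * (K * s)) (𝓝[>] 0) (𝓝 0) := by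
    refine tendsto_nhdsWithin_of_tendsto_nhds (Continuous.tendsto' (by fun_prop) _ _ ?_)
    simp
  rw [tendsto_iff_norm_sub_tendsto_zero]
  refine squeeze_zero' (Eventually.of_forall fun _ => norm_nonneg _) ?_ hlim
  filter_upwards [self_mem_nhdsWithin] with s hs
  have hs' : (0 : ℝ) < s := hs
  induction n with
  | zero => simp
  | succ n ih =>
    have hb := norm_pow_apply_le (hM s hs').1 n ((1 - unitResolvent A s) x)
    have e : (unitResolvent A s ^ (n + 1)) x - x =
        ((unitResolvent A s ^ n) x - x) - (unitResolvent A s ^ n) ((1 - unitResolvent A s) x) := by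
      rw [pow_succ, mul_apply_eq_comp, sub_apply, one_apply_eq_self, map_sub]
      abel
    have ih' := ih (by
      refine tendsto_nhdsWithin_of_tendsto_nhds (Continuous.tendsto' (by fun_prop) _ _ ?_)
      simp)
    have h3 : M ^ n * ‖(1 - unitResolvent A s) x‖ ≤ M ^ n * (K * s) :=
      mul_le_mul_of_nonneg_left (hK s hs').1 (by positivity)
    have h4 : M ^ n ≤ M ^ (n + 1) := pow_le_pow_right₀ hM1 (Nat.le_succ n)
    have h5 : 0 ≤ K * s := by positivity
    rw [e]
    refine (norm_sub_le _ _).trans ?_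
    rw [Nat.cast_succ]
    have h6 : (n : ℝ) * M ^ n * (K * s) ≤ n * M ^ (n + 1) * (K * s) := by gcongr
    have h7 : M ^ n * (K * s) ≤ M ^ (n + 1) * (K * s) := by gcongr
    have h8 := add_le_add ih' (hb.trans h3)
    linarith

theorem IsSectorial.tendsto_unitResolvent_pow_atTop (hA : IsSectorial A ω) {x : X}
    (hx : x ∈ core A) (n : ℕ) :
    Tendsto (fun s => (unitResolvent A s ^ (n + 1)) x) atTop (𝓝 0) := by
  obtain ⟨M, hM1, hM⟩ := hA.exists_unitResolvent_bounds
  obtain ⟨K, hK0, hK⟩ := hA.exists_core_bounds hx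
  have hlim : Tendsto (fun s : ℝ => M ^ n * (K * s⁻¹)) atTop (𝓝 0) := by
    simpa using (tendsto_inv_atTop_zero.const_mul K).const_mul (M ^ n)
  refine squeeze_zero_norm' ?_ hlim
  filter_upwards [eventually_gt_atTop 0] with s hs
  rw [pow_succ, mul_apply_eq_comp]
  exact (norm_pow_apply_le (hM s hs).1 _ _).trans
    (mul_le_mul_of_nonneg_left (hK s hs).2 (by positivity))

theorem integral_beta_succ (a b : ℕ) :
    ∫ j in (0 : ℝ)..1, (1 - (j : ℂ)) ^ (a + 1) * (j : ℂ) ^ b =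
      (∫ j in (0 : ℝ)..1, (1 - (j : ℂ)) ^ a * (j : ℂ) ^ b) -
        ∫ j in (0 : ℝ)..1, (1 - (j : ℂ)) ^ a * (j : ℂ) ^ (b + 1) := by
  rw [← intervalIntegral.integral_sub (Continuous.intervalIntegrable (by fun_prop) _ _)
    (Continuous.intervalIntegrable (by fun_prop) _ _)]
  congr 1
  ext j
  ring

/-- Since s dJ_s/ds = -(1 - J_s)J_s, for a = 0 the integrand is minus the derivative of
J_s^{b+1}x/(b + 1), which runs from x/(b + 1) to 0. Larger a follow from (1 - J)^{a+1} = (1 - J)^a -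
(1 - J)^a J, an identity that the scalar Beta integral shares. -/
theorem IsSectorial.integral_betaOp [CompleteSpace X] (hA : IsSectorial A ω) {x : X}
    (hx : x ∈ core A) (a b : ℕ) :
    ∫ s in Ioi (0 : ℝ), (s : ℂ)⁻¹ • betaOp A a b s x =
      (∫ j in (0 : ℝ)..1, (1 - (j : ℂ)) ^ a * (j : ℂ) ^ b) • x := by
  induction a generalizing b with
  | zero =>
    have hb : ((b : ℂ) + 1) ≠ 0 := by exact_mod_cast Nat.succ_ne_zero b
    have hder : ∀ s ∈ Ioi (0 : ℝ), HasDerivAt (fun s => (unitResolvent A s ^ (b + 1)) x)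
        (-((b : ℂ) + 1) • (s : ℂ)⁻¹ • betaOp A 0 b s x) s := by
      intro s hs
      have h := ((ContinuousLinearMap.apply ℂ X x).restrictScalars ℝ).hasFDerivAt.comp_hasDerivAt
        s (hA.hasDerivAt_unitResolvent_pow hs (b + 1))
      refine HasDerivAt.congr_deriv (f := fun s => (unitResolvent A s ^ (b + 1)) x) h ?_
      simp only [betaOp, zero_add, pow_one]
      change (-(((b + 1 : ℕ) : ℂ) • (s : ℂ)⁻¹ •
        ((1 - unitResolvent A s) * unitResolvent A s ^ (b + 1)))) x = _
      rw [neg_apply, smul_apply, smul_apply, neg_smul]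
      push_cast
      rfl
    have h := integral_Ioi_zero_of_hasDerivAt_of_tendsto
      (hA.tendsto_unitResolvent_pow_zero hx (b + 1)) hder
      ((hA.integrableOn_betaOp hx 0 b).smul _) (hA.tendsto_unitResolvent_pow_atTop hx b)
    rw [integral_smul, zero_sub, neg_smul, neg_inj] at h
    have e : ∫ j in (0 : ℝ)..1, (1 - (j : ℂ)) ^ 0 * (j : ℂ) ^ b = ((b : ℂ) + 1)⁻¹ := by
      simp only [pow_zero, one_mul, ← Complex.ofReal_pow]
      rw [intervalIntegral.integral_ofReal, integral_pow]
      simp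
    rw [e, eq_inv_smul_iff₀ hb]
    exact h
  | succ a ih =>
    simp only [betaOp_succ_left, sub_apply, smul_sub]
    rw [integral_sub (hA.integrableOn_betaOp hx a b) (hA.integrableOn_betaOp hx a (b + 1)), ih,
      ih, integral_beta_succ, sub_smul]

end MultiplicativeIntegrals

/-! ### Evaluation of the resolvent integral by analytic continuation from z = -1. -/

section ResolventBeta

variable {X : Type*} [NormedAddCommGroup X] [NormedSpace ℂ X] {A : X →ₗ.[ℂ] X} {ω : ℝ}

/-- The integral `∫ (1 - J_s)^(a+1) J_s^(b+1) (z - s A)⁻¹ x ds / s`, where `J_s = (1 + s A)⁻¹`. -/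
def resolventBeta (A : X →ₗ.[ℂ] X) (a b : ℕ) (x : X) (z : ℂ) : X :=
  ∫ s in Ioi (0 : ℝ), (s : ℂ)⁻¹ • scaledResolvent A z s (betaOp A a b s x)

/-- The value of `resolventBeta` for `A = 1` and `x = 1`, written with `j = (1 + s)⁻¹`. -/
def scalarBeta (a b : ℕ) (z : ℂ) : ℂ :=
  ∫ j in (0 : ℝ)..1, (1 - (j : ℂ)) ^ a * (j : ℂ) ^ b * (j / ((z + 1) * j - 1))

theorem IsSectorial.exists_ball_bound (hA : IsSectorial A ω) {z : ℂ} (hz : ω < |z.arg|) :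
    ∃ r K : ℝ, 0 < r ∧ 0 ≤ K ∧ ∀ w ∈ Metric.ball z r, ω < |w.arg| ∧
      ∀ s : ℝ, 0 < s → ‖scaledResolvent A w s‖ ≤ K := by
  obtain ⟨ν, hν1, hν2⟩ := exists_between hz
  obtain ⟨M, hM1, hM⟩ := hA.exists_scaledResolvent_bound hν1 (hν2.trans_le (Complex.abs_arg_le_pi z))
  have hz0 : z ≠ 0 := by
    rintro rfl
    simp only [Complex.arg_zero, abs_zero] at hz
    exact absurd hz (not_lt.2 hA.nonneg)
  have hzn : 0 < ‖z‖ := norm_pos_iff.2 hz0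
  have h1 := (isOpen_lt_abs_arg (hA.nonneg.trans hν1.le)).mem_nhds (show z ∈ {z | ν < |z.arg|} from hν2)
  have h2 : ∀ᶠ w : ℂ in 𝓝 z, ‖z‖ / 2 < ‖w‖ :=
    continuous_norm.continuousAt.eventually (lt_mem_nhds (by linarith))
  obtain ⟨r, hr, hr'⟩ := Metric.eventually_nhds_iff_ball.1 (h2.and h1)
  refine ⟨r, M / (‖z‖ / 2), hr, by positivity, fun w hw => ?_⟩
  obtain ⟨h3, h4⟩ := hr' w hw
  have h4' : ν < |w.arg| := h4
  refine ⟨hν1.trans h4', fun s hs => (hM w h4'.le s hs).trans ?_⟩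
  exact div_le_div_of_nonneg_left (by linarith) (by linarith) h3.le

theorem IsSectorial.continuousOn_scaledResolvent_right (hA : IsSectorial A ω) {z : ℂ}
    (hz : ω < |z.arg|) : ContinuousOn (scaledResolvent A z) (Ioi 0) := fun _ hs =>
  (hA.hasDerivAt_scaledResolvent_right hz hs).continuousAt.continuousWithinAt

theorem IsSectorial.differentiableAt_resolventBeta [CompleteSpace X] (hA : IsSectorial A ω)
    {x : X} (hx : x ∈ core A) (a b : ℕ) {z : ℂ} (hz : ω < |z.arg|) :
    DifferentiableAt ℂ (resolventBeta A a b x) z := by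
  obtain ⟨r, K, hr, hK0, hK⟩ := hA.exists_ball_bound hz
  have hzb : z ∈ Metric.ball z r := Metric.mem_ball_self hr
  have hi : ∀ w ∈ Metric.ball z r, IntegrableOn
      (fun s : ℝ => (s : ℂ)⁻¹ • scaledResolvent A w s (betaOp A a b s x)) (Ioi 0) := fun w hw =>
    hA.integrableOn_mul_betaOp hx (hA.continuousOn_scaledResolvent_right (hK w hw).1)
      (hK w hw).2 a b
  have hsq : ∀ w ∈ Metric.ball z r, ∀ s : ℝ, 0 < s →
      ‖-(scaledResolvent A w s * scaledResolvent A w s)‖ ≤ K * K := by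
    intro w hw s hs
    rw [norm_neg]
    exact (norm_mul_le _ _).trans (mul_le_mul ((hK w hw).2 s hs) ((hK w hw).2 s hs)
      (norm_nonneg _) hK0)
  have hi' := hA.integrableOn_mul_betaOp hx (((hA.continuousOn_scaledResolvent_right hz).mul
    (hA.continuousOn_scaledResolvent_right hz)).neg) (hsq z hzb) a b
  obtain ⟨K', M, hK', hM, hb⟩ := hA.exists_betaOp_bound hx a
  refine (hasDerivAt_integral_of_dominated_loc_of_deriv_le
    (F := fun w s => (s : ℂ)⁻¹ • scaledResolvent A w s (betaOp A a b s x))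
    (F' := fun w s => (s : ℂ)⁻¹ •
      (-(scaledResolvent A w s * scaledResolvent A w s)) (betaOp A a b s x))
    (bound := fun s => K * K * (K' * M ^ b) * (s + 1) ^ (-2 : ℝ))
    (Metric.ball_mem_nhds z hr) ?_ (hi z hzb) hi'.aestronglyMeasurable ?_
    (integrableOn_add_one_rpow.const_mul _) ?_).2.differentiableAt
  · filter_upwards [Metric.ball_mem_nhds z hr] with w hw
    exact (hi w hw).aestronglyMeasurable
  · refine (ae_restrict_mem measurableSet_Ioi).mono fun s hs w hw => ?_
    have hs' : (0 : ℝ) < s := hs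
    rw [norm_smul, norm_inv, Complex.norm_real, Real.norm_of_nonneg hs'.le]
    calc _ ≤ s⁻¹ * (K * K * (K' * M ^ b * (s * (s + 1) ^ (-2 : ℝ)))) := by
          refine mul_le_mul_of_nonneg_left ?_ (by positivity)
          exact (ContinuousLinearMap.le_opNorm _ _).trans
            (mul_le_mul (hsq w hw s hs') (hb b s hs') (norm_nonneg _) (by positivity))
      _ = K * K * (K' * M ^ b) * (s + 1) ^ (-2 : ℝ) := by field_simp
  · refine (ae_restrict_mem measurableSet_Ioi).mono fun s hs w hw => ?_
    have h := hA.hasDerivAt_scaledResolvent (hK w hw).1 hs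
    exact (h.clm_apply (hasDerivAt_const w _)).const_smul ((s : ℂ)⁻¹) |>.congr_deriv (by simp)

theorem add_one_mul_sub_one_ne_zero {z : ℂ} (hz : 0 < |z.arg|) {j : ℝ} (hj : j ∈ Icc (0 : ℝ) 1) :
    (z + 1) * j - 1 ≠ 0 := by
  intro h
  rcases hj.1.eq_or_lt with rfl | hj0
  · simp at h
  have hj' : (j : ℂ) ≠ 0 := by exact_mod_cast hj0.ne'
  have e : z = (((1 - j) / j : ℝ) : ℂ) := by
    push_cast
    rw [eq_div_iff hj']
    linear_combination h
  rw [e, Complex.arg_ofReal_of_nonneg (div_nonneg (by linarith [hj.2]) hj0.le)] at hz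
  simp at hz

theorem differentiableAt_scalarBeta (a b : ℕ) {z : ℂ} (hz : 0 < |z.arg|) :
    DifferentiableAt ℂ (scalarBeta a b) z := by
  obtain ⟨r, hr, hrU⟩ := Metric.nhds_basis_closedBall.mem_iff.1
    ((isOpen_lt_abs_arg le_rfl).mem_nhds (show z ∈ {z : ℂ | 0 < |z.arg|} from hz))
  have hne : ∀ w ∈ Metric.ball z r, ∀ j ∈ Icc (0 : ℝ) 1, (w + 1) * j - 1 ≠ 0 := fun w hw j hj =>
    add_one_mul_sub_one_ne_zero (hrU (Metric.ball_subset_closedBall hw)) hj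
  have hcont : ContinuousOn (fun p : ℂ × ℝ => (1 - (p.2 : ℂ)) ^ a * (p.2 : ℂ) ^ b *
      (p.2 * -(p.2 / ((p.1 + 1) * p.2 - 1) ^ 2))) (Metric.closedBall z r ×ˢ Icc 0 1) := by
    refine ContinuousOn.mul (by fun_prop) (ContinuousOn.mul (by fun_prop) (ContinuousOn.neg
      (ContinuousOn.div (by fun_prop) (by fun_prop) fun p hp => pow_ne_zero 2 ?_)))
    exact add_one_mul_sub_one_ne_zero (hrU hp.1) hp.2
  obtain ⟨K, hK⟩ := ((isCompact_closedBall z r).prod isCompact_Icc).exists_bound_of_continuousOn hcont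
  have hFc : ∀ w ∈ Metric.ball z r, ContinuousOn (fun j : ℝ =>
      (1 - (j : ℂ)) ^ a * (j : ℂ) ^ b * (j / ((w + 1) * j - 1))) (Icc 0 1) := fun w hw =>
    ContinuousOn.mul (by fun_prop) (ContinuousOn.div (by fun_prop) (by fun_prop) (hne w hw))
  have hzb : z ∈ Metric.ball z r := Metric.mem_ball_self hr
  have hsub : uIoc (0 : ℝ) 1 ⊆ Icc 0 1 := by
    rw [uIoc_of_le zero_le_one]
    exact Ioc_subset_Icc_self
  refine (intervalIntegral.hasDerivAt_integral_of_dominated_loc_of_deriv_le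
    (F := fun w (j : ℝ) => (1 - (j : ℂ)) ^ a * (j : ℂ) ^ b * (j / ((w + 1) * j - 1)))
    (F' := fun w (j : ℝ) => (1 - (j : ℂ)) ^ a * (j : ℂ) ^ b * (j * -(j / ((w + 1) * j - 1) ^ 2)))
    (bound := fun _ => K) (Metric.ball_mem_nhds z hr) ?_ ?_ ?_ ?_ ?_ ?_).2.differentiableAt
  · filter_upwards [Metric.ball_mem_nhds z hr] with w hw
    exact ((hFc w hw).mono hsub).aestronglyMeasurable measurableSet_uIoc
  · exact (hFc z hzb).intervalIntegrable_of_Icc zero_le_one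
  · refine ContinuousOn.aestronglyMeasurable ?_ measurableSet_uIoc
    exact hcont.comp (f := fun j : ℝ => (z, j)) (by fun_prop) fun j hj =>
      ⟨Metric.mem_closedBall_self hr.le, hsub hj⟩
  · refine Eventually.of_forall fun j hj w hw => hK (w, j) ⟨Metric.ball_subset_closedBall hw, hsub hj⟩
  · exact intervalIntegrable_const
  · refine Eventually.of_forall fun j hj w hw => ?_
    have h1 : HasDerivAt (fun w : ℂ => (w + 1) * j - 1) (j : ℂ) w := by
      simpa using (((hasDerivAt_id w).add_const 1).mul_const (j : ℂ)).sub_const 1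
    have h2 := (((h1.inv (hne w hw j (hsub hj))).const_mul (j : ℂ)).const_mul
      ((1 - (j : ℂ)) ^ a * (j : ℂ) ^ b))
    simp only [div_eq_mul_inv] at h2 ⊢
    refine h2.congr_deriv ?_
    ring

/-- Substituting (z - sA)⁻¹ = -J_s + (z + 1)(z - sA)⁻¹J_s raises b by one. The scalar integral obeys
the same recursion, and the inhomogeneous terms cancel by `IsSectorial.integral_betaOp`. -/
theorem IsSectorial.resolventBeta_expand [CompleteSpace X] (hA : IsSectorial A ω) {x : X}
    (hx : x ∈ core A) (a b : ℕ) {z : ℂ} (hz : ω < |z.arg|) :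
    resolventBeta A a b x z - scalarBeta a b z • x =
      (z + 1) • (resolventBeta A a (b + 1) x z - scalarBeta a (b + 1) z • x) := by
  obtain ⟨r, K, hr, hK0, hK⟩ := hA.exists_ball_bound hz
  have hzb : z ∈ Metric.ball z r := Metric.mem_ball_self hr
  have h1 : resolventBeta A a b x z =
      -((∫ j in (0 : ℝ)..1, (1 - (j : ℂ)) ^ a * (j : ℂ) ^ (b + 1)) • x) +
        (z + 1) • resolventBeta A a (b + 1) x z := by
    have i1 : IntegrableOn (fun s : ℝ => -((s : ℂ)⁻¹ • betaOp A a (b + 1) s x)) (Ioi 0) :=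
      (hA.integrableOn_betaOp hx a (b + 1)).neg
    have i2 : IntegrableOn (fun s : ℝ => (z + 1) • (s : ℂ)⁻¹ •
        scaledResolvent A z s (betaOp A a (b + 1) s x)) (Ioi 0) :=
      (hA.integrableOn_mul_betaOp hx (hA.continuousOn_scaledResolvent_right hz)
          (hK z hzb).2 a (b + 1)).smul (z + 1)
    rw [← hA.integral_betaOp hx, resolventBeta, resolventBeta, ← integral_neg, ← integral_smul,
      ← integral_add i1 i2]
    refine setIntegral_congr_fun measurableSet_Ioi fun s hs => ?_
    have hs' : (0 : ℝ) < s := hs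
    have e : unitResolvent A s * betaOp A a b s = betaOp A a (b + 1) s := by
      have h := ((commute_one_sub_self (unitResolvent A s)).pow_left (a + 1)).eq
      rw [betaOp, betaOp, ← mul_assoc, ← h, mul_assoc, ← pow_succ']
    have e2 := DFunLike.congr_fun (hA.scaledResolvent_eq hz hs') (betaOp A a b s x)
    rw [add_apply, smul_apply, neg_apply, mul_apply_eq_comp,
      ← mul_apply_eq_comp (unitResolvent A s) (betaOp A a b s), e] at e2
    simp only [e2]
    module
  have h2 : scalarBeta a b z = -(∫ j in (0 : ℝ)..1, (1 - (j : ℂ)) ^ a * (j : ℂ) ^ (b + 1)) +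
      (z + 1) * scalarBeta a (b + 1) z := by
    have hz0 : 0 < |z.arg| := hA.nonneg.trans_lt hz
    have hFc : ContinuousOn (fun j : ℝ =>
        (1 - (j : ℂ)) ^ a * (j : ℂ) ^ (b + 1) * (j / ((z + 1) * j - 1))) (Icc 0 1) :=
      ContinuousOn.mul (by fun_prop) (ContinuousOn.div (by fun_prop) (by fun_prop) fun j hj =>
        add_one_mul_sub_one_ne_zero hz0 hj)
    rw [scalarBeta, scalarBeta, ← intervalIntegral.integral_neg,
      ← intervalIntegral.integral_const_mul,
      ← intervalIntegral.integral_add (Continuous.intervalIntegrable (by fun_prop) _ _)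
        ((hFc.intervalIntegrable_of_Icc zero_le_one).const_mul _)]
    refine intervalIntegral.integral_congr fun j hj => ?_
    rw [uIcc_of_le zero_le_one] at hj
    have hne := add_one_mul_sub_one_ne_zero hz0 hj
    have e : (j : ℂ) / ((z + 1) * j - 1) = -j + (z + 1) * (j * (j / ((z + 1) * j - 1))) := by
      rw [div_eq_iff hne]
      have := div_mul_cancel₀ (j : ℂ) hne
      linear_combination (-(z + 1) * j) * this
    linear_combination ((1 - (j : ℂ)) ^ a * (j : ℂ) ^ b) * e
  rw [h1, h2]
  module

/-- After n expansions the discrepancy is (z + 1)^n times a quantity growing at most like M^n, so it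
vanishes once |z + 1| M < 1/2. -/
theorem IsSectorial.eventually_resolventBeta_eq [CompleteSpace X] (hA : IsSectorial A ω) {x : X}
    (hx : x ∈ core A) (a b : ℕ) :
    ∀ᶠ z in 𝓝 (-1 : ℂ), resolventBeta A a b x z = scalarBeta a b z • x := by
  obtain ⟨r, K, hr, hK0, hK⟩ := hA.exists_ball_bound hA.lt_abs_arg_neg_one
  obtain ⟨K', M, hK', hM, hb⟩ := hA.exists_betaOp_bound hx a
  have hsmall : ∀ᶠ z in 𝓝 (-1 : ℂ), ‖z + 1‖ * M < 1 / 2 := by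
    have : Tendsto (fun z : ℂ => ‖z + 1‖ * M) (𝓝 (-1)) (𝓝 0) :=
      Continuous.tendsto' (by fun_prop) _ _ (by simp)
    exact this.eventually (gt_mem_nhds (by norm_num))
  filter_upwards [hsmall, Metric.ball_mem_nhds (-1 : ℂ) hr] with z hz1 hzb
  have hz := (hK z hzb).1
  set I := ∫ s in Ioi (0 : ℝ), (s + 1) ^ (-2 : ℝ) with hI
  have hR : ∀ n : ℕ, ‖resolventBeta A a (b + n) x z‖ ≤ K * (K' * M ^ (b + n)) * I := by
    intro n
    rw [resolventBeta, hI, ← integral_const_mul]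
    refine norm_integral_le_of_norm_le (integrableOn_add_one_rpow.const_mul _) ?_
    refine (ae_restrict_mem measurableSet_Ioi).mono fun s hs => ?_
    have hs' : (0 : ℝ) < s := hs
    rw [norm_smul, norm_inv, Complex.norm_real, Real.norm_of_nonneg hs'.le]
    calc _ ≤ s⁻¹ * (K * (K' * M ^ (b + n) * (s * (s + 1) ^ (-2 : ℝ)))) := by
          refine mul_le_mul_of_nonneg_left ?_ (by positivity)
          exact (ContinuousLinearMap.le_opNorm _ _).trans
            (mul_le_mul ((hK z hzb).2 s hs') (hb (b + n) s hs') (norm_nonneg _) hK0)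
      _ = K * (K' * M ^ (b + n)) * (s + 1) ^ (-2 : ℝ) := by field_simp
  have hS : ∀ n : ℕ, ‖scalarBeta a (b + n) z‖ ≤ 2 := by
    intro n
    have h := intervalIntegral.norm_integral_le_of_norm_le_const (a := (0 : ℝ)) (b := 1) (C := 2)
      (f := fun j : ℝ => (1 - (j : ℂ)) ^ a * (j : ℂ) ^ (b + n) * (j / ((z + 1) * j - 1))) ?_
    · rw [scalarBeta]
      simpa using h
    · intro j hj
      rw [uIoc_of_le zero_le_one] at hj
      have h1 : ‖(1 - (j : ℂ)) ^ a‖ ≤ 1 := by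
        rw [norm_pow, ← Complex.ofReal_one, ← Complex.ofReal_sub, Complex.norm_real,
          Real.norm_of_nonneg (by linarith [hj.2])]
        exact pow_le_one₀ (by linarith [hj.2]) (by linarith [hj.1])
      have hjn : ‖(j : ℂ)‖ = j := by rw [Complex.norm_real, Real.norm_of_nonneg hj.1.le]
      have h2 : ‖(j : ℂ) ^ (b + n)‖ ≤ 1 := by
        rw [norm_pow, hjn]
        exact pow_le_one₀ hj.1.le hj.2
      have h3 : 1 / 2 ≤ ‖(z + 1) * j - 1‖ := by
        have h4 := norm_sub_norm_le 1 ((z + 1) * j)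
        rw [norm_one, norm_mul, hjn, norm_sub_rev] at h4
        have h5 : ‖z + 1‖ * j ≤ ‖z + 1‖ * M :=
          mul_le_mul_of_nonneg_left (hj.2.trans hM) (norm_nonneg _)
        linarith
      rw [norm_mul, norm_mul, norm_div, hjn]
      have h6 : j / ‖(z + 1) * j - 1‖ ≤ 2 := by
        rw [div_le_iff₀ (by linarith)]
        linarith [hj.2]
      have h7 : ‖(1 - (j : ℂ)) ^ a‖ * ‖(j : ℂ) ^ (b + n)‖ ≤ 1 := mul_le_one₀ h1 (norm_nonneg _) h2
      have h8 : 0 ≤ j / ‖(z + 1) * j - 1‖ := div_nonneg hj.1.le (norm_nonneg _)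
      calc _ ≤ 1 * (j / ‖(z + 1) * j - 1‖) := mul_le_mul_of_nonneg_right h7 h8
        _ ≤ 2 := by rw [one_mul]; exact h6
  have hexp : ∀ n : ℕ, resolventBeta A a b x z - scalarBeta a b z • x =
      (z + 1) ^ n • (resolventBeta A a (b + n) x z - scalarBeta a (b + n) z • x) := by
    intro n
    induction n with
    | zero => simp
    | succ n ih =>
      rw [ih, hA.resolventBeta_expand hx a (b + n) hz, smul_smul, ← pow_succ]
      rfl
  rw [← sub_eq_zero, ← norm_le_zero_iff]
  have hlim : Tendsto (fun n : ℕ => (1 / 2 : ℝ) ^ n * (K * (K' * M ^ b) * I + 2 * ‖x‖)) atTop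
      (𝓝 0) := by
    have := (tendsto_pow_atTop_nhds_zero_of_lt_one (r := (1 / 2 : ℝ)) (by norm_num)
      (by norm_num)).mul_const (K * (K' * M ^ b) * I + 2 * ‖x‖)
    rwa [zero_mul] at this
  refine ge_of_tendsto hlim (Eventually.of_forall fun n => ?_)
  have hM0 : 0 < M := by linarith
  have hI0 : 0 ≤ I := setIntegral_nonneg measurableSet_Ioi fun s hs => by
    have hs' : (0 : ℝ) < s := hs
    positivity
  rw [hexp n, norm_smul, norm_pow]
  have h1 : ‖resolventBeta A a (b + n) x z - scalarBeta a (b + n) z • x‖ ≤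
      M ^ n * (K * (K' * M ^ b) * I + 2 * ‖x‖) := by
    refine (norm_sub_le _ _).trans ?_
    rw [norm_smul, mul_add]
    refine add_le_add ((hR n).trans_eq (by rw [pow_add]; ring)) ?_
    calc ‖scalarBeta a (b + n) z‖ * ‖x‖ ≤ 2 * ‖x‖ :=
          mul_le_mul_of_nonneg_right (hS n) (norm_nonneg _)
      _ ≤ M ^ n * (2 * ‖x‖) := le_mul_of_one_le_left (by positivity) (one_le_pow₀ hM)
  calc _ ≤ ‖z + 1‖ ^ n * (M ^ n * (K * (K' * M ^ b) * I + 2 * ‖x‖)) :=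
        mul_le_mul_of_nonneg_left h1 (by positivity)
    _ = (‖z + 1‖ * M) ^ n * (K * (K' * M ^ b) * I + 2 * ‖x‖) := by rw [mul_pow]; ring
    _ ≤ _ := by
      refine mul_le_mul_of_nonneg_right ?_ (by positivity)
      exact pow_le_pow_left₀ (by positivity) hz1.le n

/-- The strip |Im w| < π - ω parametrises the directions where resolvents exist, with w = 0 sent to
-1. Adding or subtracting πi, according to the sign of Im w, returns to the principal branch. -/
theorem lt_abs_arg_neg_exp {w : ℂ} (hw : |w.im| < Real.pi - ω) :
    ω < |(-Complex.exp w).arg| := by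
  have key : ∀ v : ℂ, -Real.pi < v.im → v.im ≤ Real.pi → (Complex.exp v).arg = v.im := by
    intro v h1 h2
    rw [← Complex.log_im, Complex.log_exp h1 h2]
  rw [abs_lt] at hw
  rcases le_or_gt w.im 0 with h | h
  · by_cases hpi : -Real.pi < w.im
    · have e : -Complex.exp w = Complex.exp (w + Real.pi * Complex.I) := by
        rw [Complex.exp_add, Complex.exp_pi_mul_I, mul_neg_one]
      rw [e, key _ (by simp; linarith) (by simp; linarith)]
      refine lt_abs.2 (Or.inl ?_)
      simp
      linarith
    · have : ω < 0 := by linarith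
      exact this.trans_le (abs_nonneg _)
  · by_cases hpi : w.im ≤ 2 * Real.pi
    · have e : -Complex.exp w = Complex.exp (w - Real.pi * Complex.I) := by
        rw [Complex.exp_sub, Complex.exp_pi_mul_I, div_neg, div_one]
      rw [e, key _ (by simp; linarith) (by simp; linarith)]
      refine lt_abs.2 (Or.inr ?_)
      simp
      linarith
    · have : ω < 0 := by linarith
      exact this.trans_le (abs_nonneg _)

/-- Identity theorem in the coordinate w: the strip is convex, hence connected, and equality is
known near w = 0. -/
theorem IsSectorial.resolventBeta_neg_exp [CompleteSpace X] (hA : IsSectorial A ω) {x : X}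
    (hx : x ∈ core A) (a b : ℕ) {w : ℂ} (hw : |w.im| < Real.pi - ω) :
    resolventBeta A a b x (-Complex.exp w) = scalarBeta a b (-Complex.exp w) • x := by
  set U : Set ℂ := {w | |w.im| < Real.pi - ω} with hU
  have hUo : IsOpen U := isOpen_lt (by fun_prop) continuous_const
  have hUc : IsPreconnected U := by
    have : U = Complex.imCLM ⁻¹' Ioo (-(Real.pi - ω)) (Real.pi - ω) := by
      ext w
      simp [hU, abs_lt]
    rw [this]
    exact ((convex_Ioo _ _).linear_preimage Complex.imCLM.toLinearMap).isPreconnected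
  set f : ℂ → X := fun w => resolventBeta A a b x (-Complex.exp w) -
    scalarBeta a b (-Complex.exp w) • x with hf
  have hfd : DifferentiableOn ℂ f U := by
    intro w hw
    have h1 := lt_abs_arg_neg_exp hw
    have hexp : DifferentiableAt ℂ (fun w => -Complex.exp w) w := by fun_prop
    refine DifferentiableAt.differentiableWithinAt (DifferentiableAt.sub ?_ ?_)
    · exact DifferentiableAt.comp (g := resolventBeta A a b x) w
        (hA.differentiableAt_resolventBeta hx a b h1) hexp
    · exact (DifferentiableAt.comp (g := scalarBeta a b) w (differentiableAt_scalarBeta a b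
        (hA.nonneg.trans_lt h1)) hexp).smul_const x
  have h0 : (0 : ℂ) ∈ U := by simp [hU, hA.lt_pi]
  have hev : f =ᶠ[𝓝 0] 0 := by
    have hc : Tendsto (fun w : ℂ => -Complex.exp w) (𝓝 0) (𝓝 (-1)) :=
      Continuous.tendsto' (by fun_prop) _ _ (by simp)
    filter_upwards [hc.eventually (hA.eventually_resolventBeta_eq hx a b)] with w hw
    simp only [hf, hw, sub_self, Pi.zero_apply]
  have := (hfd.analyticOnNhd hUo).eqOn_zero_of_preconnected_of_eventuallyEq_zero hUc h0 hev hw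
  exact sub_eq_zero.1 this

theorem IsSectorial.resolventBeta_ray [CompleteSpace X] (hA : IsSectorial A ω) {x : X}
    (hx : x ∈ core A) (a b : ℕ) {r : ℝ} (hr : 0 < r) {φ : ℝ} (h1 : ω < |φ|)
    (h2 : |φ| < Real.pi) :
    resolventBeta A a b x (r * ray φ) = scalarBeta a b (r * ray φ) • x := by
  rw [abs_lt] at h2
  have hpi := Real.pi_pos
  rcases le_or_gt 0 φ with h | h
  · rw [abs_of_nonneg h] at h1
    have e : (r : ℂ) * ray φ = -Complex.exp (Real.log r + ((φ - Real.pi : ℝ) : ℂ) * Complex.I) := by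
      rw [← ofReal_exp_mul_ray, Real.exp_log hr, ray, ray, Complex.ofReal_sub, sub_mul,
        Complex.exp_sub, Complex.exp_pi_mul_I, div_neg, div_one, mul_neg, neg_neg]
    rw [e]
    refine hA.resolventBeta_neg_exp hx a b ?_
    have : ((Real.log r : ℂ) + ((φ - Real.pi : ℝ) : ℂ) * Complex.I).im = φ - Real.pi := by simp
    rw [this, abs_lt]
    constructor <;> linarith
  · rw [abs_of_neg h] at h1
    have e : (r : ℂ) * ray φ = -Complex.exp (Real.log r + ((φ + Real.pi : ℝ) : ℂ) * Complex.I) := by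
      rw [← ofReal_exp_mul_ray, Real.exp_log hr, ray, ray, Complex.ofReal_add, add_mul,
        Complex.exp_add, Complex.exp_pi_mul_I, mul_neg_one, mul_neg, neg_neg]
    rw [e]
    refine hA.resolventBeta_neg_exp hx a b ?_
    have : ((Real.log r : ℂ) + ((φ + Real.pi : ℝ) : ℂ) * Complex.I).im = φ + Real.pi := by simp
    rw [this, abs_lt]
    constructor <;> linarith

end ResolventBeta

/-! ### Dunford integrals paired with (1 - J_s)^{a+1} J_s^{b+1}. -/

section Reproducing

theorem rpow_div_one_add_rpow_le_left {s r : ℝ} (hr : 0 < r) :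
    r ^ s / (1 + r ^ (2 * s)) ≤ r ^ s :=
  div_le_self (by positivity) (by linarith [Real.rpow_pos_of_pos hr (2 * s)])

theorem rpow_div_one_add_rpow_le_right {s r : ℝ} (hr : 0 < r) :
    r ^ s / (1 + r ^ (2 * s)) ≤ r ^ (-s) := by
  have h := Real.rpow_pos_of_pos hr s
  have e : r ^ (2 * s) = r ^ s * r ^ s := by rw [← Real.rpow_add hr]; ring_nf
  rw [div_le_iff₀ (by positivity), Real.rpow_neg hr.le, e]
  field_simp
  linarith

theorem integrableOn_rpow_div_one_add_rpow {s : ℝ} (hs : 0 < s) :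
    IntegrableOn (fun r : ℝ => r ^ s / (1 + r ^ (2 * s)) / r) (Ioi 0) := by
  have hc : ContinuousOn (fun r : ℝ => r ^ s / (1 + r ^ (2 * s)) / r) (Ioi 0) := by
    intro r hr
    have hr' : (0 : ℝ) < r := hr
    have h2 := Real.rpow_pos_of_pos hr' (2 * s)
    refine ContinuousAt.continuousWithinAt (((Real.continuousAt_rpow_const _ _ (Or.inl hr'.ne')).div
      (continuousAt_const.add (Real.continuousAt_rpow_const _ _ (Or.inl hr'.ne'))) ?_).div
      continuousAt_id hr'.ne')
    exact (by positivity : (0 : ℝ) < 1 + r ^ (2 * s)).ne'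
  rw [← Ioc_union_Ioi_eq_Ioi zero_le_one]
  refine IntegrableOn.union ?_ ?_
  · have h : IntegrableOn (fun r : ℝ => r ^ (s - 1)) (Ioc 0 1) :=
      (intervalIntegrable_iff_integrableOn_Ioc_of_le zero_le_one).1
        (intervalIntegral.intervalIntegrable_rpow' (by linarith))
    refine h.mono' ((hc.mono Ioc_subset_Ioi_self).aestronglyMeasurable measurableSet_Ioc) ?_
    refine (ae_restrict_mem measurableSet_Ioc).mono fun r hr => ?_
    have hr' : (0 : ℝ) < r := hr.1
    rw [Real.norm_of_nonneg (by positivity), Real.rpow_sub_one hr'.ne']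
    exact div_le_div_of_nonneg_right (rpow_div_one_add_rpow_le_left hr') hr'.le
  · have h : IntegrableOn (fun r : ℝ => r ^ (-s - 1)) (Ioi 1) :=
      integrableOn_Ioi_rpow_of_lt (by linarith) one_pos
    refine h.mono' ((hc.mono (Ioi_subset_Ioi zero_le_one)).aestronglyMeasurable
      measurableSet_Ioi) ?_
    refine (ae_restrict_mem measurableSet_Ioi).mono fun r hr => ?_
    have hr' : (0 : ℝ) < r := one_pos.trans hr
    rw [Real.norm_of_nonneg (by positivity), Real.rpow_sub_one hr'.ne']
    exact div_le_div_of_nonneg_right (rpow_div_one_add_rpow_le_right hr') hr'.le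

variable {ν : ℝ} {ψ : ℂ → ℂ}

/-- The form of decay used in Cauchy's formula, where only infinity matters: min(r^s, r^{-s}) ≤
(2/(1 + r))^s. -/
theorem MemH0.exists_bound_rpow (h : MemH0 ν ψ) :
    ∃ K ε : ℝ, 0 < ε ∧ ∀ z ∈ sector ν, ‖ψ z‖ ≤ K * (1 + ‖z‖) ^ (-ε) := by
  obtain ⟨-, -, c, s, hc, hs, hb⟩ := h
  refine ⟨c * 2 ^ s, s, hs, fun z hz => (hb z hz).trans ?_⟩
  rw [mul_assoc]
  refine mul_le_mul_of_nonneg_left ?_ hc.le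
  set r := ‖z‖ with hr
  have hr0 : 0 ≤ r := norm_nonneg z
  rw [Real.rpow_neg (by positivity), ← div_eq_mul_inv, ← Real.div_rpow zero_le_two (by positivity)]
  rcases hr0.eq_or_lt with h0 | h0
  · rw [← h0, Real.zero_rpow hs.ne', zero_div]
    positivity
  rcases le_total r 1 with h1 | h1
  · refine (rpow_div_one_add_rpow_le_left h0).trans ((Real.rpow_le_one h0.le h1 hs.le).trans ?_)
    refine Real.one_le_rpow ?_ hs.le
    rw [le_div_iff₀ (by positivity)]
    linarith
  · refine (rpow_div_one_add_rpow_le_right h0).trans ?_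
    rw [Real.rpow_neg h0.le, ← Real.inv_rpow h0.le]
    refine Real.rpow_le_rpow (by positivity) ?_ hs.le
    rw [inv_eq_one_div, div_le_div_iff₀ h0 (by positivity)]
    linarith

theorem MemH0.continuousOn_ray (h : MemH0 ν ψ) (hν : ν ≤ Real.pi) {φ : ℝ} (hφ : |φ| < ν) :
    ContinuousOn (fun r : ℝ => ψ (r * ray φ)) (Ioi 0) :=
  continuousOn_of_mapsTo_ray hφ hν h.1.continuousOn

theorem MemH0.integrableOn_ray (h : MemH0 ν ψ) (hν : ν ≤ Real.pi) {φ : ℝ} (hφ : |φ| < ν) :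
    IntegrableOn (fun r : ℝ => ‖ψ (r * ray φ)‖ / r) (Ioi 0) := by
  have hcont := h.continuousOn_ray hν hφ
  obtain ⟨-, -, c, s, hc, hs, hb⟩ := h
  refine ((integrableOn_rpow_div_one_add_rpow hs).const_mul c).mono' ?_ ?_
  · exact (hcont.norm.div continuousOn_id fun r hr => (ne_of_gt hr)).aestronglyMeasurable
      measurableSet_Ioi
  · refine (ae_restrict_mem measurableSet_Ioi).mono fun r hr => ?_
    have hr' : (0 : ℝ) < r := hr
    have := hb _ (ofReal_mul_ray_mem_sector hφ hν hr')
    rw [norm_ofReal_mul_ray hr'.le] at this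
    rw [Real.norm_of_nonneg (by positivity), ← mul_div_assoc]
    exact div_le_div_of_nonneg_right this hr'.le

variable {X : Type*} [NormedAddCommGroup X] [NormedSpace ℂ X] {A : X →ₗ.[ℂ] X} {ω : ℝ}

/-- The contribution `∫ ψ(z) (z - s A)⁻¹ dz` of the ray of argument `φ` to `ψ(s A)`. -/
def rayIntegral (ψ : ℂ → ℂ) (A : X →ₗ.[ℂ] X) (φ s : ℝ) : X →L[ℂ] X :=
  ∫ r in Ioi (0 : ℝ), (ψ (r * ray φ) * ray φ) • scaledResolvent A (r * ray φ) s

/-- Rays are invariant under dilation, so the parameter s moves from ψ to the resolvent, leaving ψ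
independent of s for Fubini. -/
theorem integral_ray_resolvent_eq (ψ : ℂ → ℂ) (A : X →ₗ.[ℂ] X) (φ : ℝ) {s : ℝ} (hs : 0 < s) :
    ∫ r in Ioi (0 : ℝ), (ψ (s * (r * ray φ)) * ray φ) • resolvent A (r * ray φ) =
      rayIntegral ψ A φ s := by
  have hs' : (s : ℂ) ≠ 0 := by exact_mod_cast hs.ne'
  have h := integral_comp_mul_left_Ioi
    (fun u : ℝ => (ψ (u * ray φ) * ray φ) • resolvent A (u * ray φ / s)) 0 hs
  rw [mul_zero] at h
  have e : ∀ r : ℝ, ((s * r : ℝ) : ℂ) * ray φ = s * (r * ray φ) := fun r => by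
    push_cast; ring
  have e2 : ∀ r : ℝ, (s : ℂ) * (r * ray φ) / s = r * ray φ := fun r =>
    mul_div_cancel_left₀ _ hs'
  simp only [e, e2] at h
  rw [h, rayIntegral, ← integral_smul]
  congr 1
  ext1 r
  rw [scaledResolvent, smul_comm (s⁻¹), ← Complex.ofReal_inv, Complex.coe_smul]

theorem dunford_eq_rayIntegral (ψ : ℂ → ℂ) (A : X →ₗ.[ℂ] X) (θ : ℝ) {s : ℝ} (hs : 0 < s) :
    dunford θ (fun z => ψ (s * z)) A = (2 * Real.pi * Complex.I : ℂ)⁻¹ •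
      (rayIntegral ψ A (-θ) s - rayIntegral ψ A θ s) := by
  rw [← integral_ray_resolvent_eq ψ A (-θ) hs, ← integral_ray_resolvent_eq ψ A θ hs, ray_neg]
  rfl

theorem abs_arg_ofReal_mul_ray {r : ℝ} (hr : 0 < r) {φ : ℝ} (hφ : |φ| < Real.pi) :
    |((r : ℂ) * ray φ).arg| = |φ| := by
  rw [arg_ofReal_mul_ray hr (abs_lt.1 hφ).1 (abs_lt.1 hφ).2.le]

theorem IsSectorial.continuousOn_scaledResolvent_prod (hA : IsSectorial A ω) {φ : ℝ} (h1 : ω < |φ|)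
    (h2 : |φ| < Real.pi) : ContinuousOn (fun p : ℝ × ℝ => scaledResolvent A (p.2 * ray φ) p.1)
      (Ioi 0 ×ˢ Ioi 0) := by
  refine hA.continuousOn_scaledResolvent.comp
    (f := fun p : ℝ × ℝ => ((p.2 : ℂ) * ray φ, p.1)) (by fun_prop) ?_
  rintro ⟨s, r⟩ ⟨hs, hr⟩
  refine ⟨?_, hs⟩
  simp only [mem_ofPred_eq]
  rwa [abs_arg_ofReal_mul_ray hr h2]

theorem IsSectorial.exists_scaledResolvent_ray_bound (hA : IsSectorial A ω) {φ : ℝ} (h1 : ω < |φ|)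
    (h2 : |φ| < Real.pi) : ∃ M : ℝ, 0 ≤ M ∧ ∀ r : ℝ, 0 < r → ∀ s : ℝ, 0 < s →
      ‖scaledResolvent A (r * ray φ) s‖ ≤ M / r := by
  obtain ⟨M, hM1, hM⟩ := hA.exists_scaledResolvent_bound h1 h2
  refine ⟨M, zero_le_one.trans hM1, fun r hr s hs => ?_⟩
  have := hM (r * ray φ) (abs_arg_ofReal_mul_ray hr h2).ge s hs
  rwa [norm_ofReal_mul_ray hr.le] at this

theorem IsSectorial.integrableOn_rayIntegral (hA : IsSectorial A ω) (hψ : MemH0 ν ψ)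
    (hν : ν ≤ Real.pi) {φ : ℝ} (h1 : ω < |φ|) (h2 : |φ| < ν) {s : ℝ} (hs : 0 < s) :
    IntegrableOn (fun r : ℝ => (ψ (r * ray φ) * ray φ) • scaledResolvent A (r * ray φ) s)
      (Ioi 0) := by
  have h2' := h2.trans_le hν
  obtain ⟨M, hM0, hM⟩ := hA.exists_scaledResolvent_ray_bound h1 h2'
  refine ((hψ.integrableOn_ray hν h2).mul_const M).mono' ?_ ?_
  · refine ContinuousOn.aestronglyMeasurable (ContinuousOn.smul
      ((hψ.continuousOn_ray hν h2).mul continuousOn_const) ?_) measurableSet_Ioi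
    exact (hA.continuousOn_scaledResolvent_prod h1 h2').comp (f := fun r : ℝ => (s, r))
      (by fun_prop) fun r hr => ⟨hs, hr⟩
  · refine (ae_restrict_mem measurableSet_Ioi).mono fun r hr => ?_
    rw [norm_smul, norm_mul, norm_ray, mul_one, div_mul_eq_mul_div, mul_div_assoc]
    exact mul_le_mul_of_nonneg_left (hM r hr s hs) (norm_nonneg _)

theorem IsSectorial.commute_scaledResolvent_betaOp (hA : IsSectorial A ω) {z : ℂ}
    (hz : ω < |z.arg|) {s : ℝ} (hs : 0 < s) (a b : ℕ) :
    Commute (scaledResolvent A z s) (betaOp A a b s) := by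
  have h := hA.commute_scaledResolvent_unitResolvent hz hs hs
  exact (((Commute.one_right _).sub_right h).pow_right _).mul_right (h.pow_right _)

theorem IsSectorial.betaOp_rayIntegral [CompleteSpace X] (hA : IsSectorial A ω) (hψ : MemH0 ν ψ)
    (hν : ν ≤ Real.pi) {φ : ℝ} (h1 : ω < |φ|) (h2 : |φ| < ν) {s : ℝ} (hs : 0 < s) (a b : ℕ)
    (x : X) : betaOp A a b s (rayIntegral ψ A φ s x) =
      ∫ r in Ioi (0 : ℝ), (ψ (r * ray φ) * ray φ) •
        scaledResolvent A (r * ray φ) s (betaOp A a b s x) := by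
  have hi := hA.integrableOn_rayIntegral hψ hν h1 h2 hs
  have hi' : IntegrableOn (fun r : ℝ =>
      ((ψ (r * ray φ) * ray φ) • scaledResolvent A (r * ray φ) s) x) (Ioi 0) :=
    ContinuousLinearMap.integrable_comp (ContinuousLinearMap.apply ℂ X x) hi
  rw [rayIntegral, ContinuousLinearMap.integral_apply hi,
    ← ContinuousLinearMap.integral_comp_comm (betaOp A a b s) hi']
  refine setIntegral_congr_fun measurableSet_Ioi fun r hr => ?_
  have hc := hA.commute_scaledResolvent_betaOp (z := r * ray φ)
    (by rwa [abs_arg_ofReal_mul_ray hr (h2.trans_le hν)]) hs a b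
  simp only [smul_apply, map_smul]
  rw [← mul_apply_eq_comp, ← hc.eq, mul_apply_eq_comp]

/-- The integrand is dominated by a product: on `core A` the betaOp factor absorbs 1/s and leaves (s
+ 1)^{-2}, and sectoriality leaves |ψ|/r along the ray. -/
theorem IsSectorial.integrable_prod_betaOp (hA : IsSectorial A ω) (hψ : MemH0 ν ψ)
    (hν : ν ≤ Real.pi) {φ : ℝ} (h1 : ω < |φ|) (h2 : |φ| < ν) (a b : ℕ) {x : X} (hx : x ∈ core A) :
    Integrable (fun p : ℝ × ℝ => (p.1 : ℂ)⁻¹ • (ψ (p.2 * ray φ) * ray φ) •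
        scaledResolvent A (p.2 * ray φ) p.1 (betaOp A a b p.1 x))
      ((volume.restrict (Ioi 0)).prod (volume.restrict (Ioi 0))) := by
  have h2' := h2.trans_le hν
  obtain ⟨M, hM0, hM⟩ := hA.exists_scaledResolvent_ray_bound h1 h2'
  obtain ⟨K', N, hK', hN, hb⟩ := hA.exists_betaOp_bound hx a
  refine (Integrable.mul_prod (integrableOn_add_one_rpow.const_mul (M * (K' * N ^ b)))
    (hψ.integrableOn_ray hν h2)).mono' ?_ ?_
  · rw [Measure.prod_restrict]
    refine ContinuousOn.aestronglyMeasurable ?_ (measurableSet_Ioi.prod measurableSet_Ioi)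
    refine ContinuousOn.smul (ContinuousOn.inv₀ (by fun_prop) ?_) (ContinuousOn.smul
      (ContinuousOn.mul ?_ continuousOn_const) (ContinuousOn.clm_apply
        (hA.continuousOn_scaledResolvent_prod h1 h2') (ContinuousOn.clm_apply ?_ continuousOn_const)))
    · rintro p ⟨hp, -⟩
      exact_mod_cast (ne_of_gt hp : p.1 ≠ 0)
    · exact (hψ.continuousOn_ray hν h2).comp (f := fun p : ℝ × ℝ => p.2) (by fun_prop)
        fun p hp => hp.2
    · exact (continuousOn_betaOp hA a b).comp (f := fun p : ℝ × ℝ => p.1) (by fun_prop)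
        fun p hp => hp.1
  · rw [Measure.prod_restrict]
    refine (ae_restrict_mem (measurableSet_Ioi.prod measurableSet_Ioi)).mono ?_
    rintro ⟨s, r⟩ ⟨hs, hr⟩
    have hs' : (0 : ℝ) < s := hs
    have hr' : (0 : ℝ) < r := hr
    simp only
    rw [norm_smul, norm_inv, Complex.norm_real, Real.norm_of_nonneg hs'.le, norm_smul, norm_mul,
      norm_ray, mul_one]
    calc _ ≤ s⁻¹ * (‖ψ (r * ray φ)‖ * (M / r * (K' * N ^ b * (s * (s + 1) ^ (-2 : ℝ))))) := by
          refine mul_le_mul_of_nonneg_left (mul_le_mul_of_nonneg_left ?_ (norm_nonneg _))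
            (by positivity)
          exact (ContinuousLinearMap.le_opNorm _ _).trans
            (mul_le_mul (hM r hr s hs) (hb b s hs) (norm_nonneg _) (by positivity))
      _ = _ := by field_simp

/-- Fubini: the inner integral over s is `resolventBeta`, already known to be scalar on the ray. -/
theorem IsSectorial.integral_betaOp_rayIntegral [CompleteSpace X] (hA : IsSectorial A ω)
    (hψ : MemH0 ν ψ) (hν : ν ≤ Real.pi) {φ : ℝ} (h1 : ω < |φ|) (h2 : |φ| < ν) (a b : ℕ) {x : X}
    (hx : x ∈ core A) :
    IntegrableOn (fun s : ℝ => (s : ℂ)⁻¹ • betaOp A a b s (rayIntegral ψ A φ s x)) (Ioi 0) ∧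
    ∫ s in Ioi (0 : ℝ), (s : ℂ)⁻¹ • betaOp A a b s (rayIntegral ψ A φ s x) =
      (∫ r in Ioi (0 : ℝ), ψ (r * ray φ) * ray φ * scalarBeta a b (r * ray φ)) • x := by
  have hI := hA.integrable_prod_betaOp hψ hν h1 h2 a b hx
  have e : ∀ s ∈ Ioi (0 : ℝ), (s : ℂ)⁻¹ • betaOp A a b s (rayIntegral ψ A φ s x) =
      ∫ r in Ioi (0 : ℝ), (s : ℂ)⁻¹ • (ψ (r * ray φ) * ray φ) •
        scaledResolvent A (r * ray φ) s (betaOp A a b s x) := fun s hs => by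
    rw [hA.betaOp_rayIntegral hψ hν h1 h2 hs, integral_smul]
  refine ⟨(integrableOn_congr_fun e measurableSet_Ioi).2 hI.integral_prod_left, ?_⟩
  rw [setIntegral_congr_fun measurableSet_Ioi e, integral_integral_swap hI, ← integral_smul_const]
  refine setIntegral_congr_fun measurableSet_Ioi fun r hr => ?_
  have h := hA.resolventBeta_ray hx a b hr h1 (h2.trans_le hν)
  rw [← smul_smul, ← h, resolventBeta, ← integral_smul]
  congr 1
  ext1 s
  rw [smul_comm]

end Reproducing

/-! ### The reproducing formula and its constant. -/

section ReproducingFormula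

variable {ν : ℝ} {ψ : ℂ → ℂ}

theorem div_add_one_mul_sub_one {j : ℝ} (hj : j ≠ 0) (z : ℂ) :
    (j : ℂ) / ((z + 1) * j - 1) = (z - ((1 / j - 1 : ℝ) : ℂ))⁻¹ := by
  have hj' : (j : ℂ) ≠ 0 := by exact_mod_cast hj
  have e : (z + 1) * j - 1 = j * (z - ((1 / j - 1 : ℝ) : ℂ)) := by
    push_cast
    field_simp
    ring
  rw [e, ← div_div, div_self hj', one_div]

theorem MemH0.integrable_prod_scalarBeta (hψ : MemH0 ν ψ) (hν : ν ≤ Real.pi) {φ : ℝ}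
    (hφ : Real.sin φ ≠ 0) (h2 : |φ| < ν) (a b : ℕ) :
    Integrable (fun p : ℝ × ℝ => ψ (p.1 * ray φ) * ray φ *
        ((1 - (p.2 : ℂ)) ^ a * (p.2 : ℂ) ^ b * (p.2 / ((p.1 * ray φ + 1) * p.2 - 1))))
      ((volume.restrict (Ioi 0)).prod (volume.restrict (Ioo 0 1))) := by
  obtain ⟨c, hc, hcb⟩ := exists_ofReal_mul_ray_sub_ge hφ
  have hz0 : ∀ r : ℝ, 0 < r → 0 < |((r : ℂ) * ray φ).arg| := fun r hr => by
    rw [abs_arg_ofReal_mul_ray hr (h2.trans_le hν), abs_pos]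
    rintro rfl
    simp at hφ
  have hconst : Integrable (fun _ : ℝ => c⁻¹) (volume.restrict (Ioo (0 : ℝ) 1)) :=
    integrable_const _
  refine ((hψ.integrableOn_ray hν h2).mul_prod hconst).mono' ?_ ?_
  · rw [Measure.prod_restrict]
    refine ContinuousOn.aestronglyMeasurable ?_ (measurableSet_Ioi.prod measurableSet_Ioo)
    refine ContinuousOn.mul (ContinuousOn.mul ?_ continuousOn_const)
      (ContinuousOn.mul (by fun_prop) (ContinuousOn.div (by fun_prop) (by fun_prop) ?_))
    · exact (hψ.continuousOn_ray hν h2).comp (f := fun p : ℝ × ℝ => p.1) (by fun_prop)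
        fun p hp => hp.1
    · rintro p ⟨hp, hj⟩
      exact add_one_mul_sub_one_ne_zero (hz0 _ hp) (Ioo_subset_Icc_self hj)
  · rw [Measure.prod_restrict]
    refine (ae_restrict_mem (measurableSet_Ioi.prod measurableSet_Ioo)).mono ?_
    rintro ⟨r, j⟩ ⟨hr, hj⟩
    have hr' : (0 : ℝ) < r := hr
    have hj0 : (0 : ℝ) < j := hj.1
    have hj1 : j < 1 := hj.2
    simp only
    rw [norm_mul, norm_mul, norm_ray, mul_one, norm_mul, norm_mul, norm_pow, norm_pow,
      ← Complex.ofReal_one, ← Complex.ofReal_sub, Complex.norm_real, Complex.norm_real,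
      Real.norm_of_nonneg hj0.le, Real.norm_of_nonneg (by linarith), Complex.ofReal_one,
      div_add_one_mul_sub_one hj0.ne', norm_inv, div_mul_eq_mul_div, mul_div_assoc]
    refine mul_le_mul_of_nonneg_left ?_ (norm_nonneg _)
    have h3 := hcb r hr'.le (1 / j - 1)
    have h4 : c * r ≤ ‖(r : ℂ) * ray φ - ((1 / j - 1 : ℝ) : ℂ)‖ :=
      (mul_le_mul_of_nonneg_left (by linarith [abs_nonneg (1 / j - 1)]) hc.le).trans h3
    have h5 : (1 - j) ^ a * j ^ b ≤ 1 :=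
      mul_le_one₀ (pow_le_one₀ (by linarith) (by linarith)) (by positivity)
        (pow_le_one₀ hj0.le hj1.le)
    calc _ ≤ 1 * (c * r)⁻¹ := mul_le_mul h5 (inv_anti₀ (by positivity) h4)
          (inv_nonneg.2 (norm_nonneg _)) zero_le_one
      _ = c⁻¹ / r := by rw [one_mul, mul_inv, div_eq_mul_inv]

/-- The constant `∫ (1 - j)^a j^b ψ(1 / j - 1) dj` of the reproducing formula. -/
def moment (ψ : ℂ → ℂ) (a b : ℕ) : ℂ :=
  ∫ j in Ioo (0 : ℝ) 1, (1 - (j : ℂ)) ^ a * (j : ℂ) ^ b * ψ ((1 / j - 1 : ℝ) : ℂ)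

/-- A second use of Fubini: with s = 1/j - 1 the factor j/((z + 1)j - 1) is the Cauchy kernel 1/(z -
s). -/
theorem MemH0.integral_scalarBeta (hψ : MemH0 ν ψ) (hν : ν ≤ Real.pi) {φ : ℝ}
    (hφ : Real.sin φ ≠ 0) (h2 : |φ| < ν) (a b : ℕ) :
    IntegrableOn (fun j : ℝ => (1 - (j : ℂ)) ^ a * (j : ℂ) ^ b * ∫ r in Ioi (0 : ℝ),
        ψ (r * ray φ) / (r * ray φ - ((1 / j - 1 : ℝ) : ℂ)) * ray φ) (Ioo 0 1) ∧
    ∫ r in Ioi (0 : ℝ), ψ (r * ray φ) * ray φ * scalarBeta a b (r * ray φ) =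
      ∫ j in Ioo (0 : ℝ) 1, (1 - (j : ℂ)) ^ a * (j : ℂ) ^ b * ∫ r in Ioi (0 : ℝ),
        ψ (r * ray φ) / (r * ray φ - ((1 / j - 1 : ℝ) : ℂ)) * ray φ := by
  have hI := hψ.integrable_prod_scalarBeta hν hφ h2 a b
  have e : ∀ j ∈ Ioo (0 : ℝ) 1, (1 - (j : ℂ)) ^ a * (j : ℂ) ^ b * (∫ r in Ioi (0 : ℝ),
        ψ (r * ray φ) / (r * ray φ - ((1 / j - 1 : ℝ) : ℂ)) * ray φ) =
      ∫ r in Ioi (0 : ℝ), ψ (r * ray φ) * ray φ *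
        ((1 - (j : ℂ)) ^ a * (j : ℂ) ^ b * (j / ((r * ray φ + 1) * j - 1))) := fun j hj => by
    rw [← integral_const_mul]
    congr 1
    ext1 r
    rw [div_add_one_mul_sub_one hj.1.ne']
    ring
  refine ⟨(integrableOn_congr_fun e measurableSet_Ioo).2 hI.integral_prod_right, ?_⟩
  rw [setIntegral_congr_fun measurableSet_Ioo e, ← integral_integral_swap hI]
  refine setIntegral_congr_fun measurableSet_Ioi fun r hr => ?_
  rw [integral_const_mul, scalarBeta, intervalIntegral.integral_of_le zero_le_one,
    integral_Ioc_eq_integral_Ioo]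

/-- For each j in (0, 1) the two rays together form the Cauchy integral of ψ at 1/j - 1 > 0. -/
theorem MemH0.integral_scalarBeta_sub (hψ : MemH0 ν ψ) (hν : ν < Real.pi) {θ : ℝ} (hθ : 0 < θ)
    (hθν : θ < ν) (a b : ℕ) :
    (∫ r in Ioi (0 : ℝ), ψ (r * ray (-θ)) * ray (-θ) * scalarBeta a b (r * ray (-θ))) -
      ∫ r in Ioi (0 : ℝ), ψ (r * ray θ) * ray θ * scalarBeta a b (r * ray θ) =
      2 * Real.pi * Complex.I * moment ψ a b := by
  obtain ⟨K, ε, hε, hb⟩ := hψ.exists_bound_rpow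
  have hsin : Real.sin θ ≠ 0 := (Real.sin_pos_of_pos_of_lt_pi hθ (hθν.trans hν)).ne'
  have hsin' : Real.sin (-θ) ≠ 0 := by rwa [Real.sin_neg, neg_ne_zero]
  have h1 := hψ.integral_scalarBeta hν.le hsin' (by rwa [abs_neg, abs_of_pos hθ]) a b
  have h2 := hψ.integral_scalarBeta hν.le hsin (by rwa [abs_of_pos hθ]) a b
  rw [h1.2, h2.2, ← integral_sub h1.1 h2.1, moment, ← integral_const_mul]
  refine setIntegral_congr_fun measurableSet_Ioo fun j hj => ?_
  have hj' : 0 < 1 / j - 1 := by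
    have := one_lt_one_div hj.1 hj.2
    linarith
  have h := cauchy_formula_sector hθ hθν hν.le hψ.1 hε hb hj'
  rw [← mul_sub, h]
  ring

variable {X : Type*} [NormedAddCommGroup X] [NormedSpace ℂ X] {A : X →ₗ.[ℂ] X} {ω : ℝ}

/-- The reproducing formula: the contributions of the two rays are both multiples of x, and their
difference is 2πi times the moment, cancelling the Dunford normalisation. -/
theorem IsSectorial.integral_betaOp_dunford [CompleteSpace X] (hA : IsSectorial A ω)
    (hψ : MemH0 ν ψ) (hν : ν < Real.pi) {θ : ℝ} (hθ : ω < θ) (hθν : θ < ν) (a b : ℕ) {x : X}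
    (hx : x ∈ core A) :
    IntegrableOn (fun s : ℝ => (s : ℂ)⁻¹ •
      betaOp A a b s (dunford θ (fun z => ψ (s * z)) A x)) (Ioi 0) ∧
    ∫ s in Ioi (0 : ℝ), (s : ℂ)⁻¹ • betaOp A a b s (dunford θ (fun z => ψ (s * z)) A x) =
      moment ψ a b • x := by
  have hθ0 : 0 < θ := hA.nonneg.trans_lt hθ
  have h1 := hA.integral_betaOp_rayIntegral hψ hν.le (φ := -θ) (by rwa [abs_neg, abs_of_pos hθ0])
    (by rwa [abs_neg, abs_of_pos hθ0]) a b hx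
  have h2 := hA.integral_betaOp_rayIntegral hψ hν.le (φ := θ) (by rwa [abs_of_pos hθ0])
    (by rwa [abs_of_pos hθ0]) a b hx
  have e : ∀ s ∈ Ioi (0 : ℝ), (s : ℂ)⁻¹ • betaOp A a b s (dunford θ (fun z => ψ (s * z)) A x) =
      (2 * Real.pi * Complex.I : ℂ)⁻¹ • ((s : ℂ)⁻¹ • betaOp A a b s (rayIntegral ψ A (-θ) s x) -
        (s : ℂ)⁻¹ • betaOp A a b s (rayIntegral ψ A θ s x)) := fun s hs => by
    rw [dunford_eq_rayIntegral ψ A θ hs, smul_apply, sub_apply, map_smul, map_sub, smul_comm,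
      smul_sub]
  refine ⟨(integrableOn_congr_fun e measurableSet_Ioi).2 ((h1.1.sub h2.1).smul _), ?_⟩
  rw [setIntegral_congr_fun measurableSet_Ioi e, integral_smul, integral_sub h1.1 h2.1, h1.2, h2.2,
    ← sub_smul, hψ.integral_scalarBeta_sub hν hθ0 hθν, smul_smul, inv_mul_cancel_left₀]
  simp [Real.pi_ne_zero]

end ReproducingFormula

/-! ### Nonvanishing of the reproducing constant. -/

section Moments

theorem setIntegral_polynomial_mul_eq_zero {f : ℝ → ℂ} {s : Set ℝ} (hf : IntegrableOn f s)
    (hs : s ⊆ Icc 0 1) (hsm : MeasurableSet s) (h : ∀ n : ℕ, ∫ j in s, (j : ℂ) ^ n * f j = 0)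
    (P : Polynomial ℝ) : ∫ j in s, (P.eval j) • f j = 0 := by
  have hi : ∀ n : ℕ, IntegrableOn (fun j : ℝ => (j : ℂ) ^ n * f j) s := fun n => by
    refine hf.norm.mono' ((Continuous.aestronglyMeasurable (by fun_prop)).mul
      hf.aestronglyMeasurable) ((ae_restrict_mem hsm).mono fun j hj => ?_)
    rw [norm_mul, norm_pow, Complex.norm_real, Real.norm_of_nonneg (hs hj).1]
    exact mul_le_of_le_one_left (norm_nonneg _) (pow_le_one₀ (hs hj).1 (hs hj).2)
  have e : ∀ j : ℝ, (P.eval j) • f j =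
      ∑ i ∈ Finset.range (P.natDegree + 1), (P.coeff i : ℂ) * ((j : ℂ) ^ i * f j) := fun j => by
    rw [Polynomial.eval_eq_sum_range, Complex.real_smul, Complex.ofReal_sum, Finset.sum_mul]
    refine Finset.sum_congr rfl fun i _ => ?_
    push_cast
    ring
  simp only [e]
  rw [integral_finsetSum _ fun i _ => (hi i).const_mul _]
  simp [integral_const_mul, h]

/-- By Weierstrass approximation f is orthogonal to every test function, so f = 0 almost everywhere,
and continuity removes the exceptional set. -/
theorem eqOn_zero_of_moments_eq_zero {f : ℝ → ℂ} (hc : ContinuousOn f (Ioo 0 1))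
    (hf : IntegrableOn f (Ioo 0 1)) (h : ∀ n : ℕ, ∫ j in Ioo (0 : ℝ) 1, (j : ℂ) ^ n * f j = 0) :
    EqOn f 0 (Ioo 0 1) := by
  have hae : ∀ᵐ j : ℝ, j ∈ Ioo (0 : ℝ) 1 → f j = 0 := by
    refine isOpen_Ioo.ae_eq_zero_of_integral_contDiff_smul_eq_zero hf.locallyIntegrableOn
      fun g hg _ hgs => ?_
    rw [← setIntegral_eq_integral_of_forall_compl_eq_zero (s := Ioo (0 : ℝ) 1) fun j hj => by
      rw [image_eq_zero_of_notMem_tsupport fun hj' => hj (hgs hj'), zero_smul]]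
    rw [← norm_le_zero_iff]
    refine le_of_forall_pos_le_add fun ε hε => ?_
    set B := ∫ j in Ioo (0 : ℝ) 1, ‖f j‖ with hB
    have hB0 : 0 ≤ B := integral_nonneg fun _ => norm_nonneg _
    -- B + 1 instead of B keeps the tolerance meaningful when f has zero L¹ norm.
    obtain ⟨P, hP⟩ := exists_polynomial_near_of_continuousOn 0 1 g hg.continuous.continuousOn
      (ε / (B + 1)) (by positivity)
    have hi : ∀ u : ℝ → ℝ, Continuous u → IntegrableOn (fun j => u j • f j) (Ioo 0 1) := by
      intro u hu
      obtain ⟨K, hK⟩ := isCompact_Icc.exists_bound_of_continuousOn (s := Icc (0 : ℝ) 1)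
        hu.continuousOn
      refine (hf.norm.const_mul K).mono' (hu.aestronglyMeasurable.smul hf.aestronglyMeasurable)
        ((ae_restrict_mem measurableSet_Ioo).mono fun j hj => ?_)
      rw [norm_smul]
      exact mul_le_mul_of_nonneg_right (hK j (Ioo_subset_Icc_self hj)) (norm_nonneg _)
    have h0 := setIntegral_polynomial_mul_eq_zero hf Ioo_subset_Icc_self measurableSet_Ioo h P
    rw [zero_add, ← sub_zero (∫ j in Ioo (0 : ℝ) 1, g j • f j), ← h0,
      ← integral_sub (hi g hg.continuous) (hi (fun j => P.eval j) P.continuous)]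
    have hle : ‖∫ j in Ioo (0 : ℝ) 1, (g j • f j - P.eval j • f j)‖ ≤
        ∫ j in Ioo (0 : ℝ) 1, ε / (B + 1) * ‖f j‖ := by
      refine norm_integral_le_of_norm_le (hf.norm.const_mul _)
        ((ae_restrict_mem measurableSet_Ioo).mono fun j hj => ?_)
      rw [← sub_smul, norm_smul, Real.norm_eq_abs, abs_sub_comm]
      exact mul_le_mul_of_nonneg_right (hP j (Ioo_subset_Icc_self hj)).le (norm_nonneg _)
    refine hle.trans ?_
    rw [integral_const_mul, ← hB, div_mul_eq_mul_div, div_le_iff₀ (by positivity)]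
    nlinarith
  have hae' : f =ᵐ[volume.restrict (Ioo 0 1)] 0 := (ae_restrict_iff' measurableSet_Ioo).2 hae
  exact Measure.eqOn_open_of_ae_eq hae' isOpen_Ioo hc continuousOn_const

/-- The positive axis corresponds to the real line of the strip w = log z, and the zeros w = 1/(n +
1) accumulate at 0. -/
theorem eqOn_zero_sector {ν : ℝ} (hν0 : 0 < ν) (hν : ν ≤ Real.pi) {ψ : ℂ → ℂ}
    (hd : DifferentiableOn ℂ ψ (sector ν)) (h : ∀ s : ℝ, 0 < s → ψ s = 0) :
    EqOn ψ 0 (sector ν) := by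
  set U : Set ℂ := {w | |w.im| < ν} with hU
  have hUo : IsOpen U := isOpen_lt (by fun_prop) continuous_const
  have hUc : IsPreconnected U := by
    have : U = Complex.imCLM ⁻¹' Ioo (-ν) ν := by
      ext w
      simp [hU, abs_lt]
    rw [this]
    exact ((convex_Ioo _ _).linear_preimage Complex.imCLM.toLinearMap).isPreconnected
  have hfd : DifferentiableOn ℂ (fun w => ψ (Complex.exp w)) U :=
    hd.comp (f := Complex.exp) (by fun_prop) fun w hw => exp_mem_sector hν hw
  have h0 : (0 : ℂ) ∈ U := by simpa [hU] using hν0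
  have hlim : Tendsto (fun n : ℕ => ((1 / ((n : ℝ) + 1) : ℝ) : ℂ)) atTop (𝓝[≠] 0) := by
    refine tendsto_nhdsWithin_iff.2 ⟨?_, Eventually.of_forall fun n => ?_⟩
    · rw [← Complex.ofReal_zero]
      exact (Complex.continuous_ofReal.tendsto 0).comp tendsto_one_div_add_atTop_nhds_zero_nat
    · have : (1 / ((n : ℝ) + 1) : ℝ) ≠ 0 := by positivity
      exact Complex.ofReal_ne_zero.2 this
  have hfr : ∃ᶠ w in 𝓝[≠] (0 : ℂ), ψ (Complex.exp w) = 0 := by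
    refine hlim.frequently (Eventually.frequently (Eventually.of_forall fun n => ?_))
    rw [← Complex.ofReal_exp]
    exact h _ (Real.exp_pos _)
  have hz := (hfd.analyticOnNhd hUo).eqOn_zero_of_preconnected_of_frequently_eq_zero hUc h0 hfr
  intro z hzs
  rw [sector_eq hν0] at hzs
  have := hz (show Complex.log z ∈ U by rw [hU, mem_ofPred_eq, Complex.log_im]; exact hzs.2)
  simp only [Complex.exp_log hzs.1, Pi.zero_apply] at this
  rw [this, Pi.zero_apply]

/-- If all these moments vanished, (1 - j)^a j^b ψ(1/j - 1) would be zero on (0, 1). As 1/j - 1 runs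
through (0, ∞), ψ would vanish on the positive axis and hence on the sector. -/
theorem MemH0.exists_moment_ne_zero {ν : ℝ} {ψ : ℂ → ℂ} (hψ : MemH0 ν ψ) (hν0 : 0 < ν)
    (hν : ν ≤ Real.pi) (hne : ∃ z ∈ sector ν, ψ z ≠ 0) (a b : ℕ) :
    ∃ n : ℕ, moment ψ a (b + n) ≠ 0 := by
  by_contra! hall
  have hpos : ∀ j ∈ Ioo (0 : ℝ) 1, 0 < 1 / j - 1 := fun j hj => by
    have := one_lt_one_div hj.1 hj.2
    linarith
  have hmem : ∀ j ∈ Ioo (0 : ℝ) 1, ((1 / j - 1 : ℝ) : ℂ) ∈ sector ν := fun j hj =>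
    ofReal_mem_sector hν0 (hpos j hj)
  have hc : ContinuousOn (fun j : ℝ => (1 - (j : ℂ)) ^ a * (j : ℂ) ^ b *
      ψ ((1 / j - 1 : ℝ) : ℂ)) (Ioo 0 1) := by
    refine ContinuousOn.mul (by fun_prop) (hψ.1.continuousOn.comp
      (f := fun j : ℝ => ((1 / j - 1 : ℝ) : ℂ)) ?_ hmem)
    refine Complex.continuous_ofReal.comp_continuousOn ((continuousOn_const.div continuousOn_id
      fun j hj => hj.1.ne').sub continuousOn_const)
  obtain ⟨M, hM⟩ := hψ.2.1
  have hf : IntegrableOn (fun j : ℝ => (1 - (j : ℂ)) ^ a * (j : ℂ) ^ b *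
      ψ ((1 / j - 1 : ℝ) : ℂ)) (Ioo 0 1) := by
    refine (integrable_const M).mono' (hc.aestronglyMeasurable measurableSet_Ioo)
      ((ae_restrict_mem measurableSet_Ioo).mono fun j hj => ?_)
    have hj0 := hj.1
    have hj1 := hj.2
    rw [norm_mul, norm_mul, norm_pow, norm_pow, ← Complex.ofReal_one, ← Complex.ofReal_sub,
      Complex.norm_real, Complex.norm_real, Real.norm_of_nonneg hj0.le,
      Real.norm_of_nonneg (by linarith)]
    have h5 : (1 - j) ^ a * j ^ b ≤ 1 :=
      mul_le_one₀ (pow_le_one₀ (by linarith) (by linarith)) (by positivity)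
        (pow_le_one₀ hj0.le hj1.le)
    exact (mul_le_of_le_one_left (norm_nonneg _) h5).trans (hM _ (hmem j hj))
  have hz := eqOn_zero_of_moments_eq_zero hc hf fun n => by
    rw [← hall n, moment]
    congr 1
    ext1 j
    ring
  obtain ⟨z, hz1, hz2⟩ := hne
  refine hz2 (eqOn_zero_sector hν0 hν hψ.1 (fun s hs => ?_) hz1)
  have hj : (1 + s)⁻¹ ∈ Ioo (0 : ℝ) 1 := ⟨by positivity, inv_lt_one_of_one_lt₀ (by linarith)⟩
  have h := hz hj
  have hne1 : (((1 + s)⁻¹ : ℝ) : ℂ) ≠ 0 := by exact_mod_cast hj.1.ne'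
  have hne2 : 1 - (((1 + s)⁻¹ : ℝ) : ℂ) ≠ 0 := by
    have : (1 : ℝ) - (1 + s)⁻¹ ≠ 0 := by linarith [hj.2]
    exact_mod_cast this
  have e : 1 / (1 + s)⁻¹ - 1 = s := by rw [one_div, inv_inv]; ring
  simp only [e, Pi.zero_apply] at h
  exact (mul_eq_zero.1 h).resolve_left (mul_ne_zero (pow_ne_zero _ hne2) (pow_ne_zero _ hne1))

end Moments

/-! ### Schur test and the measure dt/t. -/

section SchurTest

/-- The Schur test on `L^p`. -/
theorem eLpNorm_le_of_kernel {α E F : Type*} [MeasurableSpace α] {μ : Measure α} [SFinite μ]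
    [NormedAddCommGroup E] [NormedAddCommGroup F] {κ : α → α → ℝ≥0∞}
    (hκ : Measurable (Function.uncurry κ)) {W : ℝ≥0∞} (h1 : ∀ᵐ t ∂μ, ∫⁻ s, κ t s ∂μ ≤ W)
    (h2 : ∀ᵐ s ∂μ, ∫⁻ t, κ t s ∂μ ≤ W) {p : ℝ≥0∞} (hp : 1 ≤ p) {f : α → E}
    (hf : AEStronglyMeasurable f μ) {g : α → F}
    (hg : ∀ᵐ t ∂μ, ‖g t‖ₑ ≤ ∫⁻ s, κ t s * ‖f s‖ₑ ∂μ) :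
    eLpNorm g p μ ≤ W * eLpNorm f p μ := by
  have hκt : ∀ t, Measurable (κ t) := fun t => hκ.comp measurable_prodMk_left
  have hfe : AEMeasurable (fun s => ‖f s‖ₑ) μ := hf.enorm
  have hexp : 0 ≤ 1 - 1 / p.toReal := by
    by_cases hpt : p = ∞
    · simp [hpt]
    have : 1 ≤ p.toReal := by
      rw [← ENNReal.toReal_one]
      exact ENNReal.toReal_mono hpt hp
    rw [sub_nonneg, div_le_one (by linarith)]
    exact this
  -- Hölder with respect to the measure κ(t, ·)μ, whose total mass is at most W.
  have hbd : ∀ᵐ t ∂μ, ‖g t‖ₑ ≤ eLpNorm f p (μ.withDensity (κ t)) * W ^ (1 - 1 / p.toReal) := by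
    filter_upwards [hg, h1] with t ht h1t
    refine ht.trans ?_
    have e : ∫⁻ s, κ t s * ‖f s‖ₑ ∂μ = eLpNorm f 1 (μ.withDensity (κ t)) := by
      rw [eLpNorm_one_eq_lintegral_enorm,
        lintegral_withDensity_eq_lintegral_mul₀ (hκt t).aemeasurable hfe]
      rfl
    rw [e]
    refine (eLpNorm_le_eLpNorm_mul_rpow_measure_univ hp
      (hf.mono_ac (withDensity_absolutelyContinuous μ _))).trans (mul_le_mul' le_rfl ?_)
    rw [ENNReal.toReal_one, div_one, withDensity_apply _ MeasurableSet.univ, Measure.restrict_univ]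
    exact ENNReal.rpow_le_rpow h1t hexp
  by_cases hpt : p = ∞
  · subst hpt
    simp only [ENNReal.toReal_top, div_zero, sub_zero, ENNReal.rpow_one, eLpNorm_exponent_top]
      at hbd ⊢
    refine essSup_le_of_ae_le _ (hbd.mono fun t ht => ht.trans ?_)
    rw [mul_comm]
    exact mul_le_mul' le_rfl (eLpNormEssSup_mono_measure f (withDensity_absolutelyContinuous μ _))
  have hp0 : p ≠ 0 := (one_pos.trans_le hp).ne'
  set q := p.toReal with hq
  have hq0 : 0 < q := ENNReal.toReal_pos hp0 hpt
  -- Raising to the power q costs W^{q-1}; Tonelli then exposes the other marginal of the kernel,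
  -- which supplies the last factor W.
  have hint : ∫⁻ t, ‖g t‖ₑ ^ q ∂μ ≤ W ^ q * ∫⁻ s, ‖f s‖ₑ ^ q ∂μ := by
    calc ∫⁻ t, ‖g t‖ₑ ^ q ∂μ
        ≤ ∫⁻ t, W ^ (q - 1) * ∫⁻ s, κ t s * ‖f s‖ₑ ^ q ∂μ ∂μ := by
          refine lintegral_mono_ae (hbd.mono fun t ht => ?_)
          refine (ENNReal.rpow_le_rpow ht hq0.le).trans_eq ?_
          rw [ENNReal.mul_rpow_of_nonneg _ _ hq0.le, ← ENNReal.rpow_mul, mul_comm,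
            eLpNorm_eq_lintegral_rpow_enorm_toReal hp0 hpt, ← hq, ← ENNReal.rpow_mul,
            one_div_mul_cancel hq0.ne', ENNReal.rpow_one,
            lintegral_withDensity_eq_lintegral_mul₀ (hκt t).aemeasurable (hfe.pow_const q)]
          congr 2
          field_simp
      _ = W ^ (q - 1) * ∫⁻ t, ∫⁻ s, κ t s * ‖f s‖ₑ ^ q ∂μ ∂μ := by
          refine lintegral_const_mul'' _ (AEMeasurable.lintegral_prod_right' (f := fun z : α × α =>
            κ z.1 z.2 * ‖f z.2‖ₑ ^ q) ?_)
          exact hκ.aemeasurable.mul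
            ((hfe.pow_const q).comp_quasiMeasurePreserving Measure.quasiMeasurePreserving_snd)
      _ = W ^ (q - 1) * ∫⁻ s, ∫⁻ t, κ t s * ‖f s‖ₑ ^ q ∂μ ∂μ := by
          rw [lintegral_lintegral_swap]
          exact hκ.aemeasurable.mul
            ((hfe.pow_const q).comp_quasiMeasurePreserving Measure.quasiMeasurePreserving_snd)
      _ ≤ W ^ (q - 1) * ∫⁻ s, W * ‖f s‖ₑ ^ q ∂μ := by
          refine mul_le_mul' le_rfl (lintegral_mono_ae (h2.mono fun s hs => ?_))
          have hκs : Measurable fun t => κ t s := hκ.comp measurable_prodMk_right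
          rw [lintegral_mul_const _ hκs]
          exact mul_le_mul' hs le_rfl
      _ = W ^ q * ∫⁻ s, ‖f s‖ₑ ^ q ∂μ := by
          rw [lintegral_const_mul'' _ (hfe.pow_const q), ← mul_assoc]
          congr 1
          nth_rewrite 2 [← ENNReal.rpow_one W]
          have hq1 : 0 ≤ q - 1 := by
            rw [sub_nonneg, div_le_one hq0] at hexp
            exact sub_nonneg.2 hexp
          rw [← ENNReal.rpow_add_of_nonneg _ _ hq1 zero_le_one, sub_add_cancel]
  rw [eLpNorm_eq_lintegral_rpow_enorm_toReal hp0 hpt, eLpNorm_eq_lintegral_rpow_enorm_toReal hp0 hpt,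
    ← hq]
  refine (ENNReal.rpow_le_rpow hint (by positivity)).trans_eq ?_
  rw [ENNReal.mul_rpow_of_nonneg _ _ (by positivity), ← ENNReal.rpow_mul,
    mul_one_div_cancel hq0.ne', ENNReal.rpow_one]

theorem lintegral_haarMul (g : ℝ → ℝ≥0∞) :
    ∫⁻ t, g t ∂haarMul = ∫⁻ t in Ioi (0 : ℝ), ENNReal.ofReal t⁻¹ * g t :=
  lintegral_withDensity_eq_lintegral_mul_non_measurable _
    (measurable_inv.ennreal_ofReal) (Eventually.of_forall fun _ => ENNReal.ofReal_lt_top) g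

instance : SFinite haarMul := by
  unfold haarMul
  infer_instance

theorem ae_haarMul_of_forall_pos {P : ℝ → Prop} (h : ∀ t : ℝ, 0 < t → P t) :
    ∀ᵐ t ∂haarMul, P t :=
  (withDensity_absolutelyContinuous _ _).ae_le
    ((ae_restrict_mem measurableSet_Ioi).mono fun t ht => h t ht)

theorem restrict_Icc_absolutelyContinuous_haarMul (τ : ℝ) :
    volume.restrict (Icc 0 τ) ≪ haarMul := by
  have h1 : volume.restrict (Icc 0 τ) ≤ volume.restrict (Ioi (0 : ℝ)) := by
    rw [← Measure.restrict_congr_set Ioc_ae_eq_Icc]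
    exact Measure.restrict_mono Ioc_subset_Ioi_self le_rfl
  refine h1.absolutelyContinuous.trans (withDensity_absolutelyContinuous'
    (measurable_inv.ennreal_ofReal.aemeasurable)
    ((ae_restrict_mem measurableSet_Ioi).mono fun t ht => ?_))
  have ht' : (0 : ℝ) < t := ht
  simpa using ht'

/-- Replacing dt by dt/t costs the weight t^{1/p}; for p = ∞ only absolute continuity is needed. -/
theorem eLpNorm_rpow_smul_le_haarMul {E : Type*} [NormedAddCommGroup E] [NormedSpace ℝ E]
    {p : ℝ≥0∞} (hp : 1 ≤ p) (α τ : ℝ) (g : ℝ → E) :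
    eLpNorm (fun t : ℝ => t ^ α • g t) p (volume.restrict (Icc 0 τ)) ≤
      eLpNorm (fun t : ℝ => t ^ (α + (1 / p).toReal) • g t) p haarMul := by
  by_cases hpt : p = ∞
  · subst hpt
    simp only [ENNReal.div_top, ENNReal.toReal_zero, add_zero, eLpNorm_exponent_top]
    exact eLpNormEssSup_mono_measure _ (restrict_Icc_absolutelyContinuous_haarMul τ)
  have hp0 : p ≠ 0 := (one_pos.trans_le hp).ne'
  rw [eLpNorm_eq_lintegral_rpow_enorm_toReal hp0 hpt, eLpNorm_eq_lintegral_rpow_enorm_toReal hp0 hpt,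
    lintegral_haarMul, one_div p, ENNReal.toReal_inv]
  set q := p.toReal with hq
  have hq0 : 0 < q := ENNReal.toReal_pos hp0 hpt
  refine ENNReal.rpow_le_rpow ?_ (by positivity)
  rw [← Measure.restrict_congr_set Ioc_ae_eq_Icc]
  refine (lintegral_mono_set Ioc_subset_Ioi_self).trans (setLIntegral_mono' measurableSet_Ioi
    fun t ht => le_of_eq ?_)
  have ht' : (0 : ℝ) < t := ht
  rw [enorm_smul, enorm_smul, ENNReal.mul_rpow_of_nonneg _ _ hq0.le,
    ENNReal.mul_rpow_of_nonneg _ _ hq0.le, ← mul_assoc]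
  congr 1
  rw [Real.enorm_of_nonneg (by positivity), Real.enorm_of_nonneg (by positivity),
    ENNReal.ofReal_rpow_of_pos (by positivity), ENNReal.ofReal_rpow_of_pos (by positivity),
    ← ENNReal.ofReal_mul (by positivity), ← Real.rpow_mul ht'.le, ← Real.rpow_mul ht'.le,
    ← Real.rpow_neg_one, ← Real.rpow_add ht', add_mul, inv_mul_cancel₀ hq0.ne']
  congr 2
  ring

/-- The kernel `min((s/t)^a, (t/s)^b)` is integrable with respect to `ds / s`, uniformly in `t`. -/
theorem lintegral_min_rpow_le {a b : ℝ} (ha : 0 < a) (hb : 0 < b) {t : ℝ} (ht : 0 < t) :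
    ∫⁻ s, ENNReal.ofReal (min ((s / t) ^ a) ((s / t) ^ (-b))) ∂haarMul ≤
      ENNReal.ofReal (a⁻¹ + b⁻¹) := by
  rw [lintegral_haarMul, ← Ioc_union_Ioi_eq_Ioi ht.le]
  refine (lintegral_union_le _ _ _).trans ?_
  rw [ENNReal.ofReal_add (by positivity) (by positivity)]
  refine add_le_add ?_ ?_
  · have hi : IntegrableOn (fun s : ℝ => t ^ (-a) * s ^ (a - 1)) (Ioc 0 t) :=
      ((intervalIntegrable_iff_integrableOn_Ioc_of_le ht.le).1
        (intervalIntegral.intervalIntegrable_rpow' (by linarith))).const_mul _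
    have hv : ∫ s in Ioc 0 t, t ^ (-a) * s ^ (a - 1) = a⁻¹ := by
      rw [integral_const_mul, ← intervalIntegral.integral_of_le ht.le,
        integral_rpow (Or.inl (by linarith)), sub_add_cancel, Real.zero_rpow ha.ne', sub_zero,
        ← mul_div_assoc, ← Real.rpow_add ht, neg_add_cancel, Real.rpow_zero, one_div]
    rw [← hv, ofReal_integral_eq_lintegral_ofReal hi
      ((ae_restrict_mem measurableSet_Ioc).mono fun s hs => by
        have := hs.1
        simp only [Pi.zero_apply]
        positivity)]
    refine setLIntegral_mono' measurableSet_Ioc fun s hs => ?_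
    have hs' := hs.1
    rw [← ENNReal.ofReal_mul (by positivity)]
    refine ENNReal.ofReal_le_ofReal ?_
    calc s⁻¹ * min ((s / t) ^ a) ((s / t) ^ (-b)) ≤ s⁻¹ * (s / t) ^ a :=
          mul_le_mul_of_nonneg_left (min_le_left _ _) (by positivity)
      _ = _ := by
          rw [Real.div_rpow hs'.le ht.le, Real.rpow_sub_one hs'.ne', Real.rpow_neg ht.le]
          ring
  · have hi : IntegrableOn (fun s : ℝ => t ^ b * s ^ (-b - 1)) (Ioi t) :=
      (integrableOn_Ioi_rpow_of_lt (by linarith) ht).const_mul _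
    have hv : ∫ s in Ioi t, t ^ b * s ^ (-b - 1) = b⁻¹ := by
      rw [integral_const_mul, integral_Ioi_rpow_of_lt (by linarith) ht, sub_add_cancel,
        Real.rpow_neg ht.le]
      have := (Real.rpow_pos_of_pos ht b).ne'
      field_simp
    rw [← hv, ofReal_integral_eq_lintegral_ofReal hi
      ((ae_restrict_mem measurableSet_Ioi).mono fun s hs => by
        have : 0 < s := ht.trans hs
        simp only [Pi.zero_apply]
        positivity)]
    refine setLIntegral_mono' measurableSet_Ioi fun s hs => ?_
    have hs' : 0 < s := ht.trans hs
    rw [← ENNReal.ofReal_mul (by positivity)]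
    refine ENNReal.ofReal_le_ofReal ?_
    calc s⁻¹ * min ((s / t) ^ a) ((s / t) ^ (-b)) ≤ s⁻¹ * (s / t) ^ (-b) :=
          mul_le_mul_of_nonneg_left (min_le_right _ _) (by positivity)
      _ = _ := by
          rw [Real.div_rpow hs'.le ht.le, Real.rpow_sub_one hs'.ne', Real.rpow_neg ht.le, div_inv_eq_mul]
          ring

theorem min_rpow_div_comm {a b s t : ℝ} (hs : 0 < s) (ht : 0 < t) :
    min ((t / s) ^ a) ((t / s) ^ (-b)) = min ((s / t) ^ b) ((s / t) ^ (-a)) := by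
  rw [← inv_div s t, Real.inv_rpow (by positivity), Real.inv_rpow (by positivity),
    ← Real.rpow_neg (by positivity), ← Real.rpow_neg (by positivity), neg_neg, min_comm]

theorem eLpNorm_haarMul_le_of_min_rpow {E F : Type*} [NormedAddCommGroup E] [NormedAddCommGroup F]
    {a b : ℝ} (ha : 0 < a) (hb : 0 < b) {p : ℝ≥0∞} (hp : 1 ≤ p) {f : ℝ → E}
    (hf : AEStronglyMeasurable f haarMul) {g : ℝ → F} {K : ℝ≥0}
    (hg : ∀ t : ℝ, 0 < t → ‖g t‖ₑ ≤
      K * ∫⁻ s, ENNReal.ofReal (min ((t / s) ^ a) ((t / s) ^ (-b))) * ‖f s‖ₑ ∂haarMul) :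
    eLpNorm g p haarMul ≤ K * ENNReal.ofReal (a⁻¹ + b⁻¹) * eLpNorm f p haarMul := by
  have hm : Measurable (Function.uncurry fun t s : ℝ =>
      ENNReal.ofReal (min ((t / s) ^ a) ((t / s) ^ (-b)))) := by
    unfold Function.uncurry
    fun_prop
  have hmt : ∀ t : ℝ, Measurable fun s : ℝ =>
      ENNReal.ofReal (min ((t / s) ^ a) ((t / s) ^ (-b))) := fun t => by fun_prop
  refine eLpNorm_le_of_kernel (κ := fun t s => K * ENNReal.ofReal (min ((t / s) ^ a) ((t / s) ^ (-b))))
    (hm.const_mul _) ?_ ?_ hp hf ?_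
  · refine ae_haarMul_of_forall_pos fun t ht => ?_
    rw [lintegral_const_mul _ (hmt t)]
    refine mul_le_mul' le_rfl (le_trans (le_of_eq ?_) ((lintegral_min_rpow_le hb ha ht).trans_eq
      (by rw [add_comm])))
    exact lintegral_congr_ae (ae_haarMul_of_forall_pos fun s hs => by
      simp only [min_rpow_div_comm hs ht])
  · refine ae_haarMul_of_forall_pos fun s hs => ?_
    rw [lintegral_const_mul _ (by fun_prop)]
    exact mul_le_mul' le_rfl (lintegral_min_rpow_le ha hb hs)
  · refine ae_haarMul_of_forall_pos fun t ht => (hg t ht).trans_eq ?_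
    simp only [mul_assoc]
    exact (lintegral_const_mul'' _ ((hmt t).aemeasurable.mul hf.enorm)).symm

end SchurTest

/-! ### Boundedness of W_C and L^p_*-estimates imply admissibility. -/

section Sufficiency

variable {X Y : Type*} [NormedAddCommGroup X] [NormedSpace ℂ X]
  [NormedAddCommGroup Y] [NormedSpace ℂ Y] {A : X →ₗ.[ℂ] X} {ω N ν θ : ℝ} {T : ℝ → X →L[ℂ] X}
  {k : ℕ} {ψ : ℂ → ℂ}

theorem IsSectorial.commute_unitResolvent_rayIntegral [CompleteSpace X] (hA : IsSectorial A ω)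
    (hψ : MemH0 ν ψ) (hν : ν ≤ Real.pi) {φ : ℝ} (h1 : ω < |φ|) (h2 : |φ| < ν) {s u : ℝ}
    (hs : 0 < s) (hu : 0 < u) : Commute (unitResolvent A u) (rayIntegral ψ A φ s) := by
  have hi := hA.integrableOn_rayIntegral hψ hν h1 h2 hs
  rw [Commute, SemiconjBy, rayIntegral, ← integral_const_mul_of_integrable hi,
    ← integral_mul_const_of_integrable hi]
  refine setIntegral_congr_fun measurableSet_Ioi fun r hr => ?_
  exact ((hA.commute_scaledResolvent_unitResolvent (z := r * ray φ)
    (by rwa [abs_arg_ofReal_mul_ray hr (h2.trans_le hν)]) hs hu).symm.smul_right _).eq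

theorem IsSectorial.commute_unitResolvent_dunford [CompleteSpace X] (hA : IsSectorial A ω)
    (hψ : MemH0 ν ψ) (hν : ν ≤ Real.pi) (hθ : ω < θ) (hθν : θ < ν) {s u : ℝ}
    (hs : 0 < s) (hu : 0 < u) :
    Commute (unitResolvent A u) (dunford θ (fun z => ψ (s * z)) A) := by
  have hθ0 : 0 < θ := hA.nonneg.trans_lt hθ
  rw [dunford_eq_rayIntegral ψ A θ hs]
  refine ((hA.commute_unitResolvent_rayIntegral hψ hν ?_ ?_ hs hu).sub_right
    (hA.commute_unitResolvent_rayIntegral hψ hν ?_ ?_ hs hu)).smul_right _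
  all_goals first | rwa [abs_neg, abs_of_pos hθ0] | rwa [abs_of_pos hθ0]

theorem IsBoundedAnalytic.map_nsmul (hA : IsSectorial A ω) (hT : IsBoundedAnalytic A T N) {t : ℝ}
    (ht : 0 ≤ t) (n : ℕ) : T (n * t) = T t ^ n := by
  induction n with
  | zero => simp [hT.map_zero]
  | succ n ih =>
    rw [Nat.cast_succ, add_mul, one_mul, hT.map_add hA (by positivity) ht, ih, pow_succ]

/-- T(t)(1 - J_s) = s J_s A T(t), and analyticity gives ‖A T(t)‖ ≤ N/t; the bound by a constant is
trivial. -/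
theorem IsBoundedAnalytic.exists_norm_mul_one_sub_le (hA : IsSectorial A ω)
    (hT : IsBoundedAnalytic A T N) : ∃ K : ℝ, 0 ≤ K ∧ ∀ t s : ℝ, 0 < t → 0 < s →
      ‖T t * (1 - unitResolvent A s)‖ ≤ K * min 1 (s / t) := by
  obtain ⟨M, hM1, hM⟩ := hA.exists_unitResolvent_bounds
  have hN : 0 ≤ N := (norm_nonneg _).trans (hT.norm_le 0 le_rfl)
  refine ⟨N * M, by positivity, fun t s ht hs => ?_⟩
  rw [mul_min_of_nonneg _ _ (by positivity), mul_one]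
  refine le_min ?_ ?_
  · exact (norm_mul_le _ _).trans
      (mul_le_mul (hT.norm_le t ht.le) (hM s hs).2 (norm_nonneg _) hN)
  · obtain ⟨D, -, hD, hDA⟩ := hT.deriv t ht
    have e : T t * (1 - unitResolvent A s) = (s : ℂ) • (unitResolvent A s * D) := by
      have hc : Commute (T t) (1 - unitResolvent A s) :=
        (Commute.one_right _).sub_right (hT.commute t ht.le s hs)
      rw [hc.eq]
      ext x
      obtain ⟨h, hx⟩ := hDA x
      have h2 := hA.unitResolvent_apply_add hs ⟨T t x, h⟩
      rw [hx, _root_.map_add, map_smul] at h2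
      rw [mul_apply_eq_comp, sub_apply, one_apply_eq_self, smul_apply, mul_apply_eq_comp,
        sub_eq_iff_eq_add']
      exact h2.symm
    rw [e, norm_smul, Complex.norm_real, Real.norm_of_nonneg hs.le]
    calc s * ‖unitResolvent A s * D‖ ≤ s * (M * (N / t)) :=
          mul_le_mul_of_nonneg_left ((norm_mul_le _ _).trans
            (mul_le_mul (hM s hs).1 hD (norm_nonneg _) (by positivity))) hs.le
      _ = N * M * (s / t) := by ring

/-- Splitting T(t) = T(t/k)^k gives each factor 1 - J_s its own piece of the semigroup; min(1, ks/t)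
≤ k min(1, s/t). -/
theorem IsBoundedAnalytic.exists_norm_mul_one_sub_pow_le (hA : IsSectorial A ω)
    (hT : IsBoundedAnalytic A T N) (hk : k ≠ 0) : ∃ K : ℝ, 0 ≤ K ∧ ∀ t s : ℝ, 0 < t → 0 < s →
      ‖T t * (1 - unitResolvent A s) ^ k‖ ≤ K * min 1 (s / t) ^ k := by
  obtain ⟨K, hK0, hK⟩ := hT.exists_norm_mul_one_sub_le hA
  have hk1 : (1 : ℝ) ≤ k := by exact_mod_cast Nat.one_le_iff_ne_zero.2 hk
  have hk0 : (0 : ℝ) < k := by linarith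
  refine ⟨(K * k) ^ k, by positivity, fun t s ht hs => ?_⟩
  have hc : Commute (T (t / k)) (1 - unitResolvent A s) :=
    (Commute.one_right _).sub_right (hT.commute _ (by positivity) s hs)
  have e : T t = T (t / k) ^ k := by
    rw [← hT.map_nsmul hA (by positivity), mul_div_cancel₀ _ hk0.ne']
  rw [e, ← hc.mul_pow, ← mul_pow]
  refine (norm_pow_le' _ (Nat.pos_of_ne_zero hk)).trans (pow_le_pow_left₀ (norm_nonneg _) ?_ k)
  refine (hK _ s (by positivity) hs).trans ?_
  rw [mul_assoc]
  refine mul_le_mul_of_nonneg_left ?_ hK0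
  rw [mul_min_of_nonneg _ _ hk0.le, mul_one]
  refine min_le_min hk1 (le_of_eq ?_)
  rw [div_div_eq_mul_div]
  ring

/-- The element of W_C at t = 1/s, where (t + A)⁻¹ = s J_s. The powers s^k and s^{-(k-α-1/p)}
combine to leave s^{-(α+1/p)} as the size of C J_s^k. -/
theorem IsSectorial.exists_norm_obsInv_le (hA : IsSectorial A ω) {C : DomSpace A k →L[ℂ] Y}
    {p : ℝ≥0∞} {α : ℝ} (hW : Bornology.IsBounded (weissSet p α A C)) :
    ∃ M : ℝ, 0 ≤ M ∧ ∀ s : ℝ, 0 < s → ∀ y : X,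
      ‖obsInv C ((unitResolvent A s ^ k) y)‖ ≤
        M * s ^ (-(α + (1 / p).toReal)) * ‖(unitResolvent A 1 ^ k) y‖ := by
  obtain ⟨M, hM0, hM⟩ := hW.exists_pos_norm_le
  refine ⟨M, hM0.le, fun s hs y => ?_⟩
  have hs' : (s : ℂ) ≠ 0 := by exact_mod_cast hs.ne'
  set γ := (k : ℝ) - α - (1 / p).toReal with hγ
  have h1 := hM _ ⟨s⁻¹, inv_pos.2 hs, rfl⟩
  have h2 := hA.obs_invShiftPow C (inv_pos.2 hs) y
  rw [invShift_eq_unitResolvent (inv_pos.2 hs), inv_inv, Complex.ofReal_inv, inv_inv, smul_pow,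
    smul_apply, map_smul] at h2
  rw [← hγ, norm_smul, Real.norm_of_nonneg (by positivity), Real.inv_rpow hs.le,
    Complex.ofReal_inv, inv_mul_le_iff₀ (by positivity)] at h1
  have h3 : s ^ k * ‖obsInv C ((unitResolvent A s ^ k) y)‖ ≤
      s ^ γ * M * ‖(unitResolvent A 1 ^ k) y‖ := by
    have h4 := congrArg norm h2
    rw [norm_smul, norm_pow, Complex.norm_real, Real.norm_of_nonneg hs.le] at h4
    rw [← h4]
    exact (ContinuousLinearMap.le_opNorm (C ∘L invShiftPow A (s : ℂ)⁻¹ k) _).trans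
      (mul_le_mul_of_nonneg_right h1 (norm_nonneg _))
  have e : -(α + (1 / p).toReal) = γ - k := by rw [hγ]; ring
  rw [e, Real.rpow_sub hs, Real.rpow_natCast, mul_div_assoc', div_mul_eq_mul_div,
    le_div_iff₀' (by positivity), mul_comm M]
  exact h3

theorem rpow_mul_min_pow_le {a u : ℝ} (hu : 0 < u) (k : ℕ) :
    u ^ a * min 1 u⁻¹ ^ k ≤ min (u ^ a) (u ^ (-(k - a))) := by
  have h0 : 0 ≤ min 1 u⁻¹ := le_min zero_le_one (by positivity)
  refine le_min ?_ ?_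
  · exact mul_le_of_le_one_right (by positivity) (pow_le_one₀ h0 (min_le_left _ _))
  · rw [neg_sub, Real.rpow_sub hu, Real.rpow_natCast, div_eq_mul_inv, ← inv_pow]
    exact mul_le_mul_of_nonneg_left (pow_le_pow_left₀ h0 (min_le_right _ _) k) (by positivity)

/-- The central estimate: the reproducing formula inserted into C T(t)x. The kernel depends only on
t/s because the s^{-a} lost to C and the weight t^a combine to (t/s)^a. -/
theorem IsBoundedAnalytic.exists_enorm_obsInv_le [CompleteSpace X] [CompleteSpace Y]
    (hA : IsSectorial A ω) (hT : IsBoundedAnalytic A T N) (hk : 1 ≤ k)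
    {C : DomSpace A k →L[ℂ] Y} {p : ℝ≥0∞} {α : ℝ}
    (hW : Bornology.IsBounded (weissSet p α A C)) (hψ : MemH0 ν ψ)
    (hne : ∃ z ∈ sector ν, ψ z ≠ 0) (hν : ν < Real.pi) (hθ : ω < θ) (hθν : θ < ν) :
    ∃ K : ℝ≥0, ∀ y ∈ core A, ∀ t : ℝ, 0 < t →
      ‖t ^ (α + (1 / p).toReal) • obsInv C (T t y)‖ₑ ≤
        K * ∫⁻ s, ENNReal.ofReal (min ((t / s) ^ (α + (1 / p).toReal))
          ((t / s) ^ (-(k - (α + (1 / p).toReal))))) *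
          ‖dunford θ (fun z => ψ (s * z)) A ((unitResolvent A 1 ^ k) y)‖ₑ ∂haarMul := by
  have hν0 : 0 < ν := (hA.nonneg.trans_lt hθ).trans hθν
  -- With k = j + 1, `betaOp A j (j + n)` contains exactly k factors 1 - J_s and k + n factors J_s.
  obtain ⟨j, rfl⟩ : ∃ j, k = j + 1 := ⟨k - 1, by omega⟩
  obtain ⟨n, hn⟩ := hψ.exists_moment_ne_zero hν0 hν.le hne j j
  obtain ⟨M, hM0, hM⟩ := hA.exists_norm_obsInv_le hW
  obtain ⟨K, hK0, hK⟩ := hT.exists_norm_mul_one_sub_pow_le hA (Nat.succ_ne_zero j)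
  obtain ⟨R, hR1, hR⟩ := hA.exists_unitResolvent_bounds
  set a := α + (1 / p).toReal with ha
  set c := moment ψ j (j + n) with hc
  set B := ‖c‖⁻¹ * (M * K * R ^ n) with hB
  have hB0 : 0 ≤ B := by positivity
  refine ⟨B.toNNReal, fun y hy t ht => ?_⟩
  set x := (unitResolvent A 1 ^ (j + 1)) y with hx
  set Ψ : ℝ → X →L[ℂ] X := fun s => dunford θ (fun z => ψ (s * z)) A with hΨ
  obtain ⟨hi, hI⟩ := hA.integral_betaOp_dunford hψ hν hθ hθν j (j + n) hy
  have hkey : ∀ s : ℝ, 0 < s → ‖obsInv C (T t (betaOp A j (j + n) s (Ψ s y)))‖ ≤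
      M * s ^ (-a) * (K * min 1 (s / t) ^ (j + 1) * (R ^ n * ‖Ψ s x‖)) := by
    intro s hs
    have c1 := hT.commute t ht.le s hs
    have c3 : Commute (unitResolvent A 1) (unitResolvent A s) :=
      hA.commute_unitResolvent one_pos hs
    have c4 : Commute (unitResolvent A 1) (1 - unitResolvent A s) :=
      (Commute.one_right _).sub_right c3
    set V := T t * (1 - unitResolvent A s) ^ (j + 1) with hV
    -- J_s^k is moved left to be absorbed by C, (1 - J_s)^k stays with T(t), and J_s^n is left over.
    have e1 : T t * betaOp A j (j + n) s =
        unitResolvent A s ^ (j + 1) * (V * unitResolvent A s ^ n) := by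
      rw [betaOp, show j + n + 1 = (j + 1) + n by ring,
        pow_add (unitResolvent A s), ← mul_assoc, ← mul_assoc,
        ← mul_assoc, ← hV, ((c1.symm.pow_left (j + 1)).mul_right
          ((commute_one_sub_self (unitResolvent A s)).symm.pow_pow (j + 1) (j + 1))).eq]
    have e2 : (unitResolvent A 1 ^ (j + 1)) ((V * unitResolvent A s ^ n) (Ψ s y)) =
        V ((unitResolvent A s ^ n) (Ψ s x)) := by
      have c5 : Commute (unitResolvent A 1) (V * unitResolvent A s ^ n * Ψ s) :=
        ((((hT.commute t ht.le 1 one_pos).symm).mul_right (c4.pow_right _)).mul_right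
          (c3.pow_right n)).mul_right (hA.commute_unitResolvent_dunford hψ hν.le hθ hθν hs one_pos)
      exact DFunLike.congr_fun (c5.pow_left (j + 1)).eq y
    rw [← mul_apply_eq_comp, e1, mul_apply_eq_comp]
    refine (hM s hs _).trans (mul_le_mul_of_nonneg_left ?_ (by positivity))
    rw [e2]
    exact (ContinuousLinearMap.le_opNorm _ _).trans
      (mul_le_mul (hK t s ht hs) (norm_pow_apply_le (hR s hs).1 n _) (norm_nonneg _)
        (by have : 0 ≤ min 1 (s / t) := le_min zero_le_one (by positivity)
            positivity))
  have hrep : t ^ a • obsInv C (T t y) = ∫ s in Ioi (0 : ℝ), c⁻¹ • t ^ a • (s : ℂ)⁻¹ •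
      obsInv C (T t (betaOp A j (j + n) s (Ψ s y))) := by
    have h := congrArg (obsInv C ∘L T t) hI
    rw [← ContinuousLinearMap.integral_comp_comm _ hi, map_smul] at h
    simp only [map_smul, ContinuousLinearMap.comp_apply] at h
    rw [integral_smul, integral_smul, h, smul_comm (t ^ a) c, smul_smul, inv_mul_cancel₀ hn,
      one_smul]
  rw [hrep]
  refine (enorm_integral_le_lintegral_enorm _).trans ?_
  rw [lintegral_haarMul, ← lintegral_const_mul' _ _ ENNReal.coe_ne_top]
  refine setLIntegral_mono' measurableSet_Ioi fun s hs => ?_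
  have hs' : (0 : ℝ) < s := hs
  rw [← ofReal_norm, ← ofReal_norm, show ((B.toNNReal : ℝ≥0) : ℝ≥0∞) = ENNReal.ofReal B from rfl,
    ← ENNReal.ofReal_mul (by positivity), ← ENNReal.ofReal_mul (by positivity),
    ← ENNReal.ofReal_mul (by positivity)]
  refine ENNReal.ofReal_le_ofReal ?_
  rw [norm_smul, norm_smul, norm_smul, norm_inv, norm_inv, Complex.norm_real,
    Real.norm_of_nonneg hs'.le, Real.norm_of_nonneg (by positivity : 0 ≤ t ^ a)]
  have hmin := rpow_mul_min_pow_le (a := a) (div_pos ht hs') (j + 1)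
  rw [inv_div] at hmin
  calc ‖c‖⁻¹ * (t ^ a * (s⁻¹ * ‖obsInv C (T t (betaOp A j (j + n) s (Ψ s y)))‖))
      ≤ ‖c‖⁻¹ * (t ^ a * (s⁻¹ * (M * s ^ (-a) *
          (K * min 1 (s / t) ^ (j + 1) * (R ^ n * ‖Ψ s x‖))))) := by
        have := hkey s hs'
        gcongr
    _ = B * (s⁻¹ * ((t / s) ^ a * min 1 (s / t) ^ (j + 1) * ‖Ψ s x‖)) := by
        rw [hB, Real.div_rpow ht.le hs'.le, Real.rpow_neg hs'.le]
        ring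
    _ ≤ B * (s⁻¹ * (min ((t / s) ^ a) ((t / s) ^ (-(((j + 1 : ℕ) : ℝ) - a))) * ‖Ψ s x‖)) := by
        gcongr

theorem IsBoundedAnalytic.aestronglyMeasurable_obsInv (hT : IsBoundedAnalytic A T N)
    (C : DomSpace A k →L[ℂ] Y) (α τ : ℝ) (y : X) :
    AEStronglyMeasurable (fun t : ℝ => t ^ α • obsInv C (T t y)) (volume.restrict (Icc 0 τ)) := by
  rw [← Measure.restrict_congr_set Ioc_ae_eq_Icc]
  have hr : ContinuousOn (fun t : ℝ => t ^ α) (Ioc 0 τ) := fun t ht =>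
    (Real.continuousAt_rpow_const _ _ (Or.inl ht.1.ne')).continuousWithinAt
  exact (hr.smul ((obsInv C).continuous.comp_continuousOn ((hT.continuousOn_apply y).mono
    (Ioc_subset_Icc_self.trans Icc_subset_Ici_self)))).aestronglyMeasurable measurableSet_Ioc

theorem isLpAdmissible_of_isBounded_weissSet [CompleteSpace X] [CompleteSpace Y] {p : ℝ≥0∞}
    (hp : 1 ≤ p) (hA : IsSectorial A ω) (hω : ω < Real.pi / 2) (hdom : Dense (A.domain : Set X))
    (hran : DenseRange fun x : A.domain => A x) (hk : 1 ≤ k) {C : DomSpace A k →L[ℂ] Y} {α : ℝ}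
    (hα : -(1 / p).toReal < α) (hα' : α < k - (1 / p).toReal) (hE : HasLpStarEstimates p A)
    (hW : Bornology.IsBounded (weissSet p α A C)) : IsLpAdmissible p α A C := by
  obtain ⟨T, N, hT⟩ := hA.exists_isBoundedAnalytic hω hdom
  obtain ⟨ω', θ, ν, hA', hθ, hθν, hν, ψ, hψ, hne, L, hL⟩ := hE
  -- The angle ω' in the L^p_*-estimate need not be ω. The regularity recorded for T does not
  -- involve the angle, so T can be used together with ω'.
  obtain ⟨K, hK⟩ := hT.exists_enorm_obsInv_le hA' hk hW hψ hne hν hθ hθν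
  set a := α + (1 / p).toReal with ha
  have ha0 : 0 < a := by linarith
  have hb0 : 0 < k - a := by linarith
  set M : ℝ≥0 := K * (a⁻¹ + (k - a)⁻¹).toNNReal * L with hM
  refine ⟨fun t => T t, hT.isSemigroup hA, M, fun τ hτ x => ?_⟩
  have hcore : ∀ y ∈ core A, eLpNorm (fun t : ℝ => t ^ α • obsInv C (T t y)) p
      (volume.restrict (Icc 0 τ)) ≤ M * ‖(unitResolvent A 1 ^ k) y‖ₑ := by
    intro y hy
    obtain ⟨hL1, hL2⟩ := hL ((unitResolvent A 1 ^ k) y)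
    refine (eLpNorm_rpow_smul_le_haarMul hp α τ _).trans
      ((eLpNorm_haarMul_le_of_min_rpow ha0 hb0 hp hL1.1 (hK y hy)).trans ?_)
    rw [hM, ENNReal.coe_mul, ENNReal.coe_mul, mul_assoc _ (L : ℝ≥0∞)]
    exact mul_le_mul' le_rfl hL2
  set y := DomSpace.toX A k x with hy
  have hxy : DomSpace.incl A k x = (unitResolvent A 1 ^ k) y := (hA.unitResolvent_pow_toX k x).symm
  have hmeas := hT.aestronglyMeasurable_obsInv C α τ y
  have hbd : eLpNorm (fun t : ℝ => t ^ α • obsInv C (T t y)) p (volume.restrict (Icc 0 τ)) ≤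
      M * ‖(unitResolvent A 1 ^ k) y‖ₑ := by
    -- The approximation is of y = (1 + A)^k x by elements of `core A`: the observed orbits converge
    -- pointwise in t, and Fatou's lemma preserves the bound.
    obtain ⟨v, hv, hvy⟩ := mem_closure_iff_seq_limit.1 (hA.dense_core hdom hran y)
    have hlim : Tendsto (fun n => (M : ℝ≥0∞) * ‖(unitResolvent A 1 ^ k) (v n)‖ₑ) atTop
        (𝓝 (M * ‖(unitResolvent A 1 ^ k) y‖ₑ)) :=
      ENNReal.Tendsto.const_mul
        (((unitResolvent A 1 ^ k).continuous.enorm.tendsto y).comp hvy) (Or.inr ENNReal.coe_ne_top)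
    refine (Lp.eLpNorm_lim_le_liminf_eLpNorm
      (fun n => hT.aestronglyMeasurable_obsInv C α τ (v n)) _ (Eventually.of_forall fun t =>
        ((((obsInv C ∘L T t).continuous.tendsto y).comp hvy).const_smul (t ^ α)))).trans ?_
    rw [← hlim.liminf_eq]
    exact liminf_le_liminf (Eventually.of_forall fun n => hcore _ (hv n))
  have hcongr : (fun t : ℝ => t ^ α • obsInv C (T t y)) =ᵐ[volume.restrict (Icc 0 τ)]
      fun t : ℝ => t ^ α • C ((hT.isSemigroup hA).onDom k t.toNNReal x) := by
    filter_upwards [ae_restrict_mem measurableSet_Icc] with t ht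
    rw [hT.obs_onDom hA (hT.isSemigroup hA) (fun _ => rfl), Real.coe_toNNReal _ ht.1]
  rw [← eLpNorm_congr_ae hcongr, hxy]
  exact ⟨⟨hmeas.congr hcongr, by
    rw [← eLpNorm_congr_ae hcongr]
    exact hbd.trans_lt (ENNReal.mul_lt_top ENNReal.coe_lt_top enorm_lt_top)⟩, hbd⟩

end Sufficiency

end SectorialObs

end

theorem theorem1p5 {X Y : Type*}
    [NormedAddCommGroup X] [NormedSpace ℂ X] [CompleteSpace X]
    [NormedAddCommGroup Y] [NormedSpace ℂ Y] [CompleteSpace Y]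
    (p : ℝ≥0∞) (hp : 1 ≤ p)
    (A : X →ₗ.[ℂ] X) (ω : ℝ) (hA : SectorialObs.IsSectorial A ω) (hω : ω < Real.pi / 2)
    (hdom : Dense (A.domain : Set X)) (hran : DenseRange fun x : A.domain => A x)
    (k : ℕ) (hk : 1 ≤ k) (C : SectorialObs.DomSpace A k →L[ℂ] Y)
    (α : ℝ) (hα : -(1 / p).toReal < α) (hα' : α < k - (1 / p).toReal) :
    (SectorialObs.IsLpAdmissible p α A C →
      Bornology.IsBounded (SectorialObs.weissSet p α A C)) ∧
    (SectorialObs.HasLpStarEstimates p A →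
      Bornology.IsBounded (SectorialObs.weissSet p α A C) →
      SectorialObs.IsLpAdmissible p α A C) := by
  exact ⟨SectorialObs.isBounded_weissSet_of_isLpAdmissible hp hA hω hdom hk hα',
    SectorialObs.isLpAdmissible_of_isBounded_weissSet hp hA hω hdom hran hk hα hα'⟩
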